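/- Let $G$ be a compact Lie group with Lie algebra $\mathfrak g$, let $K\subset G$ be a closed subgroup, and let $dg$, $dk$ be the normalized Haar measures. Let $E,F\to G/K$ be the homogeneous vector bundles associated to finite-dimensional unitary representations $\tau$, $\rho$ of $K$ on $E_0$, $F_0$ (irreducible ones, for instance). Identify the space $\Gamma(E)$ of smooth sections of $E$, with its $C^\infty$ topology, with the space of smooth $u:G\to E_0$ such that $u(gk)=\tau(k)^{-1}u(g)$ for $g\in G$, $k\in K$, and put $(u,v)_{L^2(E)}=\int_G\langle u(g),v(g)\rangle\,dg$; likewise for $F$. An element $X\in\mathfrak g$ acts on functions on $G$ as a left-invariant vector field, $(Xf)(g)=\frac{d}{dt}\big|_{t=0}f(g\exp tX)$. Fix a bi-invariant inner product on $\mathfrak g$, with an orthonormal basis $Y_1,\dots,Y_n$, and let $\mathcal L=-(Y_1^2+\dots+Y_n^2)$. For each class in the unitary dual $\widehat G$ fix a representative $\lambda:G\to U(d_\lambda)$. Let $c_\lambda\ge 0$ be the number with $\mathcal L\lambda_{ij}=c_\lambda\lambda_{ij}$ for all matrix coefficients of $\lambda$, and put $\langle\lambda\rangle=(1+c_\lambda)^{1/2}$.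 For $s\in\mathbb R$ let $\Xi^s=(1+\mathcal L)^{s/2}$, that is, $$\Xi^su(x)=\sum_{\lambda\in\widehat G}\langle\lambda\rangle^s\,d_\lambda\operatorname{Tr}\big(\lambda(x)\,\widehat u(\lambda)\big),\qquad \widehat u(\lambda)=\int_Gu(y)\,\lambda(y)^*\,dy .$$ The Sobolev space $H^s(E)$ is the completion of $\Gamma(E)$ with respect to the norm $\|u\|_s=\|\Xi^su\|_{L^2(E)}$; likewise for $F$. Let $A:\Gamma(E)\to\Gamma(F)$ be a continuous linear operator (not necessarily $G$-invariant). Its Schwartz kernel, lifted to $G\times G$, lets $A$ act on all smooth functions $f:G\to E_0$ by $Af:=A(Pf)$, where $Pf(x)=\int_K\tau(k)f(xk)\,dk$ is the projection to $\Gamma(E)$. The symbol of $A$ is $$\sigma_A(\lambda,x)\in\operatorname{End}(\mathbb C^{d_\lambda})\otimes\operatorname{Hom}(E_0,F_0)=\operatorname{Hom}(\mathbb C^{d_\lambda}\otimes E_0,\ \mathbb C^{d_\lambda}\otimes F_0),$$ $$\sigma_A(\lambda,x)_{ij}\,e=\sum_{p=1}^{d_\lambda}\overline{\lambda_{pi}(x)}\,\big(A(\lambda_{pj}\,e)\big)(x)\qquad(e\in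 E_0).$$ Theorem. Let $X_1,\dots,X_n$ be a basis of $\mathfrak g$ and $m\in\mathbb R$. Suppose that for every multi-index $\alpha\in\mathbb N^n$ there is a constant $C_\alpha$ such that, with the operator norm and $X^\alpha=X_1^{\alpha_1}\cdots X_n^{\alpha_n}$ acting in the variable $x$, $$\big\|X^\alpha\sigma_A(\lambda,x)\big\|\le C_\alpha\langle\lambda\rangle^m\qquad\text{for all }x\in G,\ \lambda\in\widehat G .$$ Then, for every $s\in\mathbb R$, $A$ extends to a bounded linear operator $H^s(E)\to H^{s-m}(F)$. -/

import Mathlib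

open MeasureTheory
open scoped Manifold ContDiff

noncomputable section

namespace HomogeneousBundle

/-! ### Left-invariant differential operators on a Lie group -/

section LieGroup

variable {V : Type*} [NormedAddCommGroup V] [NormedSpace ℝ V]
  {G : Type*} [TopologicalSpace G] [ChartedSpace V G] [Group G]
  {W : Type*} [NormedAddCommGroup W] [NormedSpace ℝ W]

/-- The derivative `X f` of a vector-valued function along the left-invariant vector field which
extends `X ∈ 𝔤`, that is, `(X f)(g) = d/dt f(g exp(tX))` at `t = 0`. -/
def lieDeriv (X : GroupLieAlgebra 𝓘(ℝ, V) G) (f : G → W) (g : G) : W :=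
  mfderiv 𝓘(ℝ, V) 𝓘(ℝ, W) f g (mulInvariantVectorField X g)

/-- The iterated derivative `X₁ X₂ ⋯ X_k f` for a list `[X₁, …, X_k]` in `𝔤`. -/
def lieDerivs : List (GroupLieAlgebra 𝓘(ℝ, V) G) → (G → W) → G → W
  | [], f => f
  | X :: l, f => lieDeriv X (lieDerivs l f)

/-- The derivative `X^α f = X₁^{α₁} ⋯ X_n^{α_n} f` for a multi-index `α`. -/
def multiDeriv {n : ℕ} (X : Fin n → GroupLieAlgebra 𝓘(ℝ, V) G) (α : Fin n → ℕ) (f : G → W) :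
    G → W :=
  lieDerivs ((List.finRange n).flatMap fun i => List.replicate (α i) (X i)) f

/-- The adjoint action `Ad g X` of `G` on its Lie algebra: the derivative at `1` of the
conjugation `x ↦ g x g⁻¹`. -/
def Ad (g : G) (X : GroupLieAlgebra 𝓘(ℝ, V) G) : GroupLieAlgebra 𝓘(ℝ, V) G :=
  mfderiv 𝓘(ℝ, V) 𝓘(ℝ, V) (fun x : G => g * x * g⁻¹) 1 X

/-- A bilinear form on `𝔤` is bi-invariant if it is invariant under the adjoint action of `G`. -/
def IsBiInvariant (B : LinearMap.BilinForm ℝ (GroupLieAlgebra 𝓘(ℝ, V) G)) : Prop :=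
  ∀ (g : G) (X Y : GroupLieAlgebra 𝓘(ℝ, V) G), B (Ad g X) (Ad g Y) = B X Y

/-- The operator `-(Y₁² + ⋯ + Y_n²)`; it is the Laplacian if `Y` is an orthonormal basis of `𝔤`
with respect to a bi-invariant inner product. -/
def laplacian {n : ℕ} (Y : Fin n → GroupLieAlgebra 𝓘(ℝ, V) G) (f : G → W) (x : G) : W :=
  -∑ i, lieDeriv (Y i) (lieDeriv (Y i) f) x

end LieGroup

/-! ### The unitary dual -/

section Dual

/-- A continuous irreducible unitary representation of `G` on `ℂ^dim`. (All irreducible unitary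
representations of a compact group are of this form, up to equivalence.) -/
structure UnitaryIrrep (G : Type*) [Group G] [TopologicalSpace G] where
  dim : ℕ
  toHom : G →* Matrix.unitaryGroup (Fin dim) ℂ
  continuous_toHom : Continuous toHom
  dim_pos : 0 < dim
  irreducible : ∀ S : Submodule ℂ (Fin dim → ℂ),
    (∀ g : G, ∀ v ∈ S, Matrix.mulVec (toHom g : Matrix (Fin dim) (Fin dim) ℂ) v ∈ S) →
      S = ⊥ ∨ S = ⊤

variable {G : Type*} [Group G] [TopologicalSpace G]

/-- The matrix coefficient `x ↦ ξ_{ij}(x)`. -/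
def UnitaryIrrep.coeff (ξ : UnitaryIrrep G) (i j : Fin ξ.dim) (x : G) : ℂ :=
  (ξ.toHom x : Matrix (Fin ξ.dim) (Fin ξ.dim) ℂ) i j

/-- Equivalence of representations: there is an invertible intertwining operator. -/
def UnitaryIrrep.Equivalent (ξ η : UnitaryIrrep G) : Prop :=
  ∃ T : (Fin ξ.dim → ℂ) ≃ₗ[ℂ] (Fin η.dim → ℂ), ∀ (g : G) (v : Fin ξ.dim → ℂ),
    T (Matrix.mulVec (ξ.toHom g : Matrix (Fin ξ.dim) (Fin ξ.dim) ℂ) v) =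
      Matrix.mulVec (η.toHom g : Matrix (Fin η.dim) (Fin η.dim) ℂ) (T v)

instance UnitaryIrrep.setoid (G : Type*) [Group G] [TopologicalSpace G] :
    Setoid (UnitaryIrrep G) where
  r := UnitaryIrrep.Equivalent
  iseqv :=
    { refl := fun _ => ⟨LinearEquiv.refl ℂ _, fun _ _ => rfl⟩
      symm := by
        rintro ξ η ⟨T, hT⟩
        refine ⟨T.symm, fun g v => ?_⟩
        rw [LinearEquiv.symm_apply_eq, hT, LinearEquiv.apply_symm_apply]
      trans := by
        rintro ξ η ζ ⟨T, hT⟩ ⟨S, hS⟩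
        refine ⟨T.trans S, fun g v => ?_⟩
        simp only [LinearEquiv.trans_apply, hT, hS] }

/-- The unitary dual `Ĝ`: the set of equivalence classes of irreducible unitary representations. -/
def UnitaryDual (G : Type*) [Group G] [TopologicalSpace G] : Type _ :=
  Quotient (UnitaryIrrep.setoid G)

/-- A representative of a class `ξ ∈ Ĝ`. -/
def UnitaryDual.rep (ξ : UnitaryDual G) : UnitaryIrrep G := Quotient.out ξ

variable {V : Type*} [NormedAddCommGroup V] [NormedSpace ℝ V] [ChartedSpace V G]

open Classical in
/-- The number `c_ξ` with `𝓛 ξ_{ij} = c_ξ ξ_{ij}` for all matrix coefficients of `ξ`, where `𝓛` is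
the Laplacian (such a number exists, and is unique, if `Y` is an orthonormal basis of `𝔤` for a
bi-invariant inner product on the Lie algebra of a Lie group). -/
def UnitaryIrrep.eigenvalue {n : ℕ} (Y : Fin n → GroupLieAlgebra 𝓘(ℝ, V) G)
    (ξ : UnitaryIrrep G) : ℂ :=
  if h : ∃ c : ℂ, ∀ i j, laplacian Y (ξ.coeff i j) = fun x => c * ξ.coeff i j x then h.choose
  else 0

/-- The weight `⟨ξ⟩ = (1 + |c_ξ|)^{1/2}`, the eigenvalue of `(1 + 𝓛)^{1/2}` on the matrix
coefficients of `ξ`. -/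
def UnitaryIrrep.weight {n : ℕ} (Y : Fin n → GroupLieAlgebra 𝓘(ℝ, V) G)
    (ξ : UnitaryIrrep G) : ℝ :=
  Real.sqrt (1 + ‖ξ.eigenvalue Y‖)

end Dual

/-! ### Smooth sections of a homogeneous vector bundle -/

section Sections

variable {V : Type*} [NormedAddCommGroup V] [NormedSpace ℝ V]
  {G : Type*} [TopologicalSpace G] [ChartedSpace V G] [Group G] {K : Subgroup G}
  {E₀ : Type*} [NormedAddCommGroup E₀] [InnerProductSpace ℂ E₀]

/-- The smooth functions `u : G → E₀` with `u(gk) = τ(k)⁻¹ u(g)`. -/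
def sectionSubmodule (V : Type*) [NormedAddCommGroup V] [NormedSpace ℝ V] [ChartedSpace V G]
    (τ : K →* (E₀ ≃ₗᵢ[ℂ] E₀)) : Submodule ℂ (G → E₀) where
  carrier := {u | ContMDiff 𝓘(ℝ, V) 𝓘(ℝ, E₀) ∞ u ∧ ∀ (g : G) (k : K), u (g * k) = (τ k)⁻¹ (u g)}
  add_mem' := by
    rintro u v ⟨hu, hu'⟩ ⟨hv, hv'⟩
    exact ⟨hu.add hv, fun g k => by simp [hu', hv']⟩
  zero_mem' := ⟨contMDiff_const, fun g k => by simp⟩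
  smul_mem' := by
    rintro c u ⟨hu, hu'⟩
    refine ⟨?_, fun g k => by simp [hu']⟩
    exact ((c • ContinuousLinearMap.id ℂ E₀).restrictScalars ℝ).contMDiff.comp hu

/-- The space `Γ(E)` of smooth sections of the homogeneous vector bundle `E = G ×_τ E₀` over `G/K`
associated to the representation `τ` of `K` on `E₀`: a section is the same thing as a smooth
function `u : G → E₀` with `u(gk) = τ(k)⁻¹ u(g)`. -/
def SmoothSection (V : Type*) [NormedAddCommGroup V] [NormedSpace ℝ V] [ChartedSpace V G]
    (τ : K →* (E₀ ≃ₗᵢ[ℂ] E₀)) : Type _ :=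
  ↥(sectionSubmodule V τ)

variable (τ : K →* (E₀ ≃ₗᵢ[ℂ] E₀))

instance : AddCommGroup (SmoothSection V τ) :=
  inferInstanceAs (AddCommGroup ↥(sectionSubmodule V τ))

instance : Module ℂ (SmoothSection V τ) :=
  inferInstanceAs (Module ℂ ↥(sectionSubmodule V τ))

instance : CoeFun (SmoothSection V τ) (fun _ => G → E₀) := ⟨fun u => u.1⟩

/-- The `C^∞` topology of `Γ(E)`: uniform convergence on `G` of all iterated derivatives along
left-invariant vector fields. -/
instance : TopologicalSpace (SmoothSection V τ) :=
  ⨅ l : List (GroupLieAlgebra 𝓘(ℝ, V) G),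
    TopologicalSpace.induced
      (fun u : SmoothSection V τ => UniformFun.ofFun (lieDerivs l u.1))
      (inferInstance : TopologicalSpace (UniformFun G E₀))

variable [MeasurableSpace G]

open Classical in
/-- The orthogonal projection of `f : G → E₀` to `Γ(E)`, given by
`x ↦ ∫_K τ(k) f(xk) dk` (which lies in `Γ(E)` whenever `f` is smooth and `K` is closed). -/
def proj (κ : Measure K) (f : G → E₀) : SmoothSection V τ :=
  if h : (fun x => ∫ k, τ k (f (x * k)) ∂κ) ∈ sectionSubmodule V τ then ⟨_, h⟩ else 0

end Sections

/-! ### The symbol of an operator -/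

section Symbol

variable {V : Type*} [NormedAddCommGroup V] [NormedSpace ℝ V]
  {G : Type*} [TopologicalSpace G] [ChartedSpace V G] [Group G] [MeasurableSpace G]
  {K : Subgroup G}
  {E₀ : Type*} [NormedAddCommGroup E₀] [InnerProductSpace ℂ E₀] [FiniteDimensional ℂ E₀]
  {F₀ : Type*} [NormedAddCommGroup F₀] [InnerProductSpace ℂ F₀]
  {τ : K →* (E₀ ≃ₗᵢ[ℂ] E₀)} {ρ : K →* (F₀ ≃ₗᵢ[ℂ] F₀)}

/-- The block `σ_A(ξ, x)_{mn} ∈ Hom(E₀, F₀)` of the symbol of `A : Γ(E) → Γ(F)`, that is, of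
`σ_A(ξ, x) = ξ(x)* A(ξ ⊗ ·)(x)`. On a basis vector `e` of `E₀` it is
`∑_p conj(ξ_{pm}(x)) A(ξ_{pn} e)(x)`. Here `A` acts on functions `G → E₀` which are not
`K`-equivariant through its Schwartz kernel, which is the same as to project to `Γ(E)` first. -/
def symbolBlock (κ : Measure K) (A : SmoothSection V τ →ₗ[ℂ] SmoothSection V ρ)
    (ξ : UnitaryIrrep G) (x : G) (m n : Fin ξ.dim) : E₀ →ₗ[ℂ] F₀ :=
  (stdOrthonormalBasis ℂ E₀).toBasis.constr ℂ fun a =>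
    ∑ p, star (ξ.coeff p m x) •
      A (proj τ κ fun y => ξ.coeff p n y • stdOrthonormalBasis ℂ E₀ a) x

/-- The symbol `σ_A(ξ, x) ∈ End(ℂ^d) ⊗ Hom(E₀, F₀) = Hom(ℂ^d ⊗ E₀, ℂ^d ⊗ F₀)` with `d = dim ξ`,
with its operator norm. Here the Hilbert space `ℂ^d ⊗ E₀` is written as the orthogonal sum of `d`
copies of `E₀`. -/
def symbol (κ : Measure K) (A : SmoothSection V τ →ₗ[ℂ] SmoothSection V ρ)
    (ξ : UnitaryIrrep G) (x : G) :
    PiLp 2 (fun _ : Fin ξ.dim => E₀) →L[ℂ] PiLp 2 (fun _ : Fin ξ.dim => F₀) :=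
  LinearMap.toContinuousLinearMap
    { toFun := fun v => WithLp.toLp 2 fun m => ∑ n, symbolBlock κ A ξ x m n (v n)
      map_add' := fun v w => by
        ext m
        simp [Finset.sum_add_distrib]
      map_smul' := fun c v => by
        ext m
        simp [Finset.smul_sum] }

end Symbol

/-! ### Sobolev spaces -/

section Sobolev

variable {V : Type*} [NormedAddCommGroup V] [NormedSpace ℝ V]
  {G : Type*} [TopologicalSpace G] [ChartedSpace V G] [Group G] [MeasurableSpace G]
  {K : Subgroup G}
  {E₀ : Type*} [NormedAddCommGroup E₀] [InnerProductSpace ℂ E₀]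

/-- The entry `(i, j)` of the Fourier coefficient `û(ξ) = ∫_G u(y) ξ(y)* dy`, an element of
`E₀`. -/
def fourierCoeff (μ : Measure G) (ξ : UnitaryIrrep G) (u : G → E₀) (i j : Fin ξ.dim) : E₀ :=
  ∫ y, star (ξ.coeff j i y) • u y ∂μ

/-- The component `dim(ξ) Tr(ξ(x) û(ξ))` of the Fourier series of `u`. -/
def fourierTerm (μ : Measure G) (ξ : UnitaryIrrep G) (u : G → E₀) (x : G) : E₀ :=
  (ξ.dim : ℂ) • ∑ i, ∑ j, ξ.coeff i j x • fourierCoeff μ ξ u j i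

variable {n : ℕ} (Y : Fin n → GroupLieAlgebra 𝓘(ℝ, V) G) (s : ℝ)

/-- The component at `ξ` of `(1 + 𝓛)^{s/2} u`. -/
def xiTerm (μ : Measure G) (u : G → E₀) (x : G) (ξ : UnitaryDual G) : E₀ :=
  (((ξ.rep.weight Y) ^ s : ℝ) : ℂ) • fourierTerm μ ξ.rep u x

/-- The operator `Ξ^s = (1 + 𝓛)^{s/2}`, which acts on the Fourier series of `u` by
`Ξ^s u (x) = ∑_ξ ⟨ξ⟩^s dim(ξ) Tr(ξ(x) û(ξ))`. -/
def xiPow (μ : Measure G) (u : G → E₀) (x : G) : E₀ :=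
  ∑' ξ : UnitaryDual G, xiTerm Y s μ u x ξ

section Linear

set_option linter.unusedSectionVars false

variable [CompactSpace G] [BorelSpace G]
  (μ : Measure G) [IsFiniteMeasure μ] (τ : K →* (E₀ ≃ₗᵢ[ℂ] E₀))

lemma UnitaryIrrep.continuous_coeff (ξ : UnitaryIrrep G) (i j : Fin ξ.dim) :
    Continuous (ξ.coeff i j) :=
  (continuous_subtype_val.comp ξ.continuous_toHom).matrix_elem i j

lemma integrable_coeff_smul (ξ : UnitaryIrrep G) (i j : Fin ξ.dim) {u : G → E₀}
    (hu : Continuous u) : Integrable (fun y => star (ξ.coeff i j y) • u y) μ := by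
  exact (((ξ.continuous_coeff i j).star).smul hu).integrable_of_hasCompactSupport
    (HasCompactSupport.of_compactSpace _)

lemma fourierTerm_add (ξ : UnitaryIrrep G) {u v : G → E₀} (hu : Continuous u)
    (hv : Continuous v) (x : G) :
    fourierTerm μ ξ (u + v) x = fourierTerm μ ξ u x + fourierTerm μ ξ v x := by
  have h : ∀ i j, fourierCoeff μ ξ (u + v) i j = fourierCoeff μ ξ u i j + fourierCoeff μ ξ v i j :=
    fun i j => by
      simp only [fourierCoeff, Pi.add_apply, smul_add]
      exact integral_add (integrable_coeff_smul μ ξ j i hu) (integrable_coeff_smul μ ξ j i hv)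
  simp only [fourierTerm, h, smul_add, Finset.sum_add_distrib]

lemma fourierTerm_smul (ξ : UnitaryIrrep G) (c : ℂ) (u : G → E₀) (x : G) :
    fourierTerm μ ξ (c • u) x = c • fourierTerm μ ξ u x := by
  have h : ∀ i j, fourierCoeff μ ξ (c • u) i j = c • fourierCoeff μ ξ u i j := fun i j => by
    simp only [fourierCoeff, Pi.smul_apply, smul_comm _ c]
    exact integral_smul c _
  simp only [fourierTerm, h, smul_comm _ c, Finset.smul_sum]

lemma continuous_section (u : sectionSubmodule V τ) : Continuous (u : G → E₀) :=
  u.2.1.continuous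

lemma xiTerm_add (u v : sectionSubmodule V τ) (x : G) :
    xiTerm Y s μ ((u + v : sectionSubmodule V τ) : G → E₀) x =
      xiTerm Y s μ (u : G → E₀) x + xiTerm Y s μ (v : G → E₀) x := by
  funext ξ
  simp only [xiTerm, Submodule.coe_add, Pi.add_apply,
    fourierTerm_add μ _ (continuous_section τ u) (continuous_section τ v), smul_add]

lemma xiTerm_smul (c : ℂ) (u : G → E₀) (x : G) :
    xiTerm Y s μ (c • u) x = c • xiTerm Y s μ u x := by
  funext ξ
  simp only [xiTerm, Pi.smul_apply, fourierTerm_smul, smul_comm _ c]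

/-- The sections `u` for which the Fourier series of `Ξ^s u` converges and has a sum in `L²(E)`.
(These are all sections in `Γ(E)`.) -/
def sobolevDomain : Submodule ℂ (SmoothSection V τ) where
  carrier := {u | (∀ x, Summable (xiTerm Y s μ u.1 x)) ∧ MemLp (xiPow Y s μ u.1) 2 μ}
  add_mem' := by
    rintro u v ⟨hu, hu'⟩ ⟨hv, hv'⟩
    refine ⟨fun x => ?_, ?_⟩
    · exact (xiTerm_add Y s μ τ u v x) ▸ (hu x).add (hv x)
    · have : xiPow Y s μ (u + v).1 = xiPow Y s μ u.1 + xiPow Y s μ v.1 := by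
        funext x
        exact (congrArg tsum (xiTerm_add Y s μ τ u v x)).trans ((hu x).tsum_add (hv x))
      rw [this]
      exact hu'.add hv'
  zero_mem' := by
    have h : ∀ x, xiTerm Y s μ (0 : SmoothSection V τ).1 x = 0 := fun x => by
      have := xiTerm_smul Y s μ 0 (0 : SmoothSection V τ).1 x
      rwa [zero_smul, zero_smul] at this
    have h' : xiPow Y s μ (0 : SmoothSection V τ).1 = 0 := by
      funext x
      simp [xiPow, h]
    refine ⟨fun x => ?_, ?_⟩
    · rw [h]
      exact summable_zero
    · rw [h']
      exact MemLp.zero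
  smul_mem' := by
    rintro c u ⟨hu, hu'⟩
    refine ⟨fun x => ?_, ?_⟩
    · exact (xiTerm_smul Y s μ c u.1 x) ▸ (hu x).const_smul c
    · have : xiPow Y s μ (c • u).1 = c • xiPow Y s μ u.1 := by
        funext x
        exact (congrArg tsum (xiTerm_smul Y s μ c u.1 x)).trans ((hu x).tsum_const_smul c)
      rw [this]
      exact hu'.const_smul c

/-- The space `Γ(E)`, as a space with the norm `‖u‖_s = ‖Ξ^s u‖` in `L²(E)`. -/
def PreSobolev : Type _ := ↥(sobolevDomain Y s μ τ)

instance : AddCommGroup (PreSobolev Y s μ τ) :=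
  inferInstanceAs (AddCommGroup ↥(sobolevDomain Y s μ τ))

instance : Module ℂ (PreSobolev Y s μ τ) :=
  inferInstanceAs (Module ℂ ↥(sobolevDomain Y s μ τ))

/-- The map `u ↦ Ξ^s u` from `Γ(E)` to `L²(G, E₀)`. -/
def xiPowL2 : PreSobolev Y s μ τ →ₗ[ℂ] Lp E₀ 2 μ where
  toFun u := MemLp.toLp (xiPow Y s μ u.1.1) u.2.2
  map_add' u v := by
    rw [← MemLp.toLp_add]
    apply MemLp.toLp_congr
    refine Filter.Eventually.of_forall fun x => ?_
    exact (congrArg tsum (xiTerm_add Y s μ τ u.1 v.1 x)).trans ((u.2.1 x).tsum_add (v.2.1 x))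
  map_smul' c u := by
    rw [RingHom.id_apply, ← MemLp.toLp_const_smul]
    apply MemLp.toLp_congr
    refine Filter.Eventually.of_forall fun x => ?_
    exact (congrArg tsum (xiTerm_smul Y s μ c u.1.1 x)).trans ((u.2.1 x).tsum_const_smul c)

instance : SeminormedAddCommGroup (PreSobolev Y s μ τ) :=
  SeminormedAddCommGroup.induced _ _ (xiPowL2 Y s μ τ)

instance : NormedSpace ℂ (PreSobolev Y s μ τ) :=
  NormedSpace.induced ℂ _ _ (xiPowL2 Y s μ τ)

/-- The Sobolev space `H^s(E)`: the completion of `Γ(E)` with respect to the norm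
`‖u‖_s = ‖Ξ^s u‖` in `L²(E)`. -/
abbrev Sobolev : Type _ := UniformSpace.Completion (PreSobolev Y s μ τ)

variable {τ}

/-- The element of `H^s(E)` which is given by a smooth section `u`. -/
def SmoothSection.toSobolev (u : SmoothSection V τ) (hu : u ∈ sobolevDomain Y s μ τ) :
    Sobolev Y s μ τ :=
  UniformSpace.Completion.coe' (⟨u, hu⟩ : PreSobolev Y s μ τ)

end Linear

end Sobolev

end HomogeneousBundle

end

open MeasureTheory
open scoped Manifold ContDiff

noncomputable section

namespace HomogeneousBundle

set_option linter.unusedSectionVars false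


/-! Sobolev norms are weighted `ℓ²` norms of Fourier coefficients: `‖u‖_s² = ∑_ξ d_ξ ⟨ξ⟩^{2s}
‖û(ξ)‖²`, with the Hilbert-Schmidt norm (`hasSum_norm_preSobolev_sq`). The Fourier series of a
smooth section converges in `C^∞` (`tendsto_sum_fourierSection`), so continuity of `A` gives `Au(x)
= ∑_ξ d_ξ Tr(ξ(x) σ_A(ξ,x) û(ξ))` (`apply_fourierSection`). For a symbol independent of `x` this is
a Fourier multiplier of size `⟨ξ⟩^m`, and the estimate is immediate.

The dependence on `x` is removed by expanding `σ_A(ξ,·) û(ξ)` in a second Fourier series, over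
classes `η` (`hasSum_apply_fourierSection`). Then `Au = ∑_η d_η ∑_{a,b} η_{ab} · M_{η,a,b} u`, where
the multiplier `M_{η,a,b}` has size `O(⟨η⟩^{-k} ⟨ξ⟩^m)` for every `k`, because the symbol estimates
hold for all `x`-derivatives uniformly (`exists_hsSq_symbolCoeff_le`). Two facts make the sum over
`η` converge in operator norm.

First, multiplication by `η_{ab}` is bounded on `H^t` with norm at most a constant times a power of
`⟨η⟩` (`sum_sobolevWeight_mul_hsSq_le`). If `ζ` occurs in `η ⊗ ξ`, then `c_ζ ≤ 2(c_η + c_ξ)` and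
`c_ξ ≤ 2(c_ζ + c_η)` (`casimir_triple_le`). Hence in shells of ratio `2⟨η⟩` the multiplication mixes
neighbouring shells only; on one shell the `H^t` norm is comparable to a multiple of the `L²` norm,
and `|η_{ab}| ≤ 1`.

Second, `∑_ξ d_ξ² ⟨ξ⟩^{-p}` is finite for some `p` (`exists_summable_dim_sq_div`). On a ball around
the identity of radius comparable to `1/Λ`, all `ξ` with `⟨ξ⟩ ≤ Λ` are close to their value at the
identity. So for a finite set of such `ξ` the function `∑ d_ξ χ_ξ`, whose squared `L²` norm is `N =
∑ d_ξ²`, is at least `N/2` in modulus there. Thus `N` is bounded by a constant over the volume of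
the ball, and the doubling property of Haar measure makes this polynomial in `Λ`.

Underneath lie the Schur relations, completeness of the matrix coefficients
(`eq_zero_of_fourierCoeff_eq_zero`, by the spectral theorem for a compact operator), smoothness of
matrix coefficients (`contMDiff_coeff`, by convolution with a bump function), and the fact that the
Casimir operator of an irreducible representation is a scalar (`sum_derived_mul_derived`). -/

lemma integrable_of_continuous {X : Type*} [TopologicalSpace X] [CompactSpace X]
    [MeasurableSpace X] [BorelSpace X] (μ : Measure X) [IsFiniteMeasure μ]
    {W : Type*} [NormedAddCommGroup W] {f : X → W} (hf : Continuous f) : Integrable f μ :=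
  hf.integrable_of_hasCompactSupport (HasCompactSupport.of_compactSpace _)

/-! ### Schur's lemma and the orthogonality relations -/

section CompactGroup

variable {G : Type*} [Group G] [TopologicalSpace G]

namespace UnitaryIrrep

/-- The matrix `ξ(x)`. -/
def mat (ξ : UnitaryIrrep G) (x : G) : Matrix (Fin ξ.dim) (Fin ξ.dim) ℂ :=
  (ξ.toHom x : Matrix (Fin ξ.dim) (Fin ξ.dim) ℂ)

lemma mat_mul (ξ : UnitaryIrrep G) (x y : G) : ξ.mat (x * y) = ξ.mat x * ξ.mat y := by
  simp [mat]

lemma mat_one (ξ : UnitaryIrrep G) : ξ.mat 1 = 1 := by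
  simp [mat]

lemma conjTranspose_mat_mul (ξ : UnitaryIrrep G) (x : G) :
    (ξ.mat x).conjTranspose * ξ.mat x = 1 :=
  Unitary.coe_star_mul_self (ξ.toHom x)

lemma mat_mul_conjTranspose (ξ : UnitaryIrrep G) (x : G) :
    ξ.mat x * (ξ.mat x).conjTranspose = 1 :=
  Unitary.coe_mul_star_self (ξ.toHom x)

lemma mat_inv (ξ : UnitaryIrrep G) (x : G) : ξ.mat x⁻¹ = (ξ.mat x).conjTranspose := by
  have h : ξ.mat x⁻¹ * ξ.mat x = 1 := by rw [← mat_mul, inv_mul_cancel, mat_one]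
  calc ξ.mat x⁻¹ = ξ.mat x⁻¹ * (ξ.mat x * (ξ.mat x).conjTranspose) := by
        rw [mat_mul_conjTranspose, mul_one]
    _ = _ := by rw [← mul_assoc, h, one_mul]

lemma coeff_mul (ξ : UnitaryIrrep G) (i j : Fin ξ.dim) (x y : G) :
    ξ.coeff i j (x * y) = ∑ k, ξ.coeff i k x * ξ.coeff k j y :=
  congrFun₂ (ξ.mat_mul x y) i j

lemma coeff_one (ξ : UnitaryIrrep G) (i j : Fin ξ.dim) :
    ξ.coeff i j 1 = if i = j then 1 else 0 := by
  have := congrFun₂ ξ.mat_one i j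
  rwa [Matrix.one_apply] at this

lemma coeff_inv (ξ : UnitaryIrrep G) (i j : Fin ξ.dim) (x : G) :
    ξ.coeff i j x⁻¹ = star (ξ.coeff j i x) :=
  congrFun₂ (ξ.mat_inv x) i j

lemma sum_star_coeff_mul_coeff (ξ : UnitaryIrrep G) (i j : Fin ξ.dim) (x : G) :
    ∑ k, star (ξ.coeff k i x) * ξ.coeff k j x = if i = j then 1 else 0 := by
  have := congrFun₂ (ξ.conjTranspose_mat_mul x) i j
  rwa [Matrix.one_apply] at this

lemma sum_coeff_mul_star_coeff (ξ : UnitaryIrrep G) (i j : Fin ξ.dim) (x : G) :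
    ∑ k, ξ.coeff i k x * star (ξ.coeff j k x) = if i = j then 1 else 0 := by
  have := congrFun₂ (ξ.mat_mul_conjTranspose x) i j
  rwa [Matrix.one_apply] at this

lemma sum_norm_coeff_sq (ξ : UnitaryIrrep G) (i : Fin ξ.dim) (x : G) :
    ∑ k, ‖ξ.coeff i k x‖ ^ 2 = 1 := by
  have h := ξ.sum_coeff_mul_star_coeff i i x
  simp only [if_true, Complex.star_def, Complex.mul_conj'] at h
  exact_mod_cast h

lemma norm_coeff_le_one (ξ : UnitaryIrrep G) (i j : Fin ξ.dim) (x : G) :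
    ‖ξ.coeff i j x‖ ≤ 1 := by
  have h : ‖ξ.coeff i j x‖ ^ 2 ≤ 1 := by
    rw [← ξ.sum_norm_coeff_sq i x]
    exact Finset.single_le_sum (f := fun k => ‖ξ.coeff i k x‖ ^ 2) (fun k _ => sq_nonneg _)
      (Finset.mem_univ j)
  exact (sq_le_one_iff₀ (norm_nonneg _)).1 h

/-- Schur's lemma: an operator which intertwines two inequivalent irreducible representations is
zero. -/
theorem eq_zero_of_intertwining {ξ η : UnitaryIrrep G} (hne : ¬ Equivalent η ξ)
    (M : Matrix (Fin ξ.dim) (Fin η.dim) ℂ) (hM : ∀ g, ξ.mat g * M = M * η.mat g) : M = 0 := by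
  have key : ∀ g v, Matrix.mulVec M (Matrix.mulVec (η.mat g) v) =
      Matrix.mulVec (ξ.mat g) (Matrix.mulVec M v) := fun g v => by
    rw [Matrix.mulVec_mulVec, Matrix.mulVec_mulVec, hM]
  by_contra h0
  have hL : M.mulVecLin ≠ 0 := fun h => h0 (by
    ext i j
    have := congrFun (LinearMap.congr_fun h (Pi.single j 1)) i
    simpa using this)
  have hker : LinearMap.ker M.mulVecLin = ⊥ := by
    refine (η.irreducible (LinearMap.ker M.mulVecLin) fun g v hv => ?_).resolve_right fun h => ?_
    · rw [LinearMap.mem_ker, Matrix.mulVecLin_apply] at hv ⊢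
      exact (key g v).trans (by rw [hv, Matrix.mulVec_zero])
    · exact hL (LinearMap.ker_eq_top.1 h)
  have hrange : LinearMap.range M.mulVecLin = ⊤ := by
    refine (ξ.irreducible (LinearMap.range M.mulVecLin) fun g v hv => ?_).resolve_left fun h => ?_
    · obtain ⟨w, rfl⟩ := hv
      exact ⟨Matrix.mulVec (η.mat g) w, key g w⟩
    · exact hL (LinearMap.range_eq_bot.1 h)
  exact hne ⟨LinearEquiv.ofBijective M.mulVecLin
    ⟨LinearMap.ker_eq_bot.1 hker, LinearMap.range_eq_top.1 hrange⟩, fun g v => key g v⟩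

/-- Schur's lemma: an operator which commutes with an irreducible representation is scalar. -/
theorem exists_eq_smul_one_of_commute (ξ : UnitaryIrrep G)
    (M : Matrix (Fin ξ.dim) (Fin ξ.dim) ℂ) (hM : ∀ g, ξ.mat g * M = M * ξ.mat g) :
    ∃ c : ℂ, M = c • (1 : Matrix (Fin ξ.dim) (Fin ξ.dim) ℂ) := by
  have : Nonempty (Fin ξ.dim) := ⟨⟨0, ξ.dim_pos⟩⟩
  obtain ⟨c, hc⟩ := Module.End.exists_eigenvalue (Matrix.toLin' M)
  refine ⟨c, ?_⟩
  have htop : Module.End.eigenspace (Matrix.toLin' M) c = ⊤ := by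
    refine (ξ.irreducible _ fun g v hv => ?_).resolve_left hc
    rw [Module.End.mem_eigenspace_iff, Matrix.toLin'_apply] at hv ⊢
    change Matrix.mulVec M (Matrix.mulVec (ξ.mat g) v) = c • Matrix.mulVec (ξ.mat g) v
    rw [Matrix.mulVec_mulVec, ← hM, ← Matrix.mulVec_mulVec, hv, Matrix.mulVec_smul]
  ext i j
  have h : Pi.single j (1 : ℂ) ∈ Module.End.eigenspace (Matrix.toLin' M) c := htop ▸ trivial
  rw [Module.End.mem_eigenspace_iff] at h
  have := congrFun h i
  simpa [Matrix.one_apply, Pi.single_apply] using this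

lemma dim_cast_ne_zero (ξ : UnitaryIrrep G) : (ξ.dim : ℂ) ≠ 0 :=
  Nat.cast_ne_zero.2 ξ.dim_pos.ne'

end UnitaryIrrep

lemma UnitaryDual.not_equivalent {ξ η : UnitaryDual G} (h : ξ ≠ η) :
    ¬ UnitaryIrrep.Equivalent ξ.rep η.rep := fun he =>
  h (by
    have : (⟦ξ.rep⟧ : UnitaryDual G) = ⟦η.rep⟧ := Quotient.sound he
    exact (Quotient.out_eq ξ).symm.trans (this.trans (Quotient.out_eq η)))

variable [IsTopologicalGroup G] [CompactSpace G] [MeasurableSpace G] [BorelSpace G]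
  (μ : Measure G) [μ.IsHaarMeasure] [IsProbabilityMeasure μ]

/-- Compact groups are unimodular: a right translate of `μ` is again a Haar probability measure, and
there is only one. -/
lemma isMulRightInvariant : μ.IsMulRightInvariant where
  map_mul_right_eq_self g := by
    have : IsProbabilityMeasure (μ.map (· * g)) :=
      Measure.isProbabilityMeasure_map (continuous_mul_const g).aemeasurable
    exact Measure.isHaarMeasure_eq_of_isProbabilityMeasure _ _

open UnitaryIrrep

/-- The matrix is the average `∫ ξ(x) E_{ja} η(x)* dx` of a matrix unit; the substitution `x ↦ gx`
turns it into an intertwining operator, to which Schur's lemma applies. -/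
lemma intertwining_integral (ξ η : UnitaryIrrep G) (j : Fin ξ.dim) (a : Fin η.dim) (g : G) :
    ξ.mat g * Matrix.of (fun i b => ∫ x, star (η.coeff b a x) * ξ.coeff i j x ∂μ) =
      Matrix.of (fun i b => ∫ x, star (η.coeff b a x) * ξ.coeff i j x ∂μ) * η.mat g := by
  have hint : ∀ b i, Integrable (fun x => star (η.coeff b a x) * ξ.coeff i j x) μ := fun b i =>
    integrable_of_continuous μ ((η.continuous_coeff b a).star.mul (ξ.continuous_coeff i j))
  ext i b
  rw [Matrix.mul_apply, Matrix.mul_apply]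
  have h1 : ∑ k, ξ.mat g i k * ∫ x, star (η.coeff b a x) * ξ.coeff k j x ∂μ =
      ∫ x, star (η.coeff b a x) * ξ.coeff i j (g * x) ∂μ := by
    simp_rw [coeff_mul, Finset.mul_sum]
    rw [integral_finsetSum _ fun k _ => ((hint b k).const_mul (ξ.coeff i k g)).congr
      (Filter.Eventually.of_forall fun x => by ring)]
    refine Finset.sum_congr rfl fun k _ => ?_
    rw [← integral_const_mul]
    refine integral_congr_ae (Filter.Eventually.of_forall fun x => ?_)
    change ξ.coeff i k g * _ = _
    ring
  have h2 : ∑ k, (∫ x, star (η.coeff k a x) * ξ.coeff i j x ∂μ) * η.mat g k b =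
      ∫ x, star (η.coeff b a (g⁻¹ * x)) * ξ.coeff i j x ∂μ := by
    simp_rw [coeff_mul, star_sum, Finset.sum_mul, coeff_inv, star_mul, star_star]
    rw [integral_finsetSum _ fun k _ => ((hint k i).const_mul (η.coeff k b g)).congr
      (Filter.Eventually.of_forall fun x => by ring)]
    refine Finset.sum_congr rfl fun k _ => ?_
    rw [← integral_mul_const]
    refine integral_congr_ae (Filter.Eventually.of_forall fun x => ?_)
    change _ * η.coeff k b g = _
    ring
  simp only [Matrix.of_apply]
  rw [h1, h2, ← integral_mul_left_eq_self (μ := μ)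
    (fun x => star (η.coeff b a (g⁻¹ * x)) * ξ.coeff i j x) g]
  simp only [inv_mul_cancel_left]

theorem integral_star_coeff_mul_coeff_of_not_equivalent {ξ η : UnitaryIrrep G}
    (h : ¬ Equivalent η ξ) (i j : Fin ξ.dim) (b a : Fin η.dim) :
    ∫ x, star (η.coeff b a x) * ξ.coeff i j x ∂μ = 0 :=
  congrFun₂ (eq_zero_of_intertwining h _ (intertwining_integral μ ξ η j a)) i b

theorem integral_star_coeff_mul_coeff (ξ : UnitaryIrrep G) (i j b a : Fin ξ.dim) :
    ∫ x, star (ξ.coeff b a x) * ξ.coeff i j x ∂μ =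
      if b = i ∧ a = j then (ξ.dim : ℂ)⁻¹ else 0 := by
  obtain ⟨c, hc⟩ := exists_eq_smul_one_of_commute ξ _ (intertwining_integral μ ξ ξ j a)
  have hij : ∀ i b, ∫ x, star (ξ.coeff b a x) * ξ.coeff i j x ∂μ = if i = b then c else 0 :=
    fun i b => (congrFun₂ hc i b).trans (by simp [Matrix.one_apply])
  -- The scalar is found from the trace, where unitarity of `ξ(x)` makes the integrand constant.
  have htr : c * ξ.dim = if a = j then 1 else 0 := by
    calc c * ξ.dim = ∑ i, ∫ x, star (ξ.coeff i a x) * ξ.coeff i j x ∂μ := by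
          simp only [hij, if_true, Finset.sum_const, Finset.card_univ, Fintype.card_fin,
            nsmul_eq_mul]
          exact mul_comm _ _
      _ = ∫ x, ∑ i, star (ξ.coeff i a x) * ξ.coeff i j x ∂μ :=
          (integral_finsetSum _ fun i _ => integrable_of_continuous μ
            ((ξ.continuous_coeff i a).star.mul (ξ.continuous_coeff i j))).symm
      _ = _ := by
          simp only [sum_star_coeff_mul_coeff, integral_const, probReal_univ, one_smul]
  have hc' : c = if a = j then (ξ.dim : ℂ)⁻¹ else 0 := by
    rw [eq_comm, ← div_eq_iff ξ.dim_cast_ne_zero] at htr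
    rw [← htr]
    split_ifs <;> simp
  rw [hij, hc']
  by_cases h1 : i = b <;> by_cases h2 : a = j <;> simp [h1, h2, Ne.symm]

end CompactGroup


/-! ### Fourier series on a compact group -/

section FourierSeries

variable {G : Type*} [Group G] [TopologicalSpace G]
  {W : Type*} [NormedAddCommGroup W] [InnerProductSpace ℂ W]

local notation "⟪" x ", " y "⟫" => inner ℂ x y

/-- The square of the Hilbert-Schmidt norm of a matrix with entries in `W`. -/
def hsSq {d : ℕ} (c : Fin d → Fin d → W) : ℝ := ∑ i, ∑ j, ‖c i j‖ ^ 2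

lemma hsSq_nonneg {d : ℕ} (c : Fin d → Fin d → W) : 0 ≤ hsSq c :=
  Finset.sum_nonneg fun _ _ => Finset.sum_nonneg fun _ _ => sq_nonneg _

lemma hsSq_smul {d : ℕ} (a : ℂ) (c : Fin d → Fin d → W) : hsSq (a • c) = ‖a‖ ^ 2 * hsSq c := by
  simp only [hsSq, Pi.smul_apply, norm_smul, mul_pow, Finset.mul_sum]

/-- The function `x ↦ dim(ξ) Tr(ξ(x) c)` for a matrix `c` with entries in `W`. -/
def trigTerm (ξ : UnitaryIrrep G) (c : Fin ξ.dim → Fin ξ.dim → W) (x : G) : W :=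
  (ξ.dim : ℂ) • ∑ i, ∑ j, ξ.coeff i j x • c j i

lemma trigTerm_smul (ξ : UnitaryIrrep G) (a : ℂ) (c : Fin ξ.dim → Fin ξ.dim → W) (x : G) :
    trigTerm ξ (a • c) x = a • trigTerm ξ c x := by
  simp only [trigTerm, Pi.smul_apply, Finset.smul_sum, smul_comm a]

/-- Cauchy-Schwarz for the trace pairing; a unitary matrix of size `d` has Hilbert-Schmidt norm
`√d`. -/
lemma norm_trigTerm_le (ξ : UnitaryIrrep G) (c : Fin ξ.dim → Fin ξ.dim → W) (x : G) :
    ‖trigTerm ξ c x‖ ≤ ξ.dim * (Real.sqrt ξ.dim * Real.sqrt (hsSq c)) := by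
  rw [trigTerm, norm_smul, Complex.norm_natCast]
  refine mul_le_mul_of_nonneg_left ?_ (Nat.cast_nonneg _)
  calc ‖∑ i, ∑ j, ξ.coeff i j x • c j i‖ ≤ ∑ i, ∑ j, ‖ξ.coeff i j x‖ * ‖c j i‖ := by
        refine (norm_sum_le _ _).trans (Finset.sum_le_sum fun i _ => (norm_sum_le _ _).trans
          (Finset.sum_le_sum fun j _ => (norm_smul _ _).le))
    _ = ∑ p : Fin ξ.dim × Fin ξ.dim, ‖ξ.coeff p.1 p.2 x‖ * ‖c p.2 p.1‖ :=
        (Fintype.sum_prod_type' fun i j => ‖ξ.coeff i j x‖ * ‖c j i‖).symm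
    _ ≤ Real.sqrt (∑ p : Fin ξ.dim × Fin ξ.dim, ‖ξ.coeff p.1 p.2 x‖ ^ 2) *
          Real.sqrt (∑ p : Fin ξ.dim × Fin ξ.dim, ‖c p.2 p.1‖ ^ 2) :=
        Real.sum_mul_le_sqrt_mul_sqrt _ _ _
    _ = _ := by
        rw [Fintype.sum_prod_type' fun i j => ‖ξ.coeff i j x‖ ^ 2,
          Fintype.sum_prod_type' fun i j => ‖c j i‖ ^ 2, Finset.sum_comm (γ := Fin ξ.dim)]
        have : ∑ y, ∑ x_1, ‖ξ.coeff x_1 y x‖ ^ 2 = (ξ.dim : ℝ) := by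
          rw [Finset.sum_comm]
          simp [UnitaryIrrep.sum_norm_coeff_sq]
        rw [this, Finset.sum_comm]
        rfl

variable [CompactSpace G] [MeasurableSpace G] [BorelSpace G]

lemma continuous_trigTerm (ξ : UnitaryIrrep G) (c : Fin ξ.dim → Fin ξ.dim → W) :
    Continuous (trigTerm ξ c) :=
  (continuous_finsetSum _ fun i _ => continuous_finsetSum _ fun j _ =>
    (ξ.continuous_coeff i j).smul continuous_const).const_smul _

variable [IsTopologicalGroup G] (μ : Measure G) [μ.IsHaarMeasure] [IsProbabilityMeasure μ]

lemma fourierTerm_eq_trigTerm (ξ : UnitaryIrrep G) (u : G → W) :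
    fourierTerm μ ξ u = trigTerm ξ (fourierCoeff μ ξ u) := rfl

lemma fourierCoeff_smul (ξ : UnitaryIrrep G) (a : ℂ) (u : G → W) :
    fourierCoeff μ ξ (fun x => a • u x) = a • fourierCoeff μ ξ u := by
  ext i j
  simp only [fourierCoeff, Pi.smul_apply, smul_comm _ a]
  exact integral_smul a _

lemma fourierCoeff_sub (ξ : UnitaryIrrep G) {u v : G → W} (hu : Continuous u)
    (hv : Continuous v) :
    fourierCoeff μ ξ (fun x => u x - v x) = fourierCoeff μ ξ u - fourierCoeff μ ξ v := by
  ext i j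
  simp only [fourierCoeff, Pi.sub_apply, smul_sub]
  exact integral_sub (integrable_coeff_smul μ ξ j i hu) (integrable_coeff_smul μ ξ j i hv)

lemma fourierCoeff_sum (ξ : UnitaryIrrep G) {ι : Type*} (s : Finset ι) {u : ι → G → W}
    (hu : ∀ i, Continuous (u i)) :
    fourierCoeff μ ξ (fun x => ∑ i ∈ s, u i x) = ∑ i ∈ s, fourierCoeff μ ξ (u i) := by
  ext a b
  simp only [fourierCoeff, Finset.sum_apply, Finset.smul_sum]
  exact integral_finsetSum _ fun i _ => integrable_coeff_smul μ ξ b a (hu i)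

lemma fourierCoeff_coeff_smul (η ξ : UnitaryIrrep G) [CompleteSpace W] (i j : Fin ξ.dim) (w : W)
    (a b : Fin η.dim) :
    fourierCoeff μ η (fun x => ξ.coeff i j x • w) a b =
      (∫ x, star (η.coeff b a x) * ξ.coeff i j x ∂μ) • w := by
  simp only [fourierCoeff, smul_smul]
  exact integral_smul_const _ _

lemma fourierCoeff_trigTerm (η ξ : UnitaryIrrep G) [CompleteSpace W]
    (c : Fin ξ.dim → Fin ξ.dim → W) (a b : Fin η.dim) :
    fourierCoeff μ η (trigTerm ξ c) a b =
      (ξ.dim : ℂ) • ∑ i, ∑ j, (∫ x, star (η.coeff b a x) * ξ.coeff i j x ∂μ) • c j i := by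
  have h : trigTerm ξ c = fun x => (ξ.dim : ℂ) • ∑ i, ∑ j, ξ.coeff i j x • c j i := rfl
  have hc : ∀ i j, Continuous fun x => ξ.coeff i j x • c j i := fun i j =>
    (ξ.continuous_coeff i j).smul continuous_const
  rw [h, fourierCoeff_smul, fourierCoeff_sum μ η _
    fun i => continuous_finsetSum _ fun j _ => hc i j]
  simp only [fourierCoeff_sum μ η _ (hc _), Pi.smul_apply, Finset.sum_apply,
    fourierCoeff_coeff_smul]

lemma fourierCoeff_trigTerm_of_not_equivalent {η ξ : UnitaryIrrep G} [CompleteSpace W]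
    (h : ¬ UnitaryIrrep.Equivalent η ξ) (c : Fin ξ.dim → Fin ξ.dim → W) :
    fourierCoeff μ η (trigTerm ξ c) = 0 := by
  ext a b
  rw [fourierCoeff_trigTerm]
  simp only [integral_star_coeff_mul_coeff_of_not_equivalent μ h, zero_smul,
    Finset.sum_const_zero, smul_zero, Pi.zero_apply]

lemma fourierCoeff_trigTerm_self (ξ : UnitaryIrrep G) [CompleteSpace W]
    (c : Fin ξ.dim → Fin ξ.dim → W) : fourierCoeff μ ξ (trigTerm ξ c) = c := by
  ext a b
  rw [fourierCoeff_trigTerm]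
  simp only [integral_star_coeff_mul_coeff]
  rw [Finset.sum_eq_single b, Finset.sum_eq_single a]
  · simp [smul_smul, ξ.dim_cast_ne_zero]
  · intro j _ hj
    simp [hj.symm]
  · simp
  · intro i _ hi
    simp [hi.symm]
  · simp

/-- A coefficient family over the unitary dual, that is, a matrix with entries in `W` for each
class. -/
abbrev Coeffs (G W : Type*) [Group G] [TopologicalSpace G] : Type _ :=
  ∀ ξ : UnitaryDual G, Fin ξ.rep.dim → Fin ξ.rep.dim → W

open Classical in
lemma fourierCoeff_trigTerm_rep [CompleteSpace W] (c : Coeffs G W) (η ξ : UnitaryDual G) :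
    fourierCoeff μ η.rep (trigTerm ξ.rep (c ξ)) = if ξ = η then c η else 0 := by
  split_ifs with h
  · subst h
    exact fourierCoeff_trigTerm_self μ _ _
  · exact fourierCoeff_trigTerm_of_not_equivalent μ
      (UnitaryDual.not_equivalent fun h' => h h'.symm) _

open Classical in
lemma fourierCoeff_sum_trigTerm [CompleteSpace W] (c : Coeffs G W) (η : UnitaryDual G)
    (S : Finset (UnitaryDual G)) :
    fourierCoeff μ η.rep (fun x => ∑ ξ ∈ S, trigTerm ξ.rep (c ξ) x) =
      if η ∈ S then c η else 0 := by
  rw [fourierCoeff_sum μ _ _ fun ξ => continuous_trigTerm _ _]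
  simp only [fourierCoeff_trigTerm_rep]
  exact Finset.sum_ite_eq' S η _

/-- Up to the factor `d_ξ`, forming `trigTerm` is adjoint to taking the Fourier coefficient. Bessel
and Parseval both rest on this. -/
lemma integral_inner_trigTerm [CompleteSpace W] (ξ : UnitaryIrrep G)
    (c : Fin ξ.dim → Fin ξ.dim → W) {f : G → W} (hf : Continuous f) :
    ∫ x, ⟪trigTerm ξ c x, f x⟫ ∂μ = ξ.dim * ∑ i, ∑ j, ⟪c i j, fourierCoeff μ ξ f i j⟫ := by
  have h : ∀ x, ⟪trigTerm ξ c x, f x⟫ =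
      ξ.dim * ∑ i, ∑ j, ⟪c j i, star (ξ.coeff i j x) • f x⟫ := fun x => by
    simp only [trigTerm, inner_smul_left, sum_inner, inner_smul_right, map_natCast]
    rfl
  have hi : ∀ i j, Integrable (fun x => ⟪c j i, star (ξ.coeff i j x) • f x⟫) μ := fun i j =>
    (integrable_coeff_smul μ ξ i j hf).const_inner (c j i)
  simp only [h]
  rw [integral_const_mul, integral_finsetSum _ fun i _ => integrable_finsetSum _ fun j _ => hi i j,
    Finset.sum_comm]
  congr 1
  refine Finset.sum_congr rfl fun j _ => ?_
  simp only [integral_finsetSum _ fun j _ => hi _ j]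
  exact Finset.sum_congr rfl fun i _ =>
    integral_inner (𝕜 := ℂ) (integrable_coeff_smul μ ξ j i hf) (c i j)

lemma sum_inner_self {d : ℕ} (c : Fin d → Fin d → W) :
    ∑ i, ∑ j, ⟪c i j, c i j⟫ = (hsSq c : ℂ) := by
  simp only [hsSq, inner_self_eq_norm_sq_to_K, Complex.ofReal_sum, Complex.ofReal_pow]
  rfl

open Classical in
lemma integral_norm_sum_trigTerm_sq [CompleteSpace W] (c : Coeffs G W)
    (S : Finset (UnitaryDual G)) :
    ∫ x, ‖∑ ξ ∈ S, trigTerm ξ.rep (c ξ) x‖ ^ 2 ∂μ = ∑ ξ ∈ S, ξ.rep.dim * hsSq (c ξ) := by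
  have hcont : Continuous fun x => ∑ ξ ∈ S, trigTerm ξ.rep (c ξ) x :=
    continuous_finsetSum _ fun ξ _ => continuous_trigTerm _ _
  have h : ∫ x, ⟪∑ ξ ∈ S, trigTerm ξ.rep (c ξ) x, ∑ ξ ∈ S, trigTerm ξ.rep (c ξ) x⟫ ∂μ =
      ((∑ ξ ∈ S, ξ.rep.dim * hsSq (c ξ) : ℝ) : ℂ) := by
    simp only [sum_inner S]
    rw [integral_finsetSum _ fun ξ _ => integrable_of_continuous μ
      ((continuous_trigTerm _ _).inner hcont), Complex.ofReal_sum]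
    refine Finset.sum_congr rfl fun ξ hξ => ?_
    rw [integral_inner_trigTerm μ _ _ hcont, fourierCoeff_sum_trigTerm, if_pos hξ,
      sum_inner_self]
    push_cast
    rfl
  simp only [inner_self_eq_norm_sq_to_K] at h
  have h' : ∫ x, ((‖∑ ξ ∈ S, trigTerm ξ.rep (c ξ) x‖ ^ 2 : ℝ) : ℂ) ∂μ =
      ((∑ ξ ∈ S, ξ.rep.dim * hsSq (c ξ) : ℝ) : ℂ) := by
    rw [← h]
    refine integral_congr_ae (Filter.Eventually.of_forall fun x => ?_)
    simp
  rw [integral_complex_ofReal] at h'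
  exact_mod_cast h'

/-- Bessel's inequality. -/
theorem sum_hsSq_fourierCoeff_le [CompleteSpace W] {f : G → W} (hf : Continuous f)
    (S : Finset (UnitaryDual G)) :
    ∑ ξ ∈ S, ξ.rep.dim * hsSq (fourierCoeff μ ξ.rep f) ≤ ∫ x, ‖f x‖ ^ 2 ∂μ := by
  set c : Coeffs G W := fun ξ => fourierCoeff μ ξ.rep f with hc
  have hcont : Continuous fun x => ∑ ξ ∈ S, trigTerm ξ.rep (c ξ) x :=
    continuous_finsetSum _ fun ξ _ => continuous_trigTerm _ _
  have h1 : ∫ x, ⟪∑ ξ ∈ S, trigTerm ξ.rep (c ξ) x, f x⟫ ∂μ =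
      ((∑ ξ ∈ S, ξ.rep.dim * hsSq (c ξ) : ℝ) : ℂ) := by
    simp only [sum_inner S]
    rw [integral_finsetSum _ fun ξ _ => integrable_of_continuous μ
      ((continuous_trigTerm _ _).inner (𝕜 := ℂ) hf), Complex.ofReal_sum]
    refine Finset.sum_congr rfl fun ξ hξ => ?_
    rw [integral_inner_trigTerm μ _ _ hf, sum_inner_self]
    push_cast
    rfl
  have h2 : ∫ x, RCLike.re ⟪∑ ξ ∈ S, trigTerm ξ.rep (c ξ) x, f x⟫ ∂μ =
      ∑ ξ ∈ S, ξ.rep.dim * hsSq (c ξ) := by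
    rw [integral_re (integrable_of_continuous μ (hcont.inner hf)), h1]
    exact Complex.ofReal_re _
  have h3 := integral_norm_sum_trigTerm_sq μ c S
  -- Expanding the square of the distance from `f` to its partial sum: both the mixed term and the
  -- square of the partial sum are given by the same sum over `S`.
  have h4 : 0 ≤ ∫ x, ‖(∑ ξ ∈ S, trigTerm ξ.rep (c ξ) x) - f x‖ ^ 2 ∂μ :=
    integral_nonneg fun x => sq_nonneg _
  simp only [@norm_sub_sq ℂ] at h4
  have i1 : Integrable (fun x => ‖∑ ξ ∈ S, trigTerm ξ.rep (c ξ) x‖ ^ 2) μ :=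
    integrable_of_continuous μ (hcont.norm.pow 2)
  have i2 : Integrable
      (fun x => 2 * RCLike.re ⟪∑ ξ ∈ S, trigTerm ξ.rep (c ξ) x, f x⟫) μ :=
    integrable_of_continuous μ
      ((RCLike.continuous_re.comp (hcont.inner (𝕜 := ℂ) hf)).const_mul 2)
  have i3 : Integrable (fun x => ‖f x‖ ^ 2) μ := integrable_of_continuous μ (hf.norm.pow 2)
  have h5 := integral_add (i1.sub i2) i3
  have h6 := integral_sub i1 i2
  simp only [Pi.sub_apply] at h5
  rw [h5, h6, integral_const_mul, h2, h3] at h4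
  linarith

lemma dim_mul_hsSq_fourierCoeff_le [CompleteSpace W] {f : G → W} (hf : Continuous f)
    (ξ : UnitaryDual G) {B : ℝ} (hB : ∀ x, ‖f x‖ ≤ B) :
    ξ.rep.dim * hsSq (fourierCoeff μ ξ.rep f) ≤ B ^ 2 := by
  have h := sum_hsSq_fourierCoeff_le μ hf {ξ}
  rw [Finset.sum_singleton] at h
  refine h.trans ((integral_mono (integrable_of_continuous μ (hf.norm.pow 2))
    (integrable_const (B ^ 2)) fun x => pow_le_pow_left₀ (norm_nonneg _) (hB x) 2).trans ?_)
  simp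

open Filter Topology in
lemma tendsto_integral_of_tendstoUniformly {ι X : Type*} [NormedAddCommGroup X] [NormedSpace ℝ X]
    {l : Filter ι} {F : ι → G → X} {f : G → X} (h : TendstoUniformly F f l)
    (hF : ∀ i, Continuous (F i)) (hf : Continuous f) :
    Tendsto (fun i => ∫ x, F i x ∂μ) l (𝓝 (∫ x, f x ∂μ)) := by
  rw [Metric.tendsto_nhds]
  intro ε hε
  filter_upwards [Metric.tendstoUniformly_iff.1 h (ε / 2) (half_pos hε)] with i hi
  rw [dist_comm, dist_eq_norm, ← integral_sub (integrable_of_continuous μ hf)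
    (integrable_of_continuous μ (hF i))]
  refine (norm_integral_le_of_norm_le_const (C := ε / 2) (Eventually.of_forall fun x => ?_)).trans_lt
    ?_
  · rw [← dist_eq_norm]
    exact (hi x).le
  · simpa using half_lt_self hε

open Filter Topology in
lemma tendsto_fourierCoeff {ι : Type*} {l : Filter ι} {F : ι → G → W} {f : G → W}
    (h : TendstoUniformly F f l) (hF : ∀ i, Continuous (F i)) (hf : Continuous f)
    (ξ : UnitaryIrrep G) (a b : Fin ξ.dim) :
    Tendsto (fun i => fourierCoeff μ ξ (F i) a b) l (𝓝 (fourierCoeff μ ξ f a b)) := by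
  refine tendsto_integral_of_tendstoUniformly μ ?_
    (fun i => (ξ.continuous_coeff b a).star.smul (hF i)) ((ξ.continuous_coeff b a).star.smul hf)
  rw [Metric.tendstoUniformly_iff] at h ⊢
  intro ε hε
  filter_upwards [h ε hε] with i hi x
  rw [dist_eq_norm, ← smul_sub, norm_smul, norm_star]
  refine (mul_le_of_le_one_left (norm_nonneg _) (ξ.norm_coeff_le_one b a x)).trans_lt ?_
  rw [← dist_eq_norm]
  exact hi x

/-- The sum of the Fourier series with coefficients `c`. -/
def trigSeries (c : Coeffs G W) (x : G) : W := ∑' ξ : UnitaryDual G, trigTerm ξ.rep (c ξ) x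

section Series

variable [CompleteSpace W] {c : Coeffs G W} {b : UnitaryDual G → ℝ} (hb : Summable b)
  (hc : ∀ ξ x, ‖trigTerm ξ.rep (c ξ) x‖ ≤ b ξ)

include hb hc

lemma tendstoUniformly_trigSeries :
    TendstoUniformly (fun (S : Finset (UnitaryDual G)) x => ∑ ξ ∈ S, trigTerm ξ.rep (c ξ) x)
      (trigSeries c) Filter.atTop :=
  tendstoUniformly_tsum hb hc

lemma continuous_trigSeries : Continuous (trigSeries c) :=
  (tendstoUniformly_trigSeries hb hc).continuous (Filter.Frequently.of_forall fun _ =>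
    continuous_finsetSum _ fun _ _ => continuous_trigTerm _ _)

lemma hasSum_trigSeries (x : G) :
    HasSum (fun ξ : UnitaryDual G => trigTerm ξ.rep (c ξ) x) (trigSeries c x) :=
  (Summable.of_norm_bounded hb fun ξ => hc ξ x).hasSum

/-- By orthogonality the coefficient at `ξ` of a partial sum is constant as soon as `ξ` belongs to
the summation set, and uniform convergence allows passing to the limit. -/
lemma fourierCoeff_trigSeries (ξ : UnitaryDual G) :
    fourierCoeff μ ξ.rep (trigSeries c) = c ξ := by
  classical
  ext i j
  refine tendsto_nhds_unique (tendsto_fourierCoeff μ (tendstoUniformly_trigSeries hb hc)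
    (fun _ => continuous_finsetSum _ fun _ _ => continuous_trigTerm _ _)
    (continuous_trigSeries hb hc) ξ.rep i j) ?_
  refine tendsto_const_nhds.congr' ?_
  filter_upwards [Filter.eventually_ge_atTop {ξ}] with S hS
  rw [fourierCoeff_sum_trigTerm, if_pos (hS (Finset.mem_singleton_self ξ))]

/-- Parseval's identity. -/
theorem hasSum_integral_norm_trigSeries_sq :
    HasSum (fun ξ : UnitaryDual G => ξ.rep.dim * hsSq (c ξ))
      (∫ x, ‖trigSeries c x‖ ^ 2 ∂μ) := by
  have hcont := continuous_trigSeries hb hc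
  obtain ⟨B, hB⟩ := (isCompact_range hcont).isBounded.exists_norm_le
  have hB' : ∀ x, ‖trigSeries c x‖ ≤ B := fun x => hB _ ⟨x, rfl⟩
  -- The partial sums are paired with the full sum, so that the limit is taken in one slot only and
  -- each term is a coefficient already known.
  have h := tendsto_integral_of_tendstoUniformly μ (l := Filter.atTop)
    (F := fun (S : Finset (UnitaryDual G)) x =>
      ⟪∑ ξ ∈ S, trigTerm ξ.rep (c ξ) x, trigSeries c x⟫)
    (f := fun x => ⟪trigSeries c x, trigSeries c x⟫) ?_
    (fun S => (continuous_finsetSum _ fun ξ _ => continuous_trigTerm _ _).inner hcont)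
    (hcont.inner hcont)
  · have h1 : ∀ S : Finset (UnitaryDual G),
        ∫ x, ⟪∑ ξ ∈ S, trigTerm ξ.rep (c ξ) x, trigSeries c x⟫ ∂μ =
          ((∑ ξ ∈ S, ξ.rep.dim * hsSq (c ξ) : ℝ) : ℂ) := fun S => by
      simp only [sum_inner S]
      rw [integral_finsetSum _ fun ξ _ => integrable_of_continuous μ
        ((continuous_trigTerm _ _).inner hcont), Complex.ofReal_sum]
      refine Finset.sum_congr rfl fun ξ hξ => ?_
      rw [integral_inner_trigTerm μ _ _ hcont, fourierCoeff_trigSeries μ hb hc, sum_inner_self]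
      push_cast
      rfl
    have h2 : ∫ x, ⟪trigSeries c x, trigSeries c x⟫ ∂μ =
        ((∫ x, ‖trigSeries c x‖ ^ 2 ∂μ : ℝ) : ℂ) := by
      rw [← integral_complex_ofReal]
      refine integral_congr_ae (Filter.Eventually.of_forall fun x => ?_)
      simp [inner_self_eq_norm_sq_to_K]
    simp only [h1, h2] at h
    exact (Complex.continuous_re.tendsto _).comp h
  · have hu := tendstoUniformly_trigSeries hb hc
    rw [Metric.tendstoUniformly_iff] at hu ⊢
    intro ε hε
    have hB0 : 0 < |B| + 1 := by positivity
    filter_upwards [hu (ε / (|B| + 1)) (by positivity)] with S hS x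
    rw [dist_eq_norm, ← inner_sub_left]
    have h3 := hS x
    rw [dist_eq_norm] at h3
    calc _ ≤ ‖trigSeries c x - ∑ ξ ∈ S, trigTerm ξ.rep (c ξ) x‖ * ‖trigSeries c x‖ :=
          norm_inner_le_norm _ _
      _ ≤ ‖trigSeries c x - ∑ ξ ∈ S, trigTerm ξ.rep (c ξ) x‖ * (|B| + 1) := by
          gcongr
          linarith [hB' x, le_abs_self B]
      _ < ε / (|B| + 1) * (|B| + 1) := by gcongr
      _ = ε := by field_simp

end Series

end FourierSeries


/-! ### The Peter-Weyl theorem -/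

section PeterWeyl

open scoped ComplexConjugate
open Filter Topology

variable {G : Type*} [Group G] [TopologicalSpace G] [IsTopologicalGroup G] [CompactSpace G]
  [SecondCountableTopology G]
  [MeasurableSpace G] [BorelSpace G] (μ : Measure G) [μ.IsHaarMeasure] [IsProbabilityMeasure μ]

/-- The translate `x ↦ φ(g⁻¹ x)`. -/
def translate (g : G) : C(G, ℂ) →ₗ[ℂ] C(G, ℂ) where
  toFun φ := ⟨fun x => φ (g⁻¹ * x), φ.continuous.comp (continuous_const_mul g⁻¹)⟩
  map_add' _ _ := rfl
  map_smul' _ _ := rfl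

lemma translate_apply (g : G) (φ : C(G, ℂ)) (x : G) : translate g φ x = φ (g⁻¹ * x) := rfl

lemma translate_mul (g h : G) (φ : C(G, ℂ)) :
    translate (g * h) φ = translate g (translate h φ) := by
  ext x
  simp [translate_apply, mul_assoc]

/-- The inner product of `L²(G)` on continuous functions. -/
def l2Inner (φ ψ : C(G, ℂ)) : ℂ := ∫ x, conj (φ x) * ψ x ∂μ

lemma l2Inner_translate (g : G) (φ ψ : C(G, ℂ)) :
    l2Inner μ (translate g φ) (translate g ψ) = l2Inner μ φ ψ :=
  integral_mul_left_eq_self (μ := μ) (fun x => conj (φ x) * ψ x) g⁻¹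

/-- Supplies the continuity of the representation built on a finite-dimensional invariant space. -/
lemma continuous_l2Inner_translate (φ ψ : C(G, ℂ)) :
    Continuous fun g => l2Inner μ φ (translate g ψ) := by
  have h : Continuous (Function.uncurry fun g x : G => conj (φ x) * ψ (g⁻¹ * x)) := by
    have h1 := φ.continuous
    have h2 := ψ.continuous
    fun_prop
  refine (continuous_parametric_integral_of_continuous (μ := μ) h isCompact_univ).congr fun g => ?_
  rw [setIntegral_univ]
  rfl

lemma l2Inner_sum_right {ι : Type*} (s : Finset ι) (φ : C(G, ℂ)) (a : ι → ℂ) (ψ : ι → C(G, ℂ)) :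
    l2Inner μ φ (∑ i ∈ s, a i • ψ i) = ∑ i ∈ s, a i * l2Inner μ φ (ψ i) := by
  simp only [l2Inner, ContinuousMap.coe_sum, Finset.sum_apply, ContinuousMap.smul_apply,
    smul_eq_mul, Finset.mul_sum]
  rw [integral_finsetSum _ fun i _ => integrable_of_continuous μ (by fun_prop)]
  refine Finset.sum_congr rfl fun i _ => ?_
  rw [← integral_const_mul]
  refine integral_congr_ae (Eventually.of_forall fun x => ?_)
  change _ * (a i * _) = a i * _
  ring

lemma l2Inner_conj_symm (φ ψ : C(G, ℂ)) : conj (l2Inner μ φ ψ) = l2Inner μ ψ φ := by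
  simp only [l2Inner]
  rw [← integral_conj]
  refine integral_congr_ae (Eventually.of_forall fun x => ?_)
  simp [mul_comm]

lemma l2Inner_sum_left {ι : Type*} (s : Finset ι) (φ : C(G, ℂ)) (a : ι → ℂ) (ψ : ι → C(G, ℂ)) :
    l2Inner μ (∑ i ∈ s, a i • ψ i) φ = ∑ i ∈ s, conj (a i) * l2Inner μ (ψ i) φ := by
  rw [← l2Inner_conj_symm, l2Inner_sum_right, map_sum]
  simp only [map_mul, l2Inner_conj_symm]

lemma l2Inner_eq_inner (φ ψ : C(G, ℂ)) :
    l2Inner μ φ ψ = inner ℂ (ContinuousMap.toLp 2 μ ℂ φ) (ContinuousMap.toLp 2 μ ℂ ψ) := by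
  rw [ContinuousMap.inner_toLp]
  refine integral_congr_ae (Eventually.of_forall fun x => ?_)
  simp [mul_comm]

/-- An orthonormal basis of a finite-dimensional space of continuous functions. -/
lemma exists_orthonormal_basis (F : Submodule ℂ C(G, ℂ)) [FiniteDimensional ℂ F] :
    ∃ (d : ℕ) (e : Fin d → C(G, ℂ)), d = Module.finrank ℂ F ∧ (∀ i, e i ∈ F) ∧
      (∀ i j, l2Inner μ (e i) (e j) = if i = j then 1 else 0) ∧
      ∀ φ ∈ F, φ = ∑ i, l2Inner μ (e i) φ • e i := by
  set J := (ContinuousMap.toLp (E := ℂ) 2 μ ℂ).toLinearMap with hJ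
  have hinj : Function.Injective J := ContinuousMap.toLp_injective μ
  let eq := F.equivMapOfInjective J hinj
  have hfin : FiniteDimensional ℂ (F.map J) := inferInstance
  have hrank : Module.finrank ℂ (F.map J) = Module.finrank ℂ F := eq.finrank_eq.symm
  let b := (stdOrthonormalBasis ℂ (F.map J)).reindex (finCongr hrank)
  have hb : ∀ i, J (eq.symm (b i)) = (b i : Lp ℂ 2 μ) := fun i =>
    congrArg Subtype.val (eq.apply_symm_apply (b i))
  refine ⟨_, fun i => eq.symm (b i), rfl, fun i => (eq.symm (b i)).2, fun i j => ?_, fun φ hφ => ?_⟩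
  · rw [l2Inner_eq_inner]
    change inner ℂ (J (eq.symm (b i))) (J (eq.symm (b j))) = _
    rw [hb, hb]
    exact orthonormal_iff_ite.1 b.orthonormal i j
  · apply hinj
    have h := congrArg Subtype.val (b.sum_repr' ⟨J φ, Submodule.mem_map_of_mem hφ⟩)
    rw [map_sum]
    refine h.symm.trans ?_
    rw [AddSubmonoidClass.coe_finsetSum]
    refine Finset.sum_congr rfl fun i _ => ?_
    rw [map_smul, hb, l2Inner_eq_inner]
    change _ = inner ℂ (J (eq.symm (b i))) (J φ) • _
    rw [hb]
    rfl

include μ in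
/-- A nonzero finite-dimensional translation-invariant space of continuous functions contains
a nonzero linear combination of conjugates of matrix coefficients of an irreducible
representation. -/
theorem exists_coeff_combination_mem (F : Submodule ℂ C(G, ℂ)) [FiniteDimensional ℂ F]
    (hF : F ≠ ⊥) (hinv : ∀ g, ∀ φ ∈ F, translate g φ ∈ F) :
    ∃ (U : UnitaryIrrep G) (φ : C(G, ℂ)) (j : Fin U.dim) (a : Fin U.dim → ℂ),
      φ ∈ F ∧ φ ≠ 0 ∧ ∀ x, φ x = ∑ i, a i * conj (U.coeff j i x) := by
  classical
  -- A nonzero invariant subspace of least dimension carries an irreducible representation. In an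
  -- orthonormal basis it is given by unitary matrices, since translation preserves the `L²` inner
  -- product.
  obtain ⟨F', ⟨hF'F, hF'0, hF'inv⟩, hmin⟩ :=
    exists_minimalFor_of_wellFoundedLT (fun F' : Submodule ℂ C(G, ℂ) => F' ≤ F ∧ F' ≠ ⊥ ∧
      ∀ g, ∀ φ ∈ F', translate g φ ∈ F') (fun F' => Module.finrank ℂ F') ⟨F, le_rfl, hF, hinv⟩
  have hfin : FiniteDimensional ℂ F' := Submodule.finiteDimensional_of_le hF'F
  obtain ⟨d, e, hd, heF, heo, hexp⟩ := exists_orthonormal_basis μ F'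
  have htr : ∀ g j, translate g (e j) = ∑ i, l2Inner μ (e i) (translate g (e j)) • e i :=
    fun g j => hexp _ (hF'inv g _ (heF j))
  have hdpos : 0 < d := by
    have : Nontrivial F' := Submodule.nontrivial_iff_ne_bot.2 hF'0
    rw [hd]
    exact Module.finrank_pos
  let M : G → Matrix (Fin d) (Fin d) ℂ := fun g =>
    Matrix.of fun i j => l2Inner μ (e i) (translate g (e j))
  have hM : ∀ g i j, M g i j = l2Inner μ (e i) (translate g (e j)) := fun _ _ _ => rfl
  have htr' : ∀ g j, translate g (e j) = ∑ i, M g i j • e i := htr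
  have hMmul : ∀ g h, M (g * h) = M g * M h := fun g h => by
    ext i j
    rw [hM, translate_mul, htr' h, map_sum, Matrix.mul_apply]
    simp only [map_smul, l2Inner_sum_right, ← hM]
    exact Finset.sum_congr rfl fun k _ => mul_comm _ _
  have hMu : ∀ g, M g ∈ Matrix.unitaryGroup (Fin d) ℂ := fun g => by
    rw [Matrix.mem_unitaryGroup_iff']
    ext i j
    rw [Matrix.star_eq_conjTranspose, Matrix.mul_apply, Matrix.one_apply, ← heo,
      ← l2Inner_translate μ g, htr' g i, l2Inner_sum_left]
    exact Finset.sum_congr rfl fun k _ => rfl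
  let U : UnitaryIrrep G :=
    { dim := d
      toHom := MonoidHom.mk' (fun g => ⟨M g, hMu g⟩) fun g h => Subtype.ext (hMmul g h)
      continuous_toHom := Continuous.subtype_mk
        (continuous_matrix fun i j => continuous_l2Inner_translate μ (e i) (e j)) _
      dim_pos := hdpos
      -- The coordinate map `L` carries an invariant subspace of `ℂ^d` to an invariant subspace of
      -- `F'`, which is `0` or `F'` by minimality of the dimension.
      irreducible := fun S hS => by
        have hS' : ∀ g, ∀ v ∈ S, Matrix.mulVec (M g) v ∈ S := hS
        let L : (Fin d → ℂ) →ₗ[ℂ] C(G, ℂ) := Fintype.linearCombination ℂ e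
        have hLapp : ∀ v, L v = ∑ i, v i • e i := fun v => rfl
        have hcoord : ∀ v i, l2Inner μ (e i) (L v) = v i := fun v i => by
          rw [hLapp, l2Inner_sum_right]
          simp [heo]
        have hLinj : Function.Injective L := fun v w h => by
          funext i
          rw [← hcoord v, h, hcoord]
        have hLF : ∀ v, L v ∈ F' := fun v => by
          rw [hLapp]
          exact Submodule.sum_mem _ fun i _ => Submodule.smul_mem _ _ (heF i)
        have hLtr : ∀ g v, translate g (L v) = L (Matrix.mulVec (M g) v) := fun g v => by
          simp only [hLapp, map_sum, map_smul, htr' g, Matrix.mulVec, dotProduct, Finset.smul_sum,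
            Finset.sum_smul, smul_smul]
          rw [Finset.sum_comm]
          exact Finset.sum_congr rfl fun i _ => Finset.sum_congr rfl fun j _ => by rw [mul_comm]
        by_cases h0 : S = ⊥
        · exact Or.inl h0
        right
        have hle : S.map L ≤ F' := by
          rintro _ ⟨v, -, rfl⟩
          exact hLF v
        have hne : S.map L ≠ ⊥ := fun h => h0 ((Submodule.eq_bot_iff _).2 fun v hv => hLinj (by
          have h1 : L v ∈ S.map L := Submodule.mem_map_of_mem hv
          rw [h, Submodule.mem_bot] at h1
          rw [h1, map_zero]))
        have hinvL : ∀ g, ∀ φ ∈ S.map L, translate g φ ∈ S.map L := by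
          rintro g _ ⟨v, hv, rfl⟩
          exact ⟨_, hS' g v hv, (hLtr g v).symm⟩
        have heq := Submodule.eq_of_le_of_finrank_le hle
          (hmin (j := S.map L) ⟨hle.trans hF'F, hne, hinvL⟩ (Submodule.finrank_mono hle))
        rw [eq_top_iff]
        rintro v -
        obtain ⟨w, hw, hwv⟩ : L v ∈ S.map L := heq ▸ hLF v
        exact hLinj hwv ▸ hw }
  refine ⟨U, e ⟨0, hdpos⟩, ⟨0, hdpos⟩, fun i => e i 1, hF'F (heF _), fun h => ?_, fun x => ?_⟩
  · have := heo ⟨0, hdpos⟩ ⟨0, hdpos⟩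
    rw [h] at this
    simp [l2Inner] at this
  -- Evaluating a translate at the identity recovers the function, so the values `e i 1` are the
  -- coefficients of the combination.
  · have h1 : e ⟨0, hdpos⟩ x = translate x⁻¹ (e ⟨0, hdpos⟩) 1 := by simp [translate_apply]
    rw [h1, htr', ContinuousMap.coe_sum, Finset.sum_apply]
    refine Finset.sum_congr rfl fun i _ => ?_
    rw [ContinuousMap.smul_apply, smul_eq_mul, mul_comm]
    congr 1
    exact U.coeff_inv i ⟨0, hdpos⟩ x

/-- The coefficients of equivalent representations are linear combinations of each other. This
passes from the chosen representatives to every irreducible representation. -/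
lemma fourierCoeff_eq_zero_of_equivalent {ξ η : UnitaryIrrep G} (h : UnitaryIrrep.Equivalent ξ η)
    {w : G → ℂ} (hw : Continuous w) (h0 : fourierCoeff μ ξ w = 0) : fourierCoeff μ η w = 0 := by
  obtain ⟨T, hT⟩ := h
  let P := LinearMap.toMatrix' (T : (Fin ξ.dim → ℂ) →ₗ[ℂ] (Fin η.dim → ℂ))
  let Q := LinearMap.toMatrix' (T.symm : (Fin η.dim → ℂ) →ₗ[ℂ] (Fin ξ.dim → ℂ))
  have hPQ : ∀ g, η.mat g = P * ξ.mat g * Q := fun g => by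
    apply Matrix.toLin'.injective
    rw [Matrix.toLin'_mul, Matrix.toLin'_mul, Matrix.toLin'_toMatrix', Matrix.toLin'_toMatrix']
    refine LinearMap.ext fun v => ?_
    simp only [LinearMap.comp_apply, Matrix.toLin'_apply, LinearEquiv.coe_coe]
    refine Eq.trans ?_ (hT g _).symm
    rw [LinearEquiv.apply_symm_apply]
    rfl
  have hcoeff : ∀ i j g, η.coeff i j g = ∑ l, ∑ k, P i k * ξ.coeff k l g * Q l j :=
    fun i j g => by
      refine (congrFun₂ (hPQ g) i j).trans ?_
      rw [Matrix.mul_apply]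
      refine Finset.sum_congr rfl fun l _ => ?_
      rw [Matrix.mul_apply, Finset.sum_mul]
      rfl
  ext i j
  have hint : ∀ k l, Integrable (fun y => star (ξ.coeff k l y) * w y) μ := fun k l =>
    integrable_of_continuous μ ((ξ.continuous_coeff k l).star.mul hw)
  have h0' : ∀ k l, ∫ y, star (ξ.coeff k l y) * w y ∂μ = 0 := fun k l => congrFun₂ h0 l k
  have : ∀ y, star (η.coeff j i y) • w y =
      ∑ l, ∑ k, star (P j k * Q l i) * (star (ξ.coeff k l y) * w y) := fun y => by
    rw [hcoeff, star_sum, Finset.sum_smul]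
    refine Finset.sum_congr rfl fun l _ => ?_
    rw [star_sum, Finset.sum_smul]
    refine Finset.sum_congr rfl fun k _ => ?_
    simp only [star_mul, smul_eq_mul]
    ring
  simp only [fourierCoeff, this]
  rw [integral_finsetSum _ fun l _ => integrable_finsetSum _ fun k _ => (hint k l).const_mul _]
  simp only [integral_finsetSum _ fun k _ => (hint k _).const_mul _, integral_const_mul, h0',
    mul_zero, Finset.sum_const_zero, Pi.zero_apply]

end PeterWeyl


/-! ### Completeness of the matrix coefficients, through a compact convolution operator. -/

section PeterWeylCompleteness

open scoped ComplexConjugate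
open Filter Topology

variable {G : Type*} [Group G] [TopologicalSpace G] [IsTopologicalGroup G] [CompactSpace G]
  [SecondCountableTopology G]
  [MeasurableSpace G] [BorelSpace G] (μ : Measure G) [μ.IsHaarMeasure] [IsProbabilityMeasure μ]

/-- The operator `f ↦ (x ↦ ⟪k x, f⟫)` for a continuous map `k` to a Hilbert space. -/
def kernelOp {H : Type*} [NormedAddCommGroup H] [InnerProductSpace ℂ H] (k : C(G, H)) :
    H →L[ℂ] BoundedContinuousFunction G ℂ :=
  LinearMap.mkContinuous
    { toFun := fun f => BoundedContinuousFunction.mkOfCompact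
        ⟨fun x => inner ℂ (k x) f, k.continuous.inner continuous_const⟩
      map_add' := fun f g => by
        ext x
        simp
      map_smul' := fun a f => by
        ext x
        simp } ‖k‖ fun f => by
    refine (BoundedContinuousFunction.norm_le (by positivity)).2 fun x => ?_
    exact (norm_inner_le_norm _ _).trans
      (mul_le_mul_of_nonneg_right (k.norm_coe_le_norm x) (norm_nonneg _))

/-- Arzelà-Ascoli: on the unit ball the images are bounded by `‖k‖`, and they are equicontinuous
because `|⟪k x₀ - k x, f⟫| ≤ ‖k x₀ - k x‖`. -/
lemma isCompactOperator_kernelOp {H : Type*} [NormedAddCommGroup H] [InnerProductSpace ℂ H]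
    (k : C(G, H)) : IsCompactOperator (kernelOp k) := by
  refine (isCompactOperator_iff_isCompact_closure_image_closedBall
    (kernelOp k).toLinearMap zero_lt_one).2 ?_
  refine BoundedContinuousFunction.arzela_ascoli (Metric.closedBall (0 : ℂ) ‖k‖)
    (isCompact_closedBall _ _) _ ?_ ?_
  · rintro _ x ⟨f, hf, rfl⟩
    rw [mem_closedBall_zero_iff] at hf ⊢
    refine (norm_inner_le_norm (𝕜 := ℂ) (k x) f).trans ?_
    calc ‖k x‖ * ‖f‖ ≤ ‖k‖ * 1 := by
          gcongr
          exact k.norm_coe_le_norm x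
      _ = ‖k‖ := mul_one _
  · intro x₀
    rw [Metric.equicontinuousAt_iff_right]
    intro ε hε
    have hk := Metric.tendsto_nhds.1 (k.continuous.tendsto x₀) ε hε
    filter_upwards [hk] with x hx
    rintro ⟨_, f, hf, rfl⟩
    rw [mem_closedBall_zero_iff] at hf
    change dist (inner ℂ (k x₀) f) (inner ℂ (k x) f) < ε
    rw [dist_eq_norm, ← inner_sub_left]
    refine (norm_inner_le_norm _ _).trans_lt ?_
    rw [dist_comm, dist_eq_norm] at hx
    calc ‖k x₀ - k x‖ * ‖f‖ ≤ ‖k x₀ - k x‖ * 1 := by gcongr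
      _ < ε := by rwa [mul_one]

/-- The continuous map `x ↦ (y ↦ w(y⁻¹x))`. -/
def convKernel (w : C(G, ℂ)) : C(G, C(G, ℂ)) :=
  ContinuousMap.curry ⟨fun p : G × G => w (p.2⁻¹ * p.1), by fun_prop⟩

lemma convKernel_apply (w : C(G, ℂ)) (x y : G) : convKernel w x y = w (y⁻¹ * x) := rfl

/-- Completeness of the matrix coefficients: a continuous function whose Fourier coefficients all
vanish is zero. -/
theorem eq_zero_of_fourierCoeff_eq_zero {w : G → ℂ} (hw : Continuous w)
    (h0 : ∀ ξ : UnitaryDual G, fourierCoeff μ ξ.rep w = 0) : w = 0 := by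
  -- The representation found below in an eigenspace need not be a chosen representative of its
  -- class.
  have h0' : ∀ U : UnitaryIrrep G, fourierCoeff μ U w = 0 := fun U =>
    fourierCoeff_eq_zero_of_equivalent μ
      (Quotient.mk_out (s := UnitaryIrrep.setoid G) U) hw (h0 (Quotient.mk _ U))
  set J := ContinuousMap.toLp (E := ℂ) 2 μ ℂ with hJ
  have hJinj : Function.Injective J := ContinuousMap.toLp_injective μ
  let k := convKernel ⟨w, hw⟩
  let kL : C(G, Lp ℂ 2 μ) := ⟨fun x => J (k x), J.continuous.comp k.continuous⟩
  let j := BoundedContinuousFunction.toLp (E := ℂ) 2 μ ℂ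
  let S : Lp ℂ 2 μ →L[ℂ] Lp ℂ 2 μ := j ∘L kernelOp kL
  have hScpt : IsCompactOperator S := (isCompactOperator_kernelOp kL).clm_comp j
  -- `S` itself need not be self-adjoint; `SS*` is, it is compact, and its vanishing forces `S = 0`.
  let T : Lp ℂ 2 μ →L[ℂ] Lp ℂ 2 μ := S ∘L ContinuousLinearMap.adjoint S
  have hTcpt : IsCompactOperator T := hScpt.comp_clm (ContinuousLinearMap.adjoint S)
  have hTsymm : (T : Lp ℂ 2 μ →ₗ[ℂ] Lp ℂ 2 μ).IsSymmetric :=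
    (ContinuousLinearMap.isPositive_self_comp_adjoint S).isSelfAdjoint.isSymmetric
  -- the adjoint of `S` on continuous functions
  let R : C(G, ℂ) → C(G, ℂ) := fun φ => ∫ x, φ x • k x ∂μ
  have hRint : ∀ φ : C(G, ℂ), Integrable (fun x => φ x • k x) μ := fun φ =>
    integrable_of_continuous μ (φ.continuous.smul k.continuous)
  have hR : ∀ φ y, R φ y = ∫ x, φ x * w (y⁻¹ * x) ∂μ := fun φ y =>
    ((ContinuousMap.evalCLM ℂ y).integral_comp_comm (hRint φ)).symm
  have hadj : ∀ φ, ContinuousLinearMap.adjoint S (J φ) = J (R φ) := fun φ => by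
    refine ext_inner_left ℂ fun h => ?_
    rw [ContinuousLinearMap.adjoint_inner_right]
    have h1 : J (R φ) = ∫ x, φ x • kL x ∂μ := by
      rw [← J.integral_comp_comm (hRint φ)]
      simp only [map_smul]
      rfl
    have h2 : Integrable (fun x => φ x • kL x) μ :=
      integrable_of_continuous μ (φ.continuous.smul kL.continuous)
    rw [h1, ← integral_inner h2]
    change inner ℂ (J (kernelOp kL h).toContinuousMap) (J φ) = _
    rw [← l2Inner_eq_inner]
    refine integral_congr_ae (Eventually.of_forall fun x => ?_)
    change conj (inner ℂ (kL x) h) * φ x = inner ℂ h (φ x • kL x)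
    rw [inner_smul_right, inner_conj_symm, mul_comm]
  let S' : C(G, ℂ) → C(G, ℂ) := fun ψ => (kernelOp kL (J ψ)).toContinuousMap
  have hS' : ∀ ψ x, S' ψ x = ∫ y, conj (w (y⁻¹ * x)) * ψ y ∂μ := fun ψ x =>
    (l2Inner_eq_inner μ (k x) ψ).symm
  have hTJ : ∀ φ, T (J φ) = J (S' (R φ)) := fun φ => by
    change S (ContinuousLinearMap.adjoint S (J φ)) = _
    rw [hadj]
    rfl
  -- there is no nonzero eigenvalue
  have hev : ∀ c : ℂ, Module.End.HasEigenvalue (T : Module.End ℂ (Lp ℂ 2 μ)) c → c = 0 := by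
    intro c hc
    by_contra hc0
    let E := Module.End.eigenspace (T : Module.End ℂ (Lp ℂ 2 μ)) c
    have hEfin : FiniteDimensional ℂ E := 
      ContinuousLinearMap.finite_dimensional_eigenspace hTcpt c hc0
    let F : Submodule ℂ C(G, ℂ) := E.comap J.toLinearMap
    have hFmem : ∀ φ, φ ∈ F ↔ S' (R φ) = c • φ := fun φ => by
      rw [← hJinj.eq_iff, map_smul, ← hTJ]
      exact Module.End.mem_eigenspace_iff
    have hFfin : FiniteDimensional ℂ F :=
      FiniteDimensional.of_injective (J.toLinearMap.restrict (p := F) (q := E) fun φ hφ => hφ)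
        fun a b hab => Subtype.ext (hJinj (congrArg Subtype.val hab))
    -- An eigenvector is only an `L²` class, but `c f = T f` lies in the image of `kernelOp`; since
    -- `c ≠ 0`, it has a continuous representative.
    have hF0 : F ≠ ⊥ := by
      obtain ⟨f, hf, hf0⟩ := hc.exists_hasEigenvector
      have hTf : T f = c • f := Module.End.mem_eigenspace_iff.1 hf
      intro hbot
      have h1 : J (kernelOp kL (ContinuousLinearMap.adjoint S f)).toContinuousMap = c • f := hTf
      have h2 : (kernelOp kL (ContinuousLinearMap.adjoint S f)).toContinuousMap ∈ F := by
        change J _ ∈ E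
        rw [h1]
        exact E.smul_mem c hf
      rw [hbot, Submodule.mem_bot] at h2
      rw [h2, map_zero] at h1
      exact hf0 ((smul_eq_zero.1 h1.symm).resolve_left hc0)
    have hFinv : ∀ g, ∀ φ ∈ F, translate g φ ∈ F := by
      intro g φ hφ
      rw [hFmem] at hφ ⊢
      have hRt : R (translate g φ) = translate g (R φ) := by
        ext y
        rw [translate_apply, hR, hR, ← integral_mul_left_eq_self _ g]
        simp [translate_apply, mul_assoc]
      have hSt : ∀ ψ, S' (translate g ψ) = translate g (S' ψ) := fun ψ => by
        ext y
        rw [translate_apply, hS', hS', ← integral_mul_left_eq_self _ g]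
        simp [translate_apply, mul_assoc]
      rw [hRt, hSt, hφ, map_smul]
    obtain ⟨U, φ, l, a, hφF, hφ0, hφ⟩ := exists_coeff_combination_mem μ F hF0 hFinv
    -- After the substitution `x ↦ yx`, `R φ (y) = ∫ φ(yx) w(x) dx` with `φ` a combination of
    -- conjugate coefficients: what remains are Fourier coefficients of `w`, which vanish. Then `c φ
    -- = S' (R φ) = 0`, contradicting `φ ≠ 0`.
    have hRφ : R φ = 0 := by
      ext y
      rw [hR, ← integral_mul_left_eq_self _ y]
      have : ∀ x, φ (y * x) * w (y⁻¹ * (y * x)) =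
          ∑ i, ∑ m, a i * conj (U.coeff l m y) * (star (U.coeff m i x) • w x) := fun x => by
        rw [hφ, inv_mul_cancel_left, Finset.sum_mul]
        refine Finset.sum_congr rfl fun i _ => ?_
        rw [U.coeff_mul, map_sum, Finset.mul_sum, Finset.sum_mul]
        refine Finset.sum_congr rfl fun m _ => ?_
        rw [map_mul, smul_eq_mul, Complex.star_def]
        ring
      simp only [this]
      have hint : ∀ i m, Integrable
          (fun x => a i * conj (U.coeff l m y) * (star (U.coeff m i x) • w x)) μ := fun i m =>
        (integrable_coeff_smul μ U m i hw).const_mul _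
      rw [integral_finsetSum _ fun i _ => integrable_finsetSum _ fun m _ => hint i m]
      refine Finset.sum_eq_zero fun i _ => ?_
      rw [integral_finsetSum _ fun m _ => hint i m]
      refine Finset.sum_eq_zero fun m _ => ?_
      rw [integral_const_mul]
      have h3 : ∫ x, star (U.coeff m i x) • w x ∂μ = 0 := congrFun₂ (h0' U) i m
      rw [h3, mul_zero]
    have h4 := (hFmem φ).1 hφF
    rw [hRφ] at h4
    have h5 : S' 0 = 0 := by
      ext x
      rw [hS']
      simp
    rw [h5] at h4
    exact hφ0 ((smul_eq_zero.1 h4.symm).resolve_left hc0)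
  have hT0 : T = 0 :=
    (ContinuousLinearMap.eq_zero_of_forall_hasEigenvalue_eq_zero hTcpt hTsymm).1 hev
  have hadj0 : ∀ f, ContinuousLinearMap.adjoint S f = 0 := fun f => by
    rw [← inner_self_eq_zero (𝕜 := ℂ), ContinuousLinearMap.adjoint_inner_right]
    change inner ℂ (T f) f = 0
    rw [hT0, zero_apply, inner_zero_left]
  have hS0 : S = 0 := by
    rw [← ContinuousLinearMap.adjoint_adjoint S]
    have : ContinuousLinearMap.adjoint S = 0 := ContinuousLinearMap.ext hadj0
    rw [this, map_zero]
  funext x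
  -- Applied to its own kernel at `x`, the operator takes at `x` the value `‖kL x‖²`. So the
  -- continuous function `y ↦ w(y⁻¹x)` vanishes, and its value at `y = 1` is `w x`.
  have h1 : J (kernelOp kL (kL x)).toContinuousMap = 0 := congrArg (fun T => T (kL x)) hS0
  have h2 : (kernelOp kL (kL x)).toContinuousMap = 0 := hJinj (h1.trans (map_zero J).symm)
  have h3 : inner ℂ (kL x) (kL x) = 0 := congrArg (fun φ : C(G, ℂ) => φ x) h2
  have h4 : k x = 0 := hJinj ((inner_self_eq_zero.1 h3).trans (map_zero J).symm)
  have h5 := congrArg (fun φ : C(G, ℂ) => φ 1) h4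
  simpa [k, convKernel_apply] using h5

/-- A continuous function with values in a Hilbert space is determined by its Fourier
coefficients. -/
theorem eq_of_fourierCoeff_eq {W : Type*} [NormedAddCommGroup W] [InnerProductSpace ℂ W]
    [CompleteSpace W] {u v : G → W} (hu : Continuous u) (hv : Continuous v)
    (h : ∀ ξ : UnitaryDual G, fourierCoeff μ ξ.rep u = fourierCoeff μ ξ.rep v) : u = v := by
  funext x
  rw [← sub_eq_zero]
  refine ext_inner_left ℂ fun w => ?_
  have h1 := eq_zero_of_fourierCoeff_eq_zero μ (w := fun x => inner ℂ w (u x - v x))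
    (continuous_const.inner (hu.sub hv)) fun ξ => by
      ext i j
      have h2 : fourierCoeff μ ξ.rep (fun x => u x - v x) i j = 0 := by
        rw [fourierCoeff_sub μ _ hu hv, h, sub_self]
        rfl
      have h3 : Integrable (fun y => star (ξ.rep.coeff j i y) • (u y - v y)) μ :=
        integrable_coeff_smul μ ξ.rep j i (hu.sub hv)
      simp only [fourierCoeff, smul_eq_mul, ← inner_smul_right]
      rw [integral_inner h3]
      exact (congrArg _ h2).trans (inner_zero_right w)
  rw [inner_zero_right]
  exact congrFun h1 x

/-- Fourier inversion for a continuous function whose Fourier series converges absolutely and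
uniformly. -/
theorem trigSeries_fourierCoeff {W : Type*} [NormedAddCommGroup W] [InnerProductSpace ℂ W]
    [CompleteSpace W] {u : G → W} (hu : Continuous u) {b : UnitaryDual G → ℝ} (hb : Summable b)
    (hc : ∀ (ξ : UnitaryDual G) x, ‖fourierTerm μ ξ.rep u x‖ ≤ b ξ) :
    trigSeries (fun ξ => fourierCoeff μ ξ.rep u) = u :=
  eq_of_fourierCoeff_eq μ (continuous_trigSeries hb hc) hu fun ξ =>
    fourierCoeff_trigSeries μ hb hc ξ

end PeterWeylCompleteness


/-! ### Calculus on a Lie group in the chart at the identity -/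

section Calculus

open Filter Topology Set

variable {V : Type*} [NormedAddCommGroup V] [NormedSpace ℝ V]
  {G : Type*} [TopologicalSpace G] [ChartedSpace V G]
  {W : Type*} [NormedAddCommGroup W] [NormedSpace ℝ W]

/-- A family of functions on an open subset of `V`, with a parameter in `G`, which is smooth in all
variables. -/
def JointlySmooth (U : Set V) (H : G → V → W) : Prop :=
  ContMDiffOn (𝓘(ℝ, V).prod 𝓘(ℝ, V)) 𝓘(ℝ, W) ∞ (Function.uncurry H) (univ ×ˢ U)

/-- The manifold derivative in the vector variable depends smoothly on the parameter; between vector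
spaces it is the ordinary derivative, as tangent coordinates are trivial. -/
lemma JointlySmooth.fderiv {U : Set V} (hU : IsOpen U) {H : G → V → W}
    [IsManifold 𝓘(ℝ, V) ∞ G] (h : JointlySmooth U H) :
    ContMDiffOn (𝓘(ℝ, V).prod 𝓘(ℝ, V)) 𝓘(ℝ, V →L[ℝ] W) ∞
      (fun p : G × V => fderiv ℝ (H p.1) p.2) (univ ×ˢ U) := by
  rintro ⟨y, v⟩ hv
  have hopen : IsOpen ((univ : Set G) ×ˢ U) := isOpen_univ.prod hU
  have h1 : ContMDiffAt ((𝓘(ℝ, V).prod 𝓘(ℝ, V)).prod 𝓘(ℝ, V)) 𝓘(ℝ, W) ∞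
      (Function.uncurry fun (p : G × V) (w : V) => H p.1 w) ((y, v), v) := by
    have h2 : ContMDiffAt (𝓘(ℝ, V).prod 𝓘(ℝ, V)) 𝓘(ℝ, W) ∞ (Function.uncurry H) (y, v) :=
      (h _ hv).contMDiffAt (hopen.mem_nhds hv)
    have h3 : ContMDiffAt ((𝓘(ℝ, V).prod 𝓘(ℝ, V)).prod 𝓘(ℝ, V)) (𝓘(ℝ, V).prod 𝓘(ℝ, V)) ∞
        (fun q : (G × V) × V => (q.1.1, q.2)) ((y, v), v) :=
      (contMDiffAt_fst.fst).prodMk contMDiffAt_snd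
    exact ContMDiffAt.comp ((y, v), v) h2 h3
  have h4 := ContMDiffAt.mfderiv (fun (p : G × V) (w : V) => H p.1 w) Prod.snd h1
    (contMDiffAt_snd (n := ∞)) (by simp)
  have h5 := inTangentCoordinates_model_space (I := 𝓘(ℝ, V)) (I' := 𝓘(ℝ, W))
    (Prod.snd : G × V → V) (fun p => H p.1 p.2)
    (fun p => mfderiv 𝓘(ℝ, V) 𝓘(ℝ, W) (fun w => H p.1 w) p.2) (y, v)
  have h6 : (fun p : G × V => _root_.fderiv ℝ (H p.1) p.2) =
      fun p => mfderiv 𝓘(ℝ, V) 𝓘(ℝ, W) (fun w => H p.1 w) p.2 :=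
    funext fun p => mfderiv_eq_fderiv.symm
  rw [h6]
  exact (h5 ▸ h4 : ContMDiffAt _ _ _ _ _).contMDiffWithinAt

lemma JointlySmooth.fderiv_apply {U : Set V} (hU : IsOpen U) {H : G → V → W}
    [IsManifold 𝓘(ℝ, V) ∞ G] (h : JointlySmooth U H) (e : V) :
    JointlySmooth U (fun y v => _root_.fderiv ℝ (H y) v e) := by
  have h1 := h.fderiv hU
  exact (ContinuousLinearMap.apply ℝ W e).contMDiff.comp_contMDiffOn h1

lemma JointlySmooth.contDiffOn {U : Set V} {H : G → V → W}
    (h : JointlySmooth U H) (y : G) : ContDiffOn ℝ ∞ (H y) U := by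
  rw [← contMDiffOn_iff_contDiffOn]
  exact ContMDiffOn.comp (g := Function.uncurry H) (f := fun v => (y, v)) h (contMDiffOn_const.prodMk contMDiffOn_id) fun v hv => ⟨mem_univ _, hv⟩

lemma JointlySmooth.differentiableAt {U : Set V} (hU : IsOpen U) {H : G → V → W}
    (h : JointlySmooth U H) (y : G) {v : V} (hv : v ∈ U) : DifferentiableAt ℝ (H y) v :=
  ((h.contDiffOn y).contDiffAt (hU.mem_nhds hv)).differentiableAt (by simp)

variable [CompactSpace G] [MeasurableSpace G] [BorelSpace G] [FiniteDimensional ℝ V]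
  [SecondCountableTopology G]
  (μ : Measure G) [IsFiniteMeasure μ] 

/-- Differentiation under the integral: `G` times a closed ball is compact, so the derivative of the
integrand is dominated by a constant. -/
lemma JointlySmooth.hasFDerivAt_integral {U : Set V} (hU : IsOpen U) {H : G → V → W}
    [IsManifold 𝓘(ℝ, V) ∞ G] (h : JointlySmooth U H) {a : G → ℝ} (ha : Continuous a)
    {v₀ : V} (hv₀ : v₀ ∈ U) :
    HasFDerivAt (fun v => ∫ y, a y • H y v ∂μ) (∫ y, a y • _root_.fderiv ℝ (H y) v₀ ∂μ) v₀ := by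
  obtain ⟨r, hr, hball⟩ := Metric.isOpen_iff.1 hU v₀ hv₀
  have hcl : Metric.closedBall v₀ (r / 2) ⊆ U :=
    (Metric.closedBall_subset_ball (half_lt_self hr)).trans hball
  have hD : ContinuousOn (fun p : G × V => a p.1 • _root_.fderiv ℝ (H p.1) p.2) (univ ×ˢ U) :=
    (ha.comp continuous_fst).continuousOn.smul (h.fderiv hU).continuousOn
  obtain ⟨C, hC⟩ := (isCompact_univ.prod (isCompact_closedBall v₀ (r / 2))).exists_bound_of_continuousOn
    (hD.mono (prod_mono le_rfl hcl))
  have hslice : ∀ v ∈ U, Continuous fun y => a y • H y v := fun v hv =>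
    ha.smul (h.continuousOn.comp_continuous (continuous_id.prodMk continuous_const)
      fun y => ⟨mem_univ _, hv⟩)
  refine hasFDerivAt_integral_of_dominated_of_fderiv_le (s := Metric.closedBall v₀ (r / 2))
    (F' := fun v y => a y • _root_.fderiv ℝ (H y) v) (bound := fun _ => C)
    (Metric.closedBall_mem_nhds _ (half_pos hr)) ?_ (integrable_of_continuous μ (hslice v₀ hv₀)) ?_ ?_
    (integrable_const C) ?_
  · filter_upwards [hU.mem_nhds hv₀] with v hv
    exact (integrable_of_continuous μ (hslice v hv)).aestronglyMeasurable
  · exact (integrable_of_continuous μ (hD.comp_continuous (continuous_id.prodMk continuous_const)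
      fun y => ⟨mem_univ _, hv₀⟩)).aestronglyMeasurable
  · exact Eventually.of_forall fun y v hv => hC (y, v) ⟨mem_univ _, hv⟩
  · exact Eventually.of_forall fun y v hv =>
      ((h.differentiableAt hU y (hcl hv)).hasFDerivAt.const_smul (a y))

/-- Directional derivatives of a jointly smooth family are jointly smooth, hence the induction on
`n` runs over all families at once. -/
lemma JointlySmooth.contDiffOn_integral {U : Set V} (hU : IsOpen U) [CompleteSpace W]
    [IsManifold 𝓘(ℝ, V) ∞ G] {a : G → ℝ} (ha : Continuous a) (n : ℕ) :
    ∀ {H : G → V → W}, JointlySmooth U H → ContDiffOn ℝ n (fun v => ∫ y, a y • H y v ∂μ) U := by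
  induction n with
  | zero =>
    intro H h
    rw [Nat.cast_zero, contDiffOn_zero]
    exact fun v hv => (h.hasFDerivAt_integral μ hU ha hv).continuousAt.continuousWithinAt
  | succ n ih =>
    intro H h
    rw [Nat.cast_add, Nat.cast_one, contDiffOn_succ_iff_fderiv_apply hU.uniqueDiffOn]
    refine ⟨fun v hv =>
      (h.hasFDerivAt_integral μ hU ha hv).differentiableAt.differentiableWithinAt, by simp,
      fun e => (ih (h.fderiv_apply hU e)).congr fun v hv => ?_⟩
    rw [fderivWithin_of_isOpen hU hv, (h.hasFDerivAt_integral μ hU ha hv).fderiv,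
      ContinuousLinearMap.integral_apply]
    · rfl
    · refine integrable_of_continuous μ (ha.smul ?_)
      exact (h.fderiv hU).continuousOn.comp_continuous (continuous_id.prodMk continuous_const)
        fun y => ⟨mem_univ _, hv⟩

end Calculus


/-! ### Left-invariant derivatives -/

section LeftInvariant

open Filter Topology Set

variable {V : Type*} [NormedAddCommGroup V] [NormedSpace ℝ V]
  {G : Type*} [TopologicalSpace G] [ChartedSpace V G] [Group G] [LieGroup 𝓘(ℝ, V) ∞ G]
  {W : Type*} [NormedAddCommGroup W] [NormedSpace ℝ W]

variable (V) in
/-- The chart domain at the identity, as a subset of `V`. -/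
def chartDomain (G : Type*) [TopologicalSpace G] [ChartedSpace V G] [Group G] : Set V :=
  (chartAt V (1 : G)).target

variable (V) in
/-- The inverse of the chart at the identity. -/
def invChart (G : Type*) [TopologicalSpace G] [ChartedSpace V G] [Group G] (v : V) : G :=
  (chartAt V (1 : G)).symm v

variable (V) in
/-- The coordinates of the identity in the chart at the identity. -/
def chartOrigin (G : Type*) [TopologicalSpace G] [ChartedSpace V G] [Group G] : V :=
  chartAt V (1 : G) 1

variable (V G) in
lemma isOpen_chartDomain : IsOpen (chartDomain V G) := (chartAt V (1 : G)).open_target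

variable (V G) in
lemma chartOrigin_mem : chartOrigin V G ∈ chartDomain V G := mem_chart_target V (1 : G)

variable (V G) in
lemma invChart_chartOrigin : invChart V G (chartOrigin V G) = 1 :=
  (chartAt V (1 : G)).left_inv (mem_chart_source V (1 : G))

variable (V G) in
lemma contMDiffOn_invChart : ContMDiffOn 𝓘(ℝ, V) 𝓘(ℝ, V) ∞ (invChart V G) (chartDomain V G) :=
  contMDiffOn_chart_symm

/-- Through `f (x * invChart v)` the left-invariant derivatives at every `x` become partial
derivatives in `v` at one fixed point, so a single chart serves the whole group. -/
lemma jointlySmooth_translate {f : G → W} (hf : ContMDiff 𝓘(ℝ, V) 𝓘(ℝ, W) ∞ f) :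
    JointlySmooth (chartDomain V G) fun x v => f (x * invChart V G v) := by
  have h : ContMDiffOn (𝓘(ℝ, V).prod 𝓘(ℝ, V)) 𝓘(ℝ, V) ∞
      (fun p : G × V => invChart V G p.2) (univ ×ˢ chartDomain V G) :=
    (contMDiffOn_invChart V G).comp contMDiffOn_snd fun p hp => hp.2
  exact hf.comp_contMDiffOn (contMDiffOn_fst.mul h)

lemma mfderiv_one_eq_fderiv {f : G → W} (hf : MDifferentiableAt 𝓘(ℝ, V) 𝓘(ℝ, W) f 1) :
    (mfderiv 𝓘(ℝ, V) 𝓘(ℝ, W) f 1 : V →L[ℝ] W) =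
      fderiv ℝ (fun v => f (invChart V G v)) (chartOrigin V G) := by
  have h : (mfderiv 𝓘(ℝ, V) 𝓘(ℝ, W) f 1 : V →L[ℝ] W) =
      fderivWithin ℝ (writtenInExtChartAt 𝓘(ℝ, V) 𝓘(ℝ, W) 1 f : V → W) (range 𝓘(ℝ, V))
        ((extChartAt 𝓘(ℝ, V) (1 : G)) 1) := if_pos hf
  rw [h]
  simp only [mfld_simps, fderivWithin_univ]
  rfl

/-- The left-invariant field at `x` is the image of `X` under left translation by `x`; this is the
chain rule. -/
lemma lieDeriv_eq_mfderiv_one (X : GroupLieAlgebra 𝓘(ℝ, V) G) {f : G → W} {x : G}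
    (hf : MDifferentiableAt 𝓘(ℝ, V) 𝓘(ℝ, W) f x) :
    lieDeriv X f x = (mfderiv 𝓘(ℝ, V) 𝓘(ℝ, W) (fun y => f (x * y)) 1 : V →L[ℝ] W) X := by
  have h1 : MDifferentiableAt 𝓘(ℝ, V) 𝓘(ℝ, V) (fun y : G => x * y) 1 :=
    (contMDiff_mul_left (n := ∞)).mdifferentiable (by simp) 1
  have h2 : HasMFDerivAt 𝓘(ℝ, V) 𝓘(ℝ, W) f (x * 1)
      (mfderiv 𝓘(ℝ, V) 𝓘(ℝ, W) f x : V →L[ℝ] W) := by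
    rw [mul_one]
    exact hf.hasMFDerivAt
  have h3 := HasMFDerivAt.comp (1 : G) (g := f) (f := fun y : G => x * y) h2 h1.hasMFDerivAt
  exact (congrArg (fun L : V →L[ℝ] W => L X) h3.mfderiv).symm

lemma mdifferentiableAt_translate {f : G → W} {x : G}
    (hf : MDifferentiableAt 𝓘(ℝ, V) 𝓘(ℝ, W) f x) :
    MDifferentiableAt 𝓘(ℝ, V) 𝓘(ℝ, W) (fun y => f (x * y)) 1 := by
  have h1 : MDifferentiableAt 𝓘(ℝ, V) 𝓘(ℝ, V) (fun y : G => x * y) 1 :=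
    (contMDiff_mul_left (n := ∞)).mdifferentiable (by simp) 1
  have h2 : MDifferentiableAt 𝓘(ℝ, V) 𝓘(ℝ, W) f (x * 1) := by rwa [mul_one]
  exact MDifferentiableAt.comp (g := f) (f := fun y : G => x * y) (1 : G) h2 h1

/-- The derivative along a left-invariant vector field in the chart at the identity. -/
lemma lieDeriv_eq_fderiv (X : GroupLieAlgebra 𝓘(ℝ, V) G) {f : G → W} {x : G}
    (hf : MDifferentiableAt 𝓘(ℝ, V) 𝓘(ℝ, W) f x) :
    lieDeriv X f x = fderiv ℝ (fun v => f (x * invChart V G v)) (chartOrigin V G) X := by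
  rw [lieDeriv_eq_mfderiv_one X hf, mfderiv_one_eq_fderiv (mdifferentiableAt_translate hf)]
  rfl

section Smooth

variable {f : G → W} (hf : ContMDiff 𝓘(ℝ, V) 𝓘(ℝ, W) ∞ f)
include hf

lemma mdifferentiableAt_of_smooth (x : G) : MDifferentiableAt 𝓘(ℝ, V) 𝓘(ℝ, W) f x :=
  hf.mdifferentiable (by simp) x

lemma lieDeriv_eq (X : GroupLieAlgebra 𝓘(ℝ, V) G) (x : G) :
    lieDeriv X f x = fderiv ℝ (fun v => f (x * invChart V G v)) (chartOrigin V G) X :=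
  lieDeriv_eq_fderiv X (mdifferentiableAt_of_smooth hf x)

lemma differentiableAt_translate (x : G) :
    DifferentiableAt ℝ (fun v => f (x * invChart V G v)) (chartOrigin V G) :=
  (jointlySmooth_translate hf).differentiableAt (isOpen_chartDomain V G) x (chartOrigin_mem V G)

lemma contMDiff_lieDeriv (X : GroupLieAlgebra 𝓘(ℝ, V) G) :
    ContMDiff 𝓘(ℝ, V) 𝓘(ℝ, W) ∞ (lieDeriv X f) := by
  have h : lieDeriv X f = fun x =>
      fderiv ℝ (fun v => f (x * invChart V G v)) (chartOrigin V G) X :=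
    funext fun x => lieDeriv_eq hf X x
  have h1 := (jointlySmooth_translate hf).fderiv_apply (isOpen_chartDomain V G) X
  rw [h, ← contMDiffOn_univ]
  exact ContMDiffOn.comp (g := Function.uncurry fun x v =>
      fderiv ℝ (fun v => f (x * invChart V G v)) v X) (f := fun x : G => (x, chartOrigin V G)) h1
    (contMDiffOn_id.prodMk contMDiffOn_const) fun x _ => ⟨mem_univ _, chartOrigin_mem V G⟩

lemma contMDiff_lieDerivs (l : List (GroupLieAlgebra 𝓘(ℝ, V) G)) :
    ContMDiff 𝓘(ℝ, V) 𝓘(ℝ, W) ∞ (lieDerivs l f) := by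
  induction l with
  | nil => exact hf
  | cons X l ih => exact contMDiff_lieDeriv ih X

lemma lieDeriv_add_left (X Y : GroupLieAlgebra 𝓘(ℝ, V) G) (x : G) :
    lieDeriv (X + Y) f x = lieDeriv X f x + lieDeriv Y f x := by
  simp only [lieDeriv_eq hf]
  exact map_add _ _ _

lemma lieDeriv_clm {W' : Type*} [NormedAddCommGroup W'] [NormedSpace ℝ W'] (L : W →L[ℝ] W')
    (X : GroupLieAlgebra 𝓘(ℝ, V) G) :
    lieDeriv X (fun x => L (f x)) = fun x => L (lieDeriv X f x) := by
  have h : ContMDiff 𝓘(ℝ, V) 𝓘(ℝ, W') ∞ (fun x => L (f x)) := L.contMDiff.comp hf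
  funext x
  rw [lieDeriv_eq h, lieDeriv_eq hf]
  have := (L.hasFDerivAt.comp _ (differentiableAt_translate hf x).hasFDerivAt).fderiv
  exact congrArg (fun T : V →L[ℝ] W' => T X) this

lemma lieDerivs_clm {W' : Type*} [NormedAddCommGroup W'] [NormedSpace ℝ W'] (L : W →L[ℝ] W')
    (l : List (GroupLieAlgebra 𝓘(ℝ, V) G)) :
    lieDerivs l (fun x => L (f x)) = fun x => L (lieDerivs l f x) := by
  induction l with
  | nil => rfl
  | cons X l ih =>
    rw [lieDerivs, ih, lieDeriv_clm (contMDiff_lieDerivs hf l) L X]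
    rfl

end Smooth

lemma lieDeriv_sum {ι : Type*} (s : Finset ι) {f : ι → G → W}
    (hf : ∀ i, ContMDiff 𝓘(ℝ, V) 𝓘(ℝ, W) ∞ (f i)) (X : GroupLieAlgebra 𝓘(ℝ, V) G) :
    lieDeriv X (fun x => ∑ i ∈ s, f i x) = fun x => ∑ i ∈ s, lieDeriv X (f i) x := by
  have h : ContMDiff 𝓘(ℝ, V) 𝓘(ℝ, W) ∞ (fun x => ∑ i ∈ s, f i x) :=
    contMDiff_finsetSum fun i _ => hf i
  funext x
  rw [lieDeriv_eq h]
  simp only [lieDeriv_eq (hf _)]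
  rw [fderiv_fun_sum fun i _ => differentiableAt_translate (hf i) x]
  exact sum_apply _ _ _

lemma contMDiff_smul_complex {W : Type*} [NormedAddCommGroup W] [NormedSpace ℂ W] {a : G → ℂ}
    {f : G → W} (ha : ContMDiff 𝓘(ℝ, V) 𝓘(ℝ, ℂ) ∞ a) (hf : ContMDiff 𝓘(ℝ, V) 𝓘(ℝ, W) ∞ f) :
    ContMDiff 𝓘(ℝ, V) 𝓘(ℝ, W) ∞ (fun x => a x • f x) :=
  ((ContinuousLinearMap.lsmul ℝ ℂ : ℂ →L[ℝ] W →L[ℝ] W).contMDiff.comp ha).clm_apply hf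

/-- The product rule. -/
lemma lieDeriv_smul {W : Type*} [NormedAddCommGroup W] [NormedSpace ℂ W] {a : G → ℂ}
    {f : G → W} (ha : ContMDiff 𝓘(ℝ, V) 𝓘(ℝ, ℂ) ∞ a) (hf : ContMDiff 𝓘(ℝ, V) 𝓘(ℝ, W) ∞ f)
    (X : GroupLieAlgebra 𝓘(ℝ, V) G) (x : G) :
    lieDeriv X (fun x => a x • f x) x = lieDeriv X a x • f x + a x • lieDeriv X f x := by
  rw [lieDeriv_eq (contMDiff_smul_complex ha hf), lieDeriv_eq ha, lieDeriv_eq hf,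
    fderiv_fun_smul (differentiableAt_translate ha x) (differentiableAt_translate hf x)]
  rw [invChart_chartOrigin, mul_one, add_comm]
  rfl

variable [CompactSpace G] [MeasurableSpace G] [BorelSpace G] [FiniteDimensional ℝ V]
  [SecondCountableTopology G] [IsTopologicalGroup G]
  (μ : Measure G) [μ.IsHaarMeasure] [IsProbabilityMeasure μ]

/-- The integral of a derivative along a left-invariant vector field vanishes. -/
theorem integral_lieDeriv [CompleteSpace W] {f : G → W} (hf : ContMDiff 𝓘(ℝ, V) 𝓘(ℝ, W) ∞ f)
    (X : GroupLieAlgebra 𝓘(ℝ, V) G) : ∫ x, lieDeriv X f x ∂μ = 0 := by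
  have : μ.IsMulRightInvariant := isMulRightInvariant μ
  have hj := jointlySmooth_translate hf
  have h := hj.hasFDerivAt_integral μ (isOpen_chartDomain V G) (a := fun _ => 1)
    continuous_const (chartOrigin_mem V G)
  simp only [one_smul] at h
  -- By right invariance the integral of a right translate does not depend on `v`; its derivative,
  -- which is the integral of the derivative, is zero.
  have hconst : (fun v => ∫ y, f (y * invChart V G v) ∂μ) = fun _ => ∫ y, f y ∂μ :=
    funext fun v => integral_mul_right_eq_self f _
  rw [hconst] at h
  have h0 := h.unique (hasFDerivAt_const _ _)
  simp only [lieDeriv_eq hf]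
  refine (ContinuousLinearMap.integral_apply (H := V)
    (integrable_of_continuous μ ?_) X).symm.trans ?_
  · exact (hj.fderiv (isOpen_chartDomain V G)).continuousOn.comp_continuous
      (continuous_id.prodMk continuous_const) fun y => ⟨mem_univ _, chartOrigin_mem V G⟩
  · rw [h0]
    rfl

end LeftInvariant


/-! ### Smoothness of representations -/

section SmoothRep

open Filter Topology Set

variable {V : Type*} [NormedAddCommGroup V] [NormedSpace ℝ V]
  {G : Type*} [TopologicalSpace G] [ChartedSpace V G] [Group G] [LieGroup 𝓘(ℝ, V) ∞ G]
  [CompactSpace G] [T2Space G] [MeasurableSpace G] [BorelSpace G] [FiniteDimensional ℝ V]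
  [SecondCountableTopology G] [IsTopologicalGroup G]
  (μ : Measure G) [μ.IsHaarMeasure] [IsProbabilityMeasure μ]

/-- The variable `x` enters through the smooth factor only, so the integral is smooth although `a`
is merely continuous. -/
lemma contMDiff_integral_mul_real {φ : G → ℝ} (hφ : ContMDiff 𝓘(ℝ, V) 𝓘(ℝ, ℝ) ∞ φ) {a : G → ℝ}
    (ha : Continuous a) :
    ContMDiff 𝓘(ℝ, V) 𝓘(ℝ, ℝ) ∞ (fun x => ∫ y, a y * φ (x * y) ∂μ) := by
  intro x₀
  have hH : JointlySmooth (G := G) (chartAt V x₀).target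
      fun y v => φ ((chartAt V x₀).symm v * y) := by
    have h : ContMDiffOn (𝓘(ℝ, V).prod 𝓘(ℝ, V)) 𝓘(ℝ, V) ∞
        (fun p : G × V => (chartAt V x₀).symm p.2) (univ ×ˢ (chartAt V x₀).target) :=
      (contMDiffOn_chart_symm (n := ∞)).comp contMDiffOn_snd fun p hp => hp.2
    exact hφ.comp_contMDiffOn (h.mul contMDiffOn_fst)
  have h1 : ContDiffOn ℝ ∞ (fun v => ∫ y, a y • φ ((chartAt V x₀).symm v * y) ∂μ)
      (chartAt V x₀).target :=
    contDiffOn_infty.2 fun n => hH.contDiffOn_integral μ (chartAt V x₀).open_target ha n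
  have h2 : ContMDiffOn 𝓘(ℝ, V) 𝓘(ℝ, ℝ) ∞
      (fun x => ∫ y, a y • φ ((chartAt V x₀).symm (chartAt V x₀ x) * y) ∂μ)
      (chartAt V x₀).source :=
    h1.contMDiffOn.comp (contMDiffOn_chart (n := ∞)) fun x hx => (chartAt V x₀).map_source hx
  refine ContMDiffOn.contMDiffAt (h2.congr fun x hx => ?_)
    ((chartAt V x₀).open_source.mem_nhds (mem_chart_source V x₀))
  rw [(chartAt V x₀).left_inv hx]
  rfl

lemma contMDiff_integral_mul_complex {φ : G → ℝ} (hφ : ContMDiff 𝓘(ℝ, V) 𝓘(ℝ, ℝ) ∞ φ) {a : G → ℂ}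
    (ha : Continuous a) :
    ContMDiff 𝓘(ℝ, V) 𝓘(ℝ, ℂ) ∞ (fun x => ∫ y, a y * φ (x * y) ∂μ) := by
  have h1 := contMDiff_integral_mul_real μ hφ (Complex.continuous_re.comp ha)
  have h2 := contMDiff_integral_mul_real μ hφ (Complex.continuous_im.comp ha)
  have h3 := (Complex.ofRealCLM.contMDiff (n := ∞)).comp h1
  have h4 := (Complex.ofRealCLM.smulRight Complex.I).contMDiff (n := ∞) |>.comp h2
  refine (h3.add h4).congr fun x => ?_
  have hint : Integrable (fun y => a y * φ (x * y)) μ :=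
    integrable_of_continuous μ (ha.mul (Complex.continuous_ofReal.comp
      (hφ.continuous.comp (continuous_const_mul x))))
  rw [← integral_re_add_im hint]
  simp

variable (V) in
lemma exists_bump (N : Set G) (hN : N ∈ 𝓝 (1 : G)) :
    ∃ φ : G → ℝ, ContMDiff 𝓘(ℝ, V) 𝓘(ℝ, ℝ) ∞ φ ∧ (∀ x, 0 ≤ φ x) ∧ (∀ x, x ∉ N → φ x = 0) ∧
      0 < ∫ x, φ x ∂μ := by
  have hb := (SmoothBumpFunction.nhds_basis_tsupport (I := 𝓘(ℝ, V)) (1 : G)).mem_iff.1 hN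
  obtain ⟨f, -, hf⟩ := hb
  refine ⟨f, f.contMDiff, fun x => f.nonneg, fun x hx => ?_, ?_⟩
  · by_contra h
    exact hx (hf (subset_tsupport _ h))
  · refine f.continuous.integral_pos_of_hasCompactSupport_nonneg_nonzero
      (HasCompactSupport.of_compactSpace _) (fun x => f.nonneg) (x := 1) ?_
    rw [f.eq_one]
    exact one_ne_zero

include μ in
/-- Matrix coefficients of continuous finite-dimensional representations are smooth. -/
theorem contMDiff_coeff (ξ : UnitaryIrrep G) (i j : Fin ξ.dim) :
    ContMDiff 𝓘(ℝ, V) 𝓘(ℝ, ℂ) ∞ (ξ.coeff i j) := by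
  -- The choice gives `d ε < 1`, which is what diagonal dominance of the matrix `A` requires.
  set ε : ℝ := 1 / (ξ.dim + 1) with hε
  have hε0 : 0 < ε := by positivity
  let N : Set G := {y | ∀ i j, ‖ξ.coeff i j y⁻¹ - if i = j then 1 else 0‖ < ε}
  have hN : N ∈ 𝓝 (1 : G) := by
    have : IsOpen N := by
      simp only [N, ofPred_forall]
      exact isOpen_iInter_of_finite fun i => isOpen_iInter_of_finite fun j =>
        isOpen_lt (((ξ.continuous_coeff i j).comp continuous_inv).sub continuous_const).norm
          continuous_const
    refine this.mem_nhds fun i j => ?_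
    rw [inv_one, ξ.coeff_one, sub_self, norm_zero]
    exact hε0
  obtain ⟨φ, hφ, hφ0, hφN, hφpos⟩ := exists_bump V μ N hN
  set c := ∫ x, φ x ∂μ with hc
  have hφc : Continuous φ := hφ.continuous
  have hcoeff : ∀ i j, Continuous fun y => ξ.coeff i j y⁻¹ := fun i j =>
    (ξ.continuous_coeff i j).comp continuous_inv
  -- The average of `ξ(y⁻¹)` against a bump at the identity is close to `c` times the identity
  -- matrix, hence invertible.
  let A : Matrix (Fin ξ.dim) (Fin ξ.dim) ℂ := Matrix.of fun i j => ∫ y, ξ.coeff i j y⁻¹ * φ y ∂μ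
  have hAint : ∀ i j, Integrable (fun y => ξ.coeff i j y⁻¹ * φ y) μ := fun i j =>
    integrable_of_continuous μ ((hcoeff i j).mul (Complex.continuous_ofReal.comp hφc))
  have hA : ∀ i j, ‖A i j - if i = j then (c : ℂ) else 0‖ ≤ ε * c := fun i j => by
    have h1 : (if i = j then (c : ℂ) else 0) =
        ∫ y, (if i = j then 1 else 0) * (φ y : ℂ) ∂μ := by
      rw [integral_const_mul, integral_complex_ofReal]
      split_ifs <;> simp [hc]
    have h2 : Integrable (fun y => (if i = j then 1 else 0) * (φ y : ℂ)) μ :=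
      integrable_of_continuous μ (continuous_const.mul (Complex.continuous_ofReal.comp hφc))
    change ‖(∫ y, ξ.coeff i j y⁻¹ * φ y ∂μ) - _‖ ≤ _
    rw [h1, ← integral_sub (hAint i j) h2, hc, ← integral_const_mul]
    refine norm_integral_le_of_norm_le ((integrable_of_continuous μ hφc).const_mul ε)
      (Eventually.of_forall fun y => ?_)
    rw [← sub_mul, norm_mul, Complex.norm_real, Real.norm_of_nonneg (hφ0 y)]
    by_cases hy : y ∈ N
    · exact mul_le_mul_of_nonneg_right (hy i j).le (hφ0 y)
    · simp [hφN y hy]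
  have hdet : A.det ≠ 0 := by
    refine det_ne_zero_of_sum_row_lt_diag fun k => ?_
    have h1 : ∑ j ∈ Finset.univ.erase k, ‖A k j‖ ≤ (ξ.dim - 1) * (ε * c) := by
      refine (Finset.sum_le_card_nsmul _ _ (ε * c) fun j hj => ?_).trans ?_
      · have := hA k j
        rwa [if_neg (Finset.ne_of_mem_erase hj).symm, sub_zero] at this
      · rw [Finset.card_erase_of_mem (Finset.mem_univ k), Finset.card_univ, Fintype.card_fin,
          nsmul_eq_mul, Nat.cast_sub ξ.dim_pos, Nat.cast_one]
    have h2 : c - ε * c ≤ ‖A k k‖ := by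
      have h3 := hA k k
      rw [if_pos rfl] at h3
      have h4 := norm_sub_norm_le (c : ℂ) (A k k)
      rw [norm_sub_rev, Complex.norm_real, Real.norm_of_nonneg hφpos.le] at h4
      linarith
    have h5 : ξ.dim * (ε * c) < c := by
      have : (ξ.dim : ℝ) * ε < 1 := by
        rw [hε, mul_one_div, div_lt_one (by positivity)]
        linarith
      calc ξ.dim * (ε * c) = (ξ.dim * ε) * c := by ring
        _ < 1 * c := by gcongr
        _ = c := one_mul c
    linarith
  -- The substitution `y ↦ xy` moves `x` from the representation onto the smooth bump. Multiplying
  -- by `A⁻¹` then exhibits `ξ` as smooth.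
  have hAξ : ∀ x, A * ξ.mat x = Matrix.of fun i j => ∫ y, ξ.coeff i j y⁻¹ * φ (x * y) ∂μ := by
    intro x
    ext i j
    rw [Matrix.mul_apply, Matrix.of_apply]
    have h1 : ∀ k, A i k * ξ.mat x k j = ∫ y, ξ.coeff i k y⁻¹ * φ y * ξ.coeff k j x ∂μ :=
      fun k => (integral_mul_const _ _).symm
    simp only [h1]
    rw [← integral_finsetSum _ fun k _ => (hAint i k).mul_const _,
      ← integral_mul_left_eq_self _ x]
    refine integral_congr_ae (Eventually.of_forall fun y => ?_)
    change ∑ k, ξ.coeff i k (x * y)⁻¹ * φ (x * y) * ξ.coeff k j x = ξ.coeff i j y⁻¹ * φ (x * y)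
    have h2 : y⁻¹ = (x * y)⁻¹ * x := by simp
    rw [h2, ξ.coeff_mul, Finset.sum_mul]
    exact Finset.sum_congr rfl fun k _ => by ring
  have hξ : ∀ x, ξ.coeff i j x = ∑ k, A⁻¹ i k * ∫ y, ξ.coeff k j y⁻¹ * φ (x * y) ∂μ := fun x => by
    have h1 : ξ.mat x = A⁻¹ * (A * ξ.mat x) := by
      rw [← mul_assoc, Matrix.nonsing_inv_mul _ (isUnit_iff_ne_zero.2 hdet), one_mul]
    have h2 := congrFun₂ h1 i j
    rw [hAξ, Matrix.mul_apply] at h2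
    exact h2
  rw [funext hξ]
  exact contMDiff_finsetSum fun k _ =>
    contMDiff_smul_complex contMDiff_const (contMDiff_integral_mul_complex μ hφ (hcoeff k j))

end SmoothRep


/-! ### The derived representation and the Laplacian -/

section Weight

variable {V : Type*} [NormedAddCommGroup V] [NormedSpace ℝ V]
  {G : Type*} [TopologicalSpace G] [ChartedSpace V G] [Group G]

/-- The derived representation `dξ(X)`, as a matrix. -/
def UnitaryIrrep.derived (ξ : UnitaryIrrep G) (X : GroupLieAlgebra 𝓘(ℝ, V) G) :
    Matrix (Fin ξ.dim) (Fin ξ.dim) ℂ :=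
  Matrix.of fun i j => lieDeriv X (ξ.coeff i j) 1

/-- The Casimir number of `ξ`, the absolute value of the eigenvalue of the Laplacian on the matrix
coefficients. -/
def UnitaryIrrep.casimir {n : ℕ} (Y : Fin n → GroupLieAlgebra 𝓘(ℝ, V) G) (ξ : UnitaryIrrep G) :
    ℝ := ‖ξ.eigenvalue Y‖

lemma UnitaryIrrep.casimir_nonneg {n : ℕ} (Y : Fin n → GroupLieAlgebra 𝓘(ℝ, V) G)
    (ξ : UnitaryIrrep G) : 0 ≤ ξ.casimir Y := norm_nonneg _

lemma UnitaryIrrep.weight_sq {n : ℕ} (Y : Fin n → GroupLieAlgebra 𝓘(ℝ, V) G)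
    (ξ : UnitaryIrrep G) : ξ.weight Y ^ 2 = 1 + ξ.casimir Y :=
  Real.sq_sqrt (by positivity)

lemma UnitaryIrrep.one_le_weight {n : ℕ} (Y : Fin n → GroupLieAlgebra 𝓘(ℝ, V) G)
    (ξ : UnitaryIrrep G) : 1 ≤ ξ.weight Y :=
  Real.one_le_sqrt.2 (le_add_of_nonneg_right (norm_nonneg _))

lemma UnitaryIrrep.weight_pos {n : ℕ} (Y : Fin n → GroupLieAlgebra 𝓘(ℝ, V) G)
    (ξ : UnitaryIrrep G) : 0 < ξ.weight Y := zero_lt_one.trans_le (ξ.one_le_weight Y)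

end Weight

section Derived

open Filter Topology Set

variable {V : Type*} [NormedAddCommGroup V] [NormedSpace ℝ V]
  {G : Type*} [TopologicalSpace G] [ChartedSpace V G] [Group G] [LieGroup 𝓘(ℝ, V) ∞ G]

section Translate

variable {W : Type*} [NormedAddCommGroup W] [NormedSpace ℝ W]
  {f : G → W} (hf : ContMDiff 𝓘(ℝ, V) 𝓘(ℝ, W) ∞ f)
include hf

lemma lieDeriv_translate (X : GroupLieAlgebra 𝓘(ℝ, V) G) (x : G) :
    lieDeriv X f x = lieDeriv X (fun y => f (x * y)) 1 := by
  have h : ContMDiff 𝓘(ℝ, V) 𝓘(ℝ, W) ∞ (fun y => f (x * y)) := hf.comp contMDiff_mul_left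
  rw [lieDeriv_eq hf, lieDeriv_eq h]
  simp only [one_mul]

lemma lieDeriv_one (X : GroupLieAlgebra 𝓘(ℝ, V) G) :
    lieDeriv X f 1 = (mfderiv 𝓘(ℝ, V) 𝓘(ℝ, W) f 1 : V →L[ℝ] W) X := by
  rw [lieDeriv_eq hf, mfderiv_one_eq_fderiv (mdifferentiableAt_of_smooth hf 1)]
  simp only [one_mul]
  rfl

lemma lieDeriv_Ad (g : G) (X : GroupLieAlgebra 𝓘(ℝ, V) G) :
    lieDeriv (Ad g X) f 1 = lieDeriv X (fun x => f (g * x * g⁻¹)) 1 := by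
  have h1 : ContMDiff 𝓘(ℝ, V) 𝓘(ℝ, V) ∞ (fun x : G => g * x * g⁻¹) :=
    (contMDiff_mul_right (a := g⁻¹)).comp (contMDiff_mul_left (a := g))
  rw [lieDeriv_one hf, lieDeriv_one (f := fun x => f (g * x * g⁻¹)) (hf.comp h1)]
  have h2 : HasMFDerivAt 𝓘(ℝ, V) 𝓘(ℝ, W) f (g * 1 * g⁻¹)
      (mfderiv 𝓘(ℝ, V) 𝓘(ℝ, W) f 1 : V →L[ℝ] W) := by
    rw [mul_one, mul_inv_cancel]
    exact (mdifferentiableAt_of_smooth hf 1).hasMFDerivAt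
  have h3 := HasMFDerivAt.comp (1 : G) (g := f) (f := fun x : G => g * x * g⁻¹) h2
    (h1.mdifferentiable (by simp) 1).hasMFDerivAt
  exact (congrArg (fun L : V →L[ℝ] W => L X) h3.mfderiv).symm

end Translate

variable [CompactSpace G] [T2Space G] [MeasurableSpace G] [BorelSpace G] [FiniteDimensional ℝ V]
  [SecondCountableTopology G] [IsTopologicalGroup G]
  (μ : Measure G) [μ.IsHaarMeasure] [IsProbabilityMeasure μ] (ξ : UnitaryIrrep G)

open UnitaryIrrep

include μ

lemma derived_add (X Y : GroupLieAlgebra 𝓘(ℝ, V) G) :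
    ξ.derived (X + Y) = ξ.derived X + ξ.derived Y := by
  ext i j
  exact lieDeriv_add_left (contMDiff_coeff μ ξ i j) X Y 1

lemma derived_smul (c : ℝ) (X : GroupLieAlgebra 𝓘(ℝ, V) G) :
    ξ.derived (c • X) = (c : ℂ) • ξ.derived X := by
  ext i j
  change lieDeriv (c • X) (ξ.coeff i j) 1 = (c : ℂ) * lieDeriv X (ξ.coeff i j) 1
  rw [lieDeriv_one (contMDiff_coeff μ ξ i j), lieDeriv_one (contMDiff_coeff μ ξ i j)]
  refine (ContinuousLinearMap.map_smul (M₁ := V) (M₂ := ℂ) _ c X).trans ?_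
  exact Complex.real_smul

lemma derived_sum {ι : Type*} (s : Finset ι) (a : ι → ℝ) (X : ι → GroupLieAlgebra 𝓘(ℝ, V) G) :
    ξ.derived (∑ i ∈ s, a i • X i) = ∑ i ∈ s, (a i : ℂ) • ξ.derived (X i) := by
  classical
  induction s using Finset.induction_on with
  | empty =>
    have := derived_smul μ ξ 0 (0 : GroupLieAlgebra 𝓘(ℝ, V) G)
    simpa using this
  | insert i s hi ih => rw [Finset.sum_insert hi, Finset.sum_insert hi, derived_add μ, ih,
      derived_smul μ]

/-- Differentiate `ξ(xy) = ξ(x) ξ(y)` in `y` at the identity. -/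
lemma lieDeriv_coeff (X : GroupLieAlgebra 𝓘(ℝ, V) G) (i j : Fin ξ.dim) (x : G) :
    lieDeriv X (ξ.coeff i j) x = ∑ k, ξ.coeff i k x * ξ.derived X k j := by
  have h : ∀ i j, ContMDiff 𝓘(ℝ, V) 𝓘(ℝ, ℂ) ∞ (ξ.coeff i j) := contMDiff_coeff μ ξ
  rw [lieDeriv_translate (h i j)]
  simp only [ξ.coeff_mul]
  refine (congrFun (lieDeriv_sum Finset.univ (f := fun k y => ξ.coeff i k x • ξ.coeff k j y)
    (fun k => contMDiff_smul_complex contMDiff_const (h k j)) X) 1).trans ?_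
  refine Finset.sum_congr rfl fun k _ => ?_
  exact congrFun (lieDeriv_clm (h k j)
    ((ξ.coeff i k x • ContinuousLinearMap.id ℂ ℂ).restrictScalars ℝ) X) 1

lemma lieDeriv_star_coeff (X : GroupLieAlgebra 𝓘(ℝ, V) G) (i j : Fin ξ.dim) (x : G) :
    lieDeriv X (fun x => star (ξ.coeff i j x)) x = star (lieDeriv X (ξ.coeff i j) x) :=
  congrFun (lieDeriv_clm (contMDiff_coeff μ ξ i j) (Complex.conjCLE : ℂ →L[ℝ] ℂ) X) x

lemma contMDiff_star_coeff (i j : Fin ξ.dim) :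
    ContMDiff 𝓘(ℝ, V) 𝓘(ℝ, ℂ) ∞ (fun x => star (ξ.coeff i j x)) :=
  (Complex.conjCLE : ℂ →L[ℝ] ℂ).contMDiff.comp (contMDiff_coeff μ ξ i j)

/-- Differentiate `ξ(x)* ξ(x) = 1` at the identity: the derived matrices are skew-Hermitian. -/
lemma star_derived (X : GroupLieAlgebra 𝓘(ℝ, V) G) (i j : Fin ξ.dim) :
    star (ξ.derived X j i) = -ξ.derived X i j := by
  have h := contMDiff_coeff (V := V) μ ξ
  have h' := contMDiff_star_coeff (V := V) μ ξ
  have h1 : (fun x => ∑ k, star (ξ.coeff k i x) • ξ.coeff k j x) =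
      fun _ => if i = j then 1 else 0 := funext fun x => ξ.sum_star_coeff_mul_coeff i j x
  have h2 := congrFun (lieDeriv_sum (V := V) Finset.univ
    (fun k => contMDiff_smul_complex (h' k i) (h k j)) X) 1
  rw [h1, lieDeriv_eq contMDiff_const] at h2
  simp only [lieDeriv_smul (h' _ _) (h _ _), lieDeriv_star_coeff μ, coeff_one] at h2
  simp only [fderiv_fun_const, smul_eq_mul, Finset.sum_add_distrib] at h2
  simp only [mul_ite, mul_one, mul_zero, Finset.sum_ite_eq', Finset.mem_univ, if_true, apply_ite star,
    star_one, star_zero, ite_mul, one_mul, zero_mul] at h2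
  exact eq_neg_of_add_eq_zero_left h2.symm

/-- Differentiate `ξ(g x g⁻¹) = ξ(g) ξ(x) ξ(g⁻¹)` in `x` at the identity. -/
lemma mat_mul_derived_mul_mat_inv (g : G) (X : GroupLieAlgebra 𝓘(ℝ, V) G) :
    ξ.mat g * ξ.derived X * ξ.mat g⁻¹ = ξ.derived (Ad g X) := by
  have h : ∀ i j, ContMDiff 𝓘(ℝ, V) 𝓘(ℝ, ℂ) ∞ (ξ.coeff i j) := contMDiff_coeff μ ξ
  ext i j
  change _ = lieDeriv (Ad g X) (ξ.coeff i j) 1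
  rw [lieDeriv_Ad (h i j)]
  have h1 : (fun x => ξ.coeff i j (g * x * g⁻¹)) =
      fun x => ∑ l, ∑ k, (ξ.coeff i k g * ξ.coeff l j g⁻¹) • ξ.coeff k l x := funext fun x => by
    rw [ξ.coeff_mul]
    refine Finset.sum_congr rfl fun l _ => ?_
    rw [ξ.coeff_mul, Finset.sum_mul]
    refine Finset.sum_congr rfl fun k _ => ?_
    rw [smul_eq_mul]
    ring
  have h2 : ∀ k l, ContMDiff 𝓘(ℝ, V) 𝓘(ℝ, ℂ) ∞
      (fun x => (ξ.coeff i k g * ξ.coeff l j g⁻¹) • ξ.coeff k l x) := fun k l =>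
    contMDiff_smul_complex contMDiff_const (h k l)
  rw [h1, lieDeriv_sum _ fun l => contMDiff_finsetSum fun k _ => h2 k l, Matrix.mul_apply]
  refine Finset.sum_congr rfl fun l _ => ?_
  rw [lieDeriv_sum _ fun k => h2 k l, Matrix.mul_apply, Finset.sum_mul]
  refine Finset.sum_congr rfl fun k _ => ?_
  refine Eq.trans ?_ (congrFun (lieDeriv_clm (h k l)
    (((ξ.coeff i k g * ξ.coeff l j g⁻¹) • ContinuousLinearMap.id ℂ ℂ).restrictScalars ℝ) X) 1).symm
  change ξ.coeff i k g * lieDeriv X (ξ.coeff k l) 1 * ξ.coeff l j g⁻¹ =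
    ξ.coeff i k g * ξ.coeff l j g⁻¹ * lieDeriv X (ξ.coeff k l) 1
  ring

/-- Fourier coefficients of a derivative. -/
theorem fourierCoeff_lieDeriv {W : Type*} [NormedAddCommGroup W] [InnerProductSpace ℂ W]
    [CompleteSpace W] {u : G → W} (hu : ContMDiff 𝓘(ℝ, V) 𝓘(ℝ, W) ∞ u)
    (X : GroupLieAlgebra 𝓘(ℝ, V) G) (i j : Fin ξ.dim) :
    fourierCoeff μ ξ (lieDeriv X u) i j = ∑ l, ξ.derived X i l • fourierCoeff μ ξ u l j := by
  have h' := contMDiff_star_coeff (V := V) μ ξ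
  -- Integration by parts; the minus sign cancels against the one from `star_derived`.
  have h1 := integral_lieDeriv μ (contMDiff_smul_complex (h' j i) hu) X
  simp only [lieDeriv_smul (h' _ _) hu] at h1
  have h2 : ∀ x, lieDeriv X (fun x => star (ξ.coeff j i x)) x • u x =
      -∑ l, ξ.derived X i l • (star (ξ.coeff j l x) • u x) := fun x => by
    rw [lieDeriv_star_coeff μ, lieDeriv_coeff μ, star_sum, ← Finset.sum_neg_distrib,
      Finset.sum_smul]
    refine Finset.sum_congr rfl fun l _ => ?_
    rw [star_mul, star_derived μ, smul_smul, neg_mul, neg_smul]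
  have hint : ∀ l, Integrable (fun x => ξ.derived X i l • (star (ξ.coeff j l x) • u x)) μ :=
    fun l => (integrable_coeff_smul μ ξ j l hu.continuous).smul _
  have hneg : Integrable
      (fun x => -∑ l, ξ.derived X i l • (star (ξ.coeff j l x) • u x)) μ :=
    (integrable_finsetSum _ fun l _ => hint l).neg
  simp only [h2] at h1
  rw [integral_add hneg
    (integrable_coeff_smul μ ξ j i (contMDiff_lieDeriv hu X).continuous), integral_neg,
    integral_finsetSum _ fun l _ => hint l] at h1
  simp only [integral_smul] at h1
  rw [fourierCoeff]
  exact (neg_add_eq_zero.1 h1).symm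

end Derived


/-! ### Matrices acting on vectors with entries in a Hilbert space -/

section MatrixAction

variable {W : Type*} [NormedAddCommGroup W] [InnerProductSpace ℂ W]

/-- The action of a scalar matrix on a column vector with entries in `W`. -/
def matAct {m n : ℕ} (D : Matrix (Fin m) (Fin n) ℂ) (w : Fin n → W) : Fin m → W :=
  fun p => ∑ q, D p q • w q

/-- The square of the `ℓ²` norm of a vector with entries in `W`. -/
def vecSq {n : ℕ} (w : Fin n → W) : ℝ := ∑ p, ‖w p‖ ^ 2

lemma vecSq_nonneg {n : ℕ} (w : Fin n → W) : 0 ≤ vecSq w :=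
  Finset.sum_nonneg fun _ _ => sq_nonneg _

lemma hsSq_eq_sum_vecSq {d : ℕ} (c : Fin d → Fin d → W) :
    hsSq c = ∑ j, vecSq fun i => c i j := by
  rw [hsSq, Finset.sum_comm]
  rfl

lemma matAct_mul {m n l : ℕ} (A : Matrix (Fin m) (Fin n) ℂ) (B : Matrix (Fin n) (Fin l) ℂ)
    (w : Fin l → W) : matAct (A * B) w = matAct A (matAct B w) := by
  funext p
  simp only [matAct, Matrix.mul_apply, Finset.sum_smul, Finset.smul_sum, smul_smul]
  exact Finset.sum_comm

lemma matAct_one {n : ℕ} (w : Fin n → W) : matAct 1 w = w := by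
  funext p
  simp [matAct, Matrix.one_apply]

lemma matAct_sum {m n : ℕ} {ι : Type*} (s : Finset ι) (A : ι → Matrix (Fin m) (Fin n) ℂ)
    (w : Fin n → W) (p : Fin m) : matAct (∑ i ∈ s, A i) w p = ∑ i ∈ s, matAct (A i) w p := by
  simp only [matAct, Matrix.sum_apply, Finset.sum_smul]
  exact Finset.sum_comm

lemma matAct_smul {m n : ℕ} (a : ℂ) (A : Matrix (Fin m) (Fin n) ℂ) (w : Fin n → W) (p : Fin m) :
    matAct (a • A) w p = a • matAct A w p := by
  simp only [matAct, Matrix.smul_apply, Finset.smul_sum, smul_assoc]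

lemma sum_inner_matAct_left {n : ℕ} {D : Matrix (Fin n) (Fin n) ℂ}
    (hD : ∀ i j, star (D j i) = -D i j) (v w : Fin n → W) :
    ∑ p, inner ℂ (matAct D v p) (w p) = -∑ p, inner ℂ (v p) (matAct D w p) := by
  simp only [matAct, sum_inner, inner_sum, inner_smul_left, inner_smul_right]
  rw [Finset.sum_comm, ← Finset.sum_neg_distrib]
  refine Finset.sum_congr rfl fun p _ => ?_
  rw [← Finset.sum_neg_distrib]
  refine Finset.sum_congr rfl fun q _ => ?_
  rw [← neg_mul]
  congr 1
  exact hD p q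

lemma sum_inner_self_eq_vecSq {n : ℕ} (w : Fin n → W) :
    ∑ p, inner ℂ (w p) (w p) = (vecSq w : ℂ) := by
  simp only [vecSq, inner_self_eq_norm_sq_to_K, Complex.ofReal_sum, Complex.ofReal_pow]
  rfl

lemma norm_sum_inner_sq_le {n : ℕ} (v w : Fin n → W) :
    ‖∑ p, inner ℂ (v p) (w p)‖ ^ 2 ≤ vecSq v * vecSq w := by
  have h : ‖∑ p, inner ℂ (v p) (w p)‖ ≤ ∑ p, ‖v p‖ * ‖w p‖ :=
    (norm_sum_le _ _).trans (Finset.sum_le_sum fun p _ => norm_inner_le_norm _ _)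
  exact (pow_le_pow_left₀ (norm_nonneg _) h 2).trans (Finset.sum_mul_sq_le_sq_mul_sq _ _ _)

/-- For skew-Hermitian `D`, `‖Dw‖² = -⟪w, D²w⟫`, and Cauchy-Schwarz applies. Thus the numbers `‖D^j
w‖²` are log-convex in `j`. -/
lemma vecSq_matAct_sq_le {n : ℕ} {D : Matrix (Fin n) (Fin n) ℂ}
    (hD : ∀ i j, star (D j i) = -D i j) (w : Fin n → W) :
    vecSq (matAct D w) ^ 2 ≤ vecSq w * vecSq (matAct D (matAct D w)) := by
  have h : (vecSq (matAct D w) : ℂ) = -∑ p, inner ℂ (w p) (matAct D (matAct D w) p) := by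
    rw [← sum_inner_self_eq_vecSq, sum_inner_matAct_left hD]
  have h2 : vecSq (matAct D w) = ‖∑ p, inner ℂ (w p) (matAct D (matAct D w) p)‖ := by
    rw [← norm_neg, ← h, Complex.norm_real, Real.norm_of_nonneg (vecSq_nonneg _)]
  rw [h2]
  exact norm_sum_inner_sq_le _ _

/-- The ratios `a (j+1) / a j` do not decrease, so the `(k+1)`-th power of the first is at most
their product up to `j = k`. If `a 1` is positive, all later terms are, which permits the
cancellations. -/
lemma pow_succ_le_of_logConvex {a : ℕ → ℝ} (ha : ∀ j, 0 ≤ a j)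
    (h : ∀ j, a (j + 1) ^ 2 ≤ a j * a (j + 2)) (k : ℕ) : a 1 ^ (k + 1) ≤ a 0 ^ k * a (k + 1) := by
  rcases (ha 1).eq_or_lt with h1 | h1
  · rw [← h1, zero_pow k.succ_ne_zero]
    exact mul_nonneg (pow_nonneg (ha 0) k) (ha _)
  have hpos : ∀ j, 0 < a (j + 1) := fun j => by
    induction j with
    | zero => exact h1
    | succ j ih =>
      refine (ha _).lt_of_ne fun h0 => ?_
      have h2 := h j
      rw [← h0, mul_zero] at h2
      exact absurd h2 (not_le.2 (pow_pos ih 2))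
  have hratio : ∀ j, a 1 * a j ≤ a 0 * a (j + 1) := fun j => by
    induction j with
    | zero => rw [mul_comm]
    | succ j ih =>
      refine le_of_mul_le_mul_right ?_ (hpos j)
      calc a 1 * a (j + 1) * a (j + 1) = a 1 * a (j + 1) ^ 2 := by ring
        _ ≤ a 1 * (a j * a (j + 2)) := mul_le_mul_of_nonneg_left (h j) h1.le
        _ = a 1 * a j * a (j + 2) := by ring
        _ ≤ a 0 * a (j + 1) * a (j + 2) := mul_le_mul_of_nonneg_right ih (ha _)
        _ = _ := by ring
  induction k with
  | zero => simp
  | succ k ih =>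
    calc a 1 ^ (k + 1 + 1) = a 1 * a 1 ^ (k + 1) := by ring
      _ ≤ a 1 * (a 0 ^ k * a (k + 1)) := mul_le_mul_of_nonneg_left ih h1.le
      _ = a 0 ^ k * (a 1 * a (k + 1)) := by ring
      _ ≤ a 0 ^ k * (a 0 * a (k + 1 + 1)) :=
        mul_le_mul_of_nonneg_left (hratio _) (pow_nonneg (ha 0) k)
      _ = _ := by ring

/-- Lets pure powers of single basis vectors control powers of the Casimir number, so that no mixed
derivatives are needed. -/
lemma vecSq_matAct_pow_le {n : ℕ} {D : Matrix (Fin n) (Fin n) ℂ}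
    (hD : ∀ i j, star (D j i) = -D i j) (w : Fin n → W) (k : ℕ) :
    vecSq (matAct D w) ^ (k + 1) ≤ vecSq w ^ k * vecSq (matAct (D ^ (k + 1)) w) := by
  have h := pow_succ_le_of_logConvex (a := fun j => vecSq (matAct (D ^ j) w))
    (fun j => vecSq_nonneg _) (fun j => by
      have := vecSq_matAct_sq_le hD (matAct (D ^ j) w)
      rw [← matAct_mul, ← pow_succ', ← matAct_mul, ← pow_succ'] at this
      exact this) k
  simpa [matAct_one] using h

end MatrixAction

/-! ### The Casimir operator and the decay of Fourier coefficients -/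

section Casimir

variable {V : Type*} [NormedAddCommGroup V] [NormedSpace ℝ V]
  {G : Type*} [TopologicalSpace G] [ChartedSpace V G] [Group G] [LieGroup 𝓘(ℝ, V) ∞ G]
  {n : ℕ}

/-- Bi-invariance yields `OᵀO = 1` for the matrix of `Ad g`; the relation wanted for the Casimir sum
is `OOᵀ = 1`, equivalent for square matrices. -/
lemma exists_orthogonal_Ad {B : LinearMap.BilinForm ℝ (GroupLieAlgebra 𝓘(ℝ, V) G)}
    (hB : IsBiInvariant B) {Y : Module.Basis (Fin n) ℝ (GroupLieAlgebra 𝓘(ℝ, V) G)}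
    (hY : ∀ i j, B (Y i) (Y j) = if i = j then 1 else 0) (g : G) :
    ∃ O : Matrix (Fin n) (Fin n) ℝ, (∀ i, Ad g (Y i) = ∑ j, O j i • Y j) ∧
      ∀ j k, ∑ i, O j i * O k i = if j = k then 1 else 0 := by
  let O : Matrix (Fin n) (Fin n) ℝ := Matrix.of fun j i => Y.repr (Ad g (Y i)) j
  have h1 : ∀ i, Ad g (Y i) = ∑ j, O j i • Y j := fun i => (Y.sum_repr (Ad g (Y i))).symm
  have h2 : O.transpose * O = 1 := by
    ext i l
    have h3 := hB g (Y i) (Y l)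
    rw [h1, h1, hY] at h3
    simp only [map_sum, map_smul, LinearMap.sum_apply, LinearMap.smul_apply, hY, smul_eq_mul] at h3
    rw [Matrix.mul_apply, Matrix.one_apply, ← h3]
    refine Finset.sum_congr rfl fun j _ => ?_
    simp [mul_comm]
  have h4 : O * O.transpose = 1 := mul_eq_one_comm.1 h2
  refine ⟨O, h1, fun j k => ?_⟩
  have h5 := congrFun₂ h4 j k
  rwa [Matrix.mul_apply, Matrix.one_apply] at h5

variable [CompactSpace G] [T2Space G] [MeasurableSpace G] [BorelSpace G] [FiniteDimensional ℝ V]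
  [SecondCountableTopology G] [IsTopologicalGroup G]
  (μ : Measure G) [μ.IsHaarMeasure] [IsProbabilityMeasure μ] (ξ : UnitaryIrrep G)

include μ

/-- Conjugation by `ξ(g)` replaces each `Y i` by `Ad g (Y i)`, and the sum of squares is the same
for every orthonormal basis. -/
lemma mat_mul_casimir {B : LinearMap.BilinForm ℝ (GroupLieAlgebra 𝓘(ℝ, V) G)}
    (hB : IsBiInvariant B) {Y : Module.Basis (Fin n) ℝ (GroupLieAlgebra 𝓘(ℝ, V) G)}
    (hY : ∀ i j, B (Y i) (Y j) = if i = j then 1 else 0) (g : G) :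
    ξ.mat g * (∑ i, ξ.derived (Y i) * ξ.derived (Y i)) =
      (∑ i, ξ.derived (Y i) * ξ.derived (Y i)) * ξ.mat g := by
  obtain ⟨O, hO, hO'⟩ := exists_orthogonal_Ad hB hY g
  have hinv : ξ.mat g⁻¹ * ξ.mat g = 1 := by
    rw [← ξ.mat_mul, inv_mul_cancel, ξ.mat_one]
  have hconj : ∀ i, ξ.mat g * (ξ.derived (Y i) * ξ.derived (Y i)) * ξ.mat g⁻¹ =
      ∑ j, ∑ k, ((O j i * O k i : ℝ) : ℂ) • (ξ.derived (Y j) * ξ.derived (Y k)) := fun i => by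
    have h1 : ξ.mat g * (ξ.derived (Y i) * ξ.derived (Y i)) * ξ.mat g⁻¹ =
        (ξ.mat g * ξ.derived (Y i) * ξ.mat g⁻¹) * (ξ.mat g * ξ.derived (Y i) * ξ.mat g⁻¹) := by
      calc _ = ξ.mat g * ξ.derived (Y i) * 1 * ξ.derived (Y i) * ξ.mat g⁻¹ := by
            simp only [mul_one, mul_assoc]
        _ = _ := by
            rw [← hinv]
            simp only [mul_assoc]
    rw [h1, mat_mul_derived_mul_mat_inv μ, hO i, derived_sum μ, Finset.sum_mul]
    refine Finset.sum_congr rfl fun j _ => ?_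
    rw [Finset.mul_sum]
    refine Finset.sum_congr rfl fun k _ => ?_
    rw [smul_mul_smul_comm, Complex.ofReal_mul]
  have h2 : ξ.mat g * (∑ i, ξ.derived (Y i) * ξ.derived (Y i)) * ξ.mat g⁻¹ =
      ∑ i, ξ.derived (Y i) * ξ.derived (Y i) := by
    rw [Finset.mul_sum, Finset.sum_mul]
    simp only [hconj]
    rw [Finset.sum_comm]
    refine Finset.sum_congr rfl fun j _ => ?_
    rw [Finset.sum_comm]
    simp only [← Finset.sum_smul, ← Complex.ofReal_sum, hO']
    simp
  calc _ = ξ.mat g * (∑ i, ξ.derived (Y i) * ξ.derived (Y i)) * (ξ.mat g⁻¹ * ξ.mat g) := by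
        rw [hinv, mul_one]
    _ = _ := by rw [← mul_assoc, h2]

lemma laplacian_coeff (Y : Fin n → GroupLieAlgebra 𝓘(ℝ, V) G) (i j : Fin ξ.dim) (x : G) :
    laplacian Y (ξ.coeff i j) x =
      -∑ k, ξ.coeff i k x * (∑ l, ξ.derived (Y l) * ξ.derived (Y l)) k j := by
  have h : ∀ i j, ContMDiff 𝓘(ℝ, V) 𝓘(ℝ, ℂ) ∞ (ξ.coeff i j) := contMDiff_coeff μ ξ
  rw [laplacian]
  have h1 : ∀ l, lieDeriv (Y l) (lieDeriv (Y l) (ξ.coeff i j)) x =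
      ∑ k, ξ.coeff i k x * (ξ.derived (Y l) * ξ.derived (Y l)) k j := fun l => by
    have h2 : lieDeriv (Y l) (ξ.coeff i j) =
        fun x => ∑ k, ξ.derived (Y l) k j • ξ.coeff i k x := funext fun x => by
      rw [lieDeriv_coeff μ]
      exact Finset.sum_congr rfl fun k _ => mul_comm _ _
    rw [h2]
    refine (congrFun (lieDeriv_sum Finset.univ
      (f := fun k x => ξ.derived (Y l) k j • ξ.coeff i k x)
      (fun k => contMDiff_smul_complex contMDiff_const (h i k)) (Y l)) x).trans ?_
    have h3 : ∀ k, lieDeriv (Y l) (fun x => ξ.derived (Y l) k j • ξ.coeff i k x) x =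
        ∑ m, ξ.coeff i m x * (ξ.derived (Y l) m k * ξ.derived (Y l) k j) := fun k => by
      refine (congrFun (lieDeriv_clm (h i k)
        ((ξ.derived (Y l) k j • ContinuousLinearMap.id ℂ ℂ).restrictScalars ℝ) (Y l)) x).trans ?_
      change ξ.derived (Y l) k j * lieDeriv (Y l) (ξ.coeff i k) x = _
      rw [lieDeriv_coeff μ, Finset.mul_sum]
      exact Finset.sum_congr rfl fun m _ => by ring
    simp only [h3, Matrix.mul_apply, Finset.mul_sum]
    exact Finset.sum_comm
  simp only [h1, Matrix.sum_apply, Finset.mul_sum]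
  rw [Finset.sum_comm]

/-- The Casimir operator of `ξ` is minus the Casimir number. -/
theorem sum_derived_mul_derived {B : LinearMap.BilinForm ℝ (GroupLieAlgebra 𝓘(ℝ, V) G)}
    (hB : IsBiInvariant B) {Y : Module.Basis (Fin n) ℝ (GroupLieAlgebra 𝓘(ℝ, V) G)}
    (hY : ∀ i j, B (Y i) (Y j) = if i = j then 1 else 0) :
    ∑ i, ξ.derived (Y i) * ξ.derived (Y i) =
      (-(ξ.casimir Y : ℂ)) • (1 : Matrix (Fin ξ.dim) (Fin ξ.dim) ℂ) := by
  obtain ⟨c, hc⟩ := ξ.exists_eq_smul_one_of_commute _ (mat_mul_casimir μ ξ hB hY)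
  let i₀ : Fin ξ.dim := ⟨0, ξ.dim_pos⟩
  have hlap : ∀ i j, laplacian Y (ξ.coeff i j) = fun x => -c * ξ.coeff i j x := fun i j => by
    funext x
    rw [laplacian_coeff μ, hc]
    simp [Matrix.one_apply, mul_comm]
  have hex : ∃ c : ℂ, ∀ i j, laplacian Y (ξ.coeff i j) = fun x => c * ξ.coeff i j x := ⟨-c, hlap⟩
  -- The eigenvalue is a choice among the numbers with the defining property; a diagonal coefficient
  -- equals `1` at the identity, which makes that number unique.
  have hev : ξ.eigenvalue Y = -c := by
    rw [UnitaryIrrep.eigenvalue, dif_pos hex]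
    have h1 := congrFun ((hex.choose_spec i₀ i₀).symm.trans (hlap i₀ i₀)) 1
    simpa [ξ.coeff_one] using h1
  -- Since the derived matrices are skew-Hermitian, a diagonal entry of `-∑ D_i²` is a sum of
  -- squared moduli. Hence the eigenvalue is real and nonnegative, and the norm in `casimir` does
  -- not change it.
  have hcreal : -c = ((∑ i, ∑ p, ‖ξ.derived (Y i) p i₀‖ ^ 2 : ℝ) : ℂ) := by
    have h1 := congrFun₂ hc i₀ i₀
    rw [Matrix.sum_apply, Matrix.smul_apply, Matrix.one_apply_eq, smul_eq_mul, mul_one] at h1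
    rw [← h1, ← Finset.sum_neg_distrib, Complex.ofReal_sum]
    refine Finset.sum_congr rfl fun i _ => ?_
    rw [Matrix.mul_apply, ← Finset.sum_neg_distrib, Complex.ofReal_sum]
    refine Finset.sum_congr rfl fun p _ => ?_
    rw [← neg_mul, ← star_derived μ, Complex.ofReal_pow, ← Complex.conj_mul']
    rfl
  have hcas : (ξ.casimir Y : ℂ) = -c := by
    rw [UnitaryIrrep.casimir, hev, hcreal, Complex.norm_real, Real.norm_of_nonneg]
    exact Finset.sum_nonneg fun i _ => Finset.sum_nonneg fun p _ => sq_nonneg _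
  rw [hc, hcas, neg_neg]

/-- Moving one factor across, `∑ ‖D_i w‖² = -⟪w, ∑ D_i² w⟫`, and the Casimir sum is a scalar. -/
lemma sum_vecSq_matAct_derived {W : Type*} [NormedAddCommGroup W] [InnerProductSpace ℂ W]
    {B : LinearMap.BilinForm ℝ (GroupLieAlgebra 𝓘(ℝ, V) G)}
    (hB : IsBiInvariant B) {Y : Module.Basis (Fin n) ℝ (GroupLieAlgebra 𝓘(ℝ, V) G)}
    (hY : ∀ i j, B (Y i) (Y j) = if i = j then 1 else 0) (w : Fin ξ.dim → W) :
    ∑ i, vecSq (matAct (ξ.derived (Y i)) w) = ξ.casimir Y * vecSq w := by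
  have key : ∀ p, ∑ i, matAct (ξ.derived (Y i)) (matAct (ξ.derived (Y i)) w) p =
      (-(ξ.casimir Y : ℂ)) • w p := fun p =>
    calc ∑ i, matAct (ξ.derived (Y i)) (matAct (ξ.derived (Y i)) w) p
        = ∑ i, matAct (ξ.derived (Y i) * ξ.derived (Y i)) w p :=
          Finset.sum_congr rfl fun i _ => (congrFun (matAct_mul _ _ w) p).symm
      _ = matAct (∑ i, ξ.derived (Y i) * ξ.derived (Y i)) w p := (matAct_sum _ _ w p).symm
      _ = _ := by rw [sum_derived_mul_derived μ ξ hB hY, matAct_smul, matAct_one]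
  have h1 : ∀ i, ((vecSq (matAct (ξ.derived (Y i)) w) : ℝ) : ℂ) =
      -∑ p, inner ℂ (w p) (matAct (ξ.derived (Y i)) (matAct (ξ.derived (Y i)) w) p) := fun i => by
    rw [← sum_inner_self_eq_vecSq, sum_inner_matAct_left fun i j => star_derived μ ξ _ i j]
  have h : ((∑ i, vecSq (matAct (ξ.derived (Y i)) w) : ℝ) : ℂ) = (ξ.casimir Y * vecSq w : ℝ) := by
    rw [Complex.ofReal_sum, Finset.sum_congr rfl fun i _ => h1 i, Finset.sum_neg_distrib,
      Finset.sum_comm]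
    have h2 : ∀ p, ∑ i, inner ℂ (w p) (matAct (ξ.derived (Y i)) (matAct (ξ.derived (Y i)) w) p) =
        (-(ξ.casimir Y : ℂ)) * inner ℂ (w p) (w p) := fun p => by
      rw [← inner_sum, key, inner_smul_right]
    rw [Finset.sum_congr rfl fun p _ => h2 p, ← Finset.mul_sum, sum_inner_self_eq_vecSq,
      Complex.ofReal_mul]
    ring
  exact_mod_cast h

/-- The Casimir number is controlled by the derivatives along any basis. -/
lemma exists_casimir_mul_vecSq_le {B : LinearMap.BilinForm ℝ (GroupLieAlgebra 𝓘(ℝ, V) G)}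
    (hB : IsBiInvariant B) {Y : Module.Basis (Fin n) ℝ (GroupLieAlgebra 𝓘(ℝ, V) G)}
    (hY : ∀ i j, B (Y i) (Y j) = if i = j then 1 else 0)
    (X : Module.Basis (Fin n) ℝ (GroupLieAlgebra 𝓘(ℝ, V) G)) :
    ∃ C : ℝ, 0 ≤ C ∧ ∀ (ξ : UnitaryIrrep G) {W : Type*} [NormedAddCommGroup W]
      [InnerProductSpace ℂ W] (w : Fin ξ.dim → W),
      ξ.casimir Y * vecSq w ≤ C * ∑ j, vecSq (matAct (ξ.derived (X j)) w) := by
  refine ⟨∑ i, ∑ j, (X.repr (Y i) j) ^ 2, Finset.sum_nonneg fun i _ =>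
    Finset.sum_nonneg fun j _ => sq_nonneg _, fun ξ W _ _ w => ?_⟩
  rw [← sum_vecSq_matAct_derived μ ξ hB hY, Finset.sum_mul]
  refine Finset.sum_le_sum fun i _ => ?_
  have h1 : ξ.derived (Y i) = ∑ j, (X.repr (Y i) j : ℂ) • ξ.derived (X j) := by
    rw [← derived_sum μ, X.sum_repr]
  have h2 : ∀ p, ‖matAct (ξ.derived (Y i)) w p‖ ^ 2 ≤
      (∑ j, (X.repr (Y i) j) ^ 2) * ∑ j, ‖matAct (ξ.derived (X j)) w p‖ ^ 2 := fun p => by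
    rw [h1, matAct_sum]
    refine (pow_le_pow_left₀ (norm_nonneg _) (norm_sum_le _ _) 2).trans ?_
    simp only [matAct_smul, norm_smul, Complex.norm_real]
    refine (Finset.sum_mul_sq_le_sq_mul_sq _ _ _).trans_eq ?_
    simp only [Real.norm_eq_abs, sq_abs]
  calc vecSq (matAct (ξ.derived (Y i)) w) ≤
        ∑ p, (∑ j, (X.repr (Y i) j) ^ 2) * ∑ j, ‖matAct (ξ.derived (X j)) w p‖ ^ 2 :=
        Finset.sum_le_sum fun p _ => h2 p
    _ = _ := by
        rw [← Finset.mul_sum, Finset.sum_comm]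
        rfl

end Casimir


/-! ### Rapid decay of the Fourier coefficients of smooth functions. -/

section Decay

variable {V : Type*} [NormedAddCommGroup V] [NormedSpace ℝ V]
  {G : Type*} [TopologicalSpace G] [ChartedSpace V G] [Group G] [LieGroup 𝓘(ℝ, V) ∞ G]
  [CompactSpace G] [T2Space G] [MeasurableSpace G] [BorelSpace G] [FiniteDimensional ℝ V]
  [SecondCountableTopology G] [IsTopologicalGroup G] {n : ℕ}
  (μ : Measure G) [μ.IsHaarMeasure] [IsProbabilityMeasure μ]

include μ

/-- Raise the hypothesis to the power `k + 1`, distribute the power over the `n` summands by the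
power mean inequality (whence `n ^ k`), and apply `vecSq_matAct_pow_le`; the surplus factor `vecSq w
^ k` cancels. -/
lemma casimir_pow_mul_le {W : Type*} [NormedAddCommGroup W] [InnerProductSpace ℂ W]
    (ξ : UnitaryIrrep G) (Y X : Fin n → GroupLieAlgebra 𝓘(ℝ, V) G) {C : ℝ} (hC : 0 ≤ C)
    (w : Fin ξ.dim → W)
    (h : ξ.casimir Y * vecSq w ≤ C * ∑ j, vecSq (matAct (ξ.derived (X j)) w)) (k : ℕ) :
    ξ.casimir Y ^ (k + 1) * vecSq w ≤
      C ^ (k + 1) * n ^ k * ∑ j, vecSq (matAct (ξ.derived (X j) ^ (k + 1)) w) := by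
  have hR : 0 ≤ C ^ (k + 1) * n ^ k * ∑ j, vecSq (matAct (ξ.derived (X j) ^ (k + 1)) w) :=
    mul_nonneg (by positivity) (Finset.sum_nonneg fun _ _ => vecSq_nonneg _)
  rcases (vecSq_nonneg w).eq_or_lt with h0 | h0
  · rw [← h0, mul_zero]
    exact hR
  refine le_of_mul_le_mul_right ?_ (pow_pos h0 k)
  have hn : (∑ j, vecSq (matAct (ξ.derived (X j)) w)) ^ (k + 1) ≤
      n ^ k * ∑ j, vecSq (matAct (ξ.derived (X j)) w) ^ (k + 1) := by
    rcases n.eq_zero_or_pos with rfl | hn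
    · simp
    have := pow_sum_div_card_le_sum_pow (s := Finset.univ)
      (f := fun j => vecSq (matAct (ξ.derived (X j)) w)) (fun _ _ => vecSq_nonneg _) k
    rw [Finset.card_univ, Fintype.card_fin, div_le_iff₀ (by positivity)] at this
    rwa [mul_comm]
  calc ξ.casimir Y ^ (k + 1) * vecSq w * vecSq w ^ k = (ξ.casimir Y * vecSq w) ^ (k + 1) := by ring
    _ ≤ (C * ∑ j, vecSq (matAct (ξ.derived (X j)) w)) ^ (k + 1) :=
        pow_le_pow_left₀ (mul_nonneg (ξ.casimir_nonneg Y) h0.le) h _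
    _ = C ^ (k + 1) * (∑ j, vecSq (matAct (ξ.derived (X j)) w)) ^ (k + 1) := mul_pow _ _ _
    _ ≤ C ^ (k + 1) * (n ^ k * ∑ j, vecSq (matAct (ξ.derived (X j)) w) ^ (k + 1)) := by gcongr
    _ ≤ C ^ (k + 1) * (n ^ k * ∑ j, vecSq w ^ k *
          vecSq (matAct (ξ.derived (X j) ^ (k + 1)) w)) := by
        gcongr with j
        exact vecSq_matAct_pow_le (fun i j => star_derived μ ξ _ i j) w k
    _ = _ := by
        rw [← Finset.mul_sum]
        ring

lemma fourierCoeff_lieDerivs_replicate {W : Type*} [NormedAddCommGroup W] [InnerProductSpace ℂ W]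
    [CompleteSpace W] (ξ : UnitaryIrrep G) {u : G → W} (hu : ContMDiff 𝓘(ℝ, V) 𝓘(ℝ, W) ∞ u)
    (X : GroupLieAlgebra 𝓘(ℝ, V) G) (k : ℕ) (j : Fin ξ.dim) :
    (fun i => fourierCoeff μ ξ (lieDerivs (List.replicate k X) u) i j) =
      matAct (ξ.derived X ^ k) fun i => fourierCoeff μ ξ u i j := by
  induction k with
  | zero =>
    rw [pow_zero, matAct_one]
    rfl
  | succ k ih =>
    rw [pow_succ', matAct_mul, ← ih]
    exact funext fun i => fourierCoeff_lieDeriv μ ξ (contMDiff_lieDerivs hu _) X i j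

/-- The Fourier coefficients of a smooth function decay rapidly. -/
theorem exists_weight_pow_mul_hsSq_le
    {B : LinearMap.BilinForm ℝ (GroupLieAlgebra 𝓘(ℝ, V) G)}
    (hB : IsBiInvariant B) {Y : Module.Basis (Fin n) ℝ (GroupLieAlgebra 𝓘(ℝ, V) G)}
    (hY : ∀ i j, B (Y i) (Y j) = if i = j then 1 else 0)
    (X : Module.Basis (Fin n) ℝ (GroupLieAlgebra 𝓘(ℝ, V) G)) (k : ℕ) :
    ∃ C : ℝ, 0 ≤ C ∧ ∀ (ξ : UnitaryIrrep G) {W : Type*} [NormedAddCommGroup W]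
      [InnerProductSpace ℂ W] [CompleteSpace W] (u : G → W), ContMDiff 𝓘(ℝ, V) 𝓘(ℝ, W) ∞ u →
      ξ.weight Y ^ (2 * k) * hsSq (fourierCoeff μ ξ u) ≤ C * (hsSq (fourierCoeff μ ξ u) +
        ∑ j, hsSq (fourierCoeff μ ξ (lieDerivs (List.replicate k (X j)) u))) := by
  cases k with
  | zero =>
    refine ⟨1, zero_le_one, fun ξ W _ _ _ u hu => ?_⟩
    rw [mul_zero, pow_zero, one_mul, one_mul]
    exact le_add_of_nonneg_right (Finset.sum_nonneg fun _ _ => hsSq_nonneg _)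
  | succ k =>
  obtain ⟨C, hC, hCas⟩ := exists_casimir_mul_vecSq_le μ hB hY X
  set M : ℝ := 2 ^ k * max 1 (C ^ (k + 1) * n ^ k) with hM
  refine ⟨M, by positivity, fun ξ W _ _ _ u hu => ?_⟩
  have h1 : ξ.casimir Y ^ (k + 1) * hsSq (fourierCoeff μ ξ u) ≤ C ^ (k + 1) * n ^ k *
      ∑ j, hsSq (fourierCoeff μ ξ (lieDerivs (List.replicate (k + 1) (X j)) u)) := by
    simp only [hsSq_eq_sum_vecSq]
    rw [Finset.sum_comm, Finset.mul_sum, Finset.mul_sum]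
    refine Finset.sum_le_sum fun j _ => ?_
    simp only [fourierCoeff_lieDerivs_replicate μ ξ hu]
    exact casimir_pow_mul_le μ ξ Y X hC _ (hCas ξ _) k
  -- This is `(1 + c)^(k+1) ≤ 2^k (1 + c^(k+1))` for the Casimir number `c`.
  have h2 : ξ.weight Y ^ (2 * (k + 1)) ≤ 2 ^ k * (1 + ξ.casimir Y ^ (k + 1)) := by
    rw [pow_mul, UnitaryIrrep.weight_sq]
    have := add_pow_le zero_le_one (ξ.casimir_nonneg Y) (k + 1)
    rwa [one_pow, Nat.add_sub_cancel] at this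
  set a := hsSq (fourierCoeff μ ξ u)
  set b := ∑ j, hsSq (fourierCoeff μ ξ (lieDerivs (List.replicate (k + 1) (X j)) u)) with hb
  have ha : 0 ≤ a := hsSq_nonneg _
  have hb0 : 0 ≤ b := Finset.sum_nonneg fun _ _ => hsSq_nonneg _
  calc ξ.weight Y ^ (2 * (k + 1)) * a ≤ 2 ^ k * (1 + ξ.casimir Y ^ (k + 1)) * a := by gcongr
    _ = 2 ^ k * (1 * a + ξ.casimir Y ^ (k + 1) * a) := by ring
    _ ≤ 2 ^ k * (max 1 (C ^ (k + 1) * n ^ k) * a + max 1 (C ^ (k + 1) * n ^ k) * b) := by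
        refine mul_le_mul_of_nonneg_left (add_le_add ?_ ?_) (by positivity)
        · exact mul_le_mul_of_nonneg_right (le_max_left _ _) ha
        · exact h1.trans (mul_le_mul_of_nonneg_right (le_max_right _ _) hb0)
    _ = M * (a + b) := by
        rw [hM]
        ring

end Decay

/-! ### Unitary matrices and linear combinations of matrices acting on vectors. -/

section UnitaryAction

variable {W : Type*} [NormedAddCommGroup W] [InnerProductSpace ℂ W]

lemma sum_inner_matAct {m n : ℕ} (D : Matrix (Fin m) (Fin n) ℂ) (v : Fin n → W) (w : Fin m → W) :
    ∑ p, inner ℂ (matAct D v p) (w p) = ∑ q, inner ℂ (v q) (matAct D.conjTranspose w q) := by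
  simp only [matAct, sum_inner, inner_sum, inner_smul_left, inner_smul_right]
  exact Finset.sum_comm

lemma vecSq_matAct_of_unitary {n : ℕ} {U : Matrix (Fin n) (Fin n) ℂ} (hU : U.conjTranspose * U = 1)
    (w : Fin n → W) : vecSq (matAct U w) = vecSq w := by
  have h : ((vecSq (matAct U w) : ℝ) : ℂ) = vecSq w := by
    rw [← sum_inner_self_eq_vecSq, sum_inner_matAct, ← matAct_mul, hU, matAct_one,
      sum_inner_self_eq_vecSq]
  exact_mod_cast h

lemma vecSq_matAct_sum_le {n d : ℕ} (D : Fin n → Matrix (Fin d) (Fin d) ℂ) (a : Fin n → ℝ)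
    (w : Fin d → W) : vecSq (matAct (∑ j, (a j : ℂ) • D j) w) ≤
      (∑ j, a j ^ 2) * ∑ j, vecSq (matAct (D j) w) := by
  have h : ∀ p, ‖matAct (∑ j, (a j : ℂ) • D j) w p‖ ^ 2 ≤
      (∑ j, a j ^ 2) * ∑ j, ‖matAct (D j) w p‖ ^ 2 := fun p => by
    rw [matAct_sum]
    refine (pow_le_pow_left₀ (norm_nonneg _) (norm_sum_le _ _) 2).trans ?_
    simp only [matAct_smul, norm_smul, Complex.norm_real]
    refine (Finset.sum_mul_sq_le_sq_mul_sq _ _ _).trans_eq ?_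
    simp only [Real.norm_eq_abs, sq_abs]
  refine (Finset.sum_le_sum fun p _ => h p).trans_eq ?_
  rw [← Finset.mul_sum, Finset.sum_comm]
  rfl

end UnitaryAction

/-! ### The size of the unitary dual -/

section Counting

open Filter Topology Set

variable {V : Type*} [NormedAddCommGroup V] [NormedSpace ℝ V]
  {G : Type*} [TopologicalSpace G] [ChartedSpace V G] [Group G] [LieGroup 𝓘(ℝ, V) ∞ G]
  {n : ℕ}

lemma invChart_chart {g : G} (hg : g ∈ (chartAt V (1 : G)).source) :
    invChart V G (chartAt V (1 : G) g) = g := (chartAt V (1 : G)).left_inv hg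

variable (V G) in
/-- Near the identity, the coordinates of `x⁻¹ y` are bounded by the distance of the coordinates of
`x` and `y`. -/
lemma exists_chart_lipschitz :
    ∃ C r : ℝ, 0 < C ∧ 0 < r ∧ Metric.closedBall (chartOrigin V G) r ⊆ chartDomain V G ∧
      ∀ v ∈ Metric.closedBall (chartOrigin V G) r, ∀ w ∈ Metric.closedBall (chartOrigin V G) r,
        ∃ z ∈ chartDomain V G, ‖z - chartOrigin V G‖ ≤ C * ‖w - v‖ ∧
          (invChart V G v)⁻¹ * invChart V G w = invChart V G z := by
  set o := chartOrigin V G with ho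
  let q : V × V → G := fun p => (invChart V G p.1)⁻¹ * invChart V G p.2
  have hψ : ContMDiffAt 𝓘(ℝ, V) 𝓘(ℝ, V) ∞ (invChart V G) o :=
    (contMDiffOn_invChart V G).contMDiffAt ((isOpen_chartDomain V G).mem_nhds (chartOrigin_mem V G))
  have hq : ContMDiffAt 𝓘(ℝ, V × V) 𝓘(ℝ, V) ∞ q (o, o) := by
    have h1 : ContMDiffAt 𝓘(ℝ, V × V) 𝓘(ℝ, V) ∞ (fun p : V × V => invChart V G p.1) (o, o) :=
      ContMDiffAt.comp (g := invChart V G) (f := Prod.fst) (o, o) hψ contDiff_fst.contMDiff.contMDiffAt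
    have h2 : ContMDiffAt 𝓘(ℝ, V × V) 𝓘(ℝ, V) ∞ (fun p : V × V => invChart V G p.2) (o, o) :=
      ContMDiffAt.comp (g := invChart V G) (f := Prod.snd) (o, o) hψ contDiff_snd.contMDiff.contMDiffAt
    exact h1.inv.mul h2
  have hq1 : q (o, o) = 1 := inv_mul_cancel _
  have hF : ContDiffAt ℝ ∞ (fun p => chartAt V (1 : G) (q p)) (o, o) := by
    rw [← contMDiffAt_iff_contDiffAt]
    refine ContMDiffAt.comp (g := chartAt V (1 : G)) (o, o) ?_ hq
    rw [hq1]
    exact contMDiffAt_of_mem_maximalAtlas (IsManifold.chart_mem_maximalAtlas 1)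
      (mem_chart_source V 1)
  obtain ⟨C, t, ht, hC⟩ := (hF.of_le (m := 1) (by simp)).exists_lipschitzOnWith
  have hsrc : ∀ᶠ p in 𝓝 (o, o), q p ∈ (chartAt V (1 : G)).source := by
    refine hq.continuousAt.eventually_mem ?_
    rw [hq1]
    exact chart_source_mem_nhds V 1
  have hdom : ∀ᶠ p : V × V in 𝓝 (o, o), p.1 ∈ chartDomain V G :=
    continuous_fst.continuousAt.eventually_mem
      ((isOpen_chartDomain V G).mem_nhds (chartOrigin_mem V G))
  obtain ⟨r, hr, hr'⟩ := Metric.nhds_basis_closedBall.eventually_iff.1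
    ((hsrc.and hdom).and (show ∀ᶠ p in 𝓝 (o, o), p ∈ t from ht))
  have hmem : ∀ v ∈ Metric.closedBall o r, ∀ w ∈ Metric.closedBall o r,
      (v, w) ∈ Metric.closedBall (o, o) r := fun v hv w hw => by
    rw [← closedBall_prod_same]
    exact ⟨hv, hw⟩
  -- The Lipschitz constant may be zero; adding `1` makes it positive.
  refine ⟨C + 1, r, by positivity, hr, fun v hv => (hr' (hmem v hv v hv)).1.2, fun v hv w hw => ?_⟩
  obtain ⟨⟨h1, -⟩, h3⟩ := hr' (hmem v hv w hw)
  have h4 := (hr' (hmem v hv v hv)).2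
  refine ⟨chartAt V (1 : G) (q (v, w)), (chartAt V (1 : G)).map_source h1, ?_,
    (invChart_chart h1).symm⟩
  -- The Lipschitz bound compares `(v, w)` with `(v, v)`, whose image under `q` is the identity.
  have h5 := hC.dist_le_mul _ h3 _ h4
  have h6 : q (v, v) = 1 := inv_mul_cancel _
  rw [h6, dist_eq_norm, dist_eq_norm, Prod.mk_sub_mk, sub_self, Prod.norm_mk, norm_zero,
    max_eq_right (norm_nonneg _)] at h5
  refine h5.trans (mul_le_mul_of_nonneg_right ?_ (norm_nonneg _))
  exact le_add_of_nonneg_right zero_le_one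

/-- The `j`-th column of the matrix `ξ(x)`. -/
def UnitaryIrrep.column (ξ : UnitaryIrrep G) (j : Fin ξ.dim) (x : G) :
    EuclideanSpace ℂ (Fin ξ.dim) := WithLp.toLp 2 fun i => ξ.coeff i j x

/-- `ξ(x)` is unitary. This lets estimates near the identity be carried to any other point. -/
lemma UnitaryIrrep.norm_column_sub_column (ξ : UnitaryIrrep G) (j : Fin ξ.dim) (x y z : G) :
    ‖ξ.column j (x * y) - ξ.column j (x * z)‖ = ‖ξ.column j y - ξ.column j z‖ := by
  have h : ∀ u : EuclideanSpace ℂ (Fin ξ.dim), ‖u‖ ^ 2 = vecSq u.ofLp := fun u =>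
    EuclideanSpace.norm_sq_eq u
  refine (pow_left_inj₀ (norm_nonneg _) (norm_nonneg _) two_ne_zero).1 ?_
  rw [h, h, ← vecSq_matAct_of_unitary (ξ.conjTranspose_mat_mul x)
    (ξ.column j y - ξ.column j z).ofLp]
  congr 1
  funext i
  change ξ.coeff i j (x * y) - ξ.coeff i j (x * z) =
    ∑ k, ξ.coeff i k x * (ξ.coeff k j y - ξ.coeff k j z)
  simp only [ξ.coeff_mul, mul_sub, Finset.sum_sub_distrib]

lemma UnitaryIrrep.norm_coeff_sub_le (ξ : UnitaryIrrep G) (j : Fin ξ.dim) (x : G) :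
    ‖ξ.coeff j j x - 1‖ ≤ ‖ξ.column j x - ξ.column j 1‖ := by
  refine le_trans (le_of_eq ?_) (PiLp.norm_apply_le (ξ.column j x - ξ.column j 1) j)
  change _ = ‖ξ.coeff j j x - ξ.coeff j j 1‖
  rw [ξ.coeff_one, if_pos rfl]

variable [CompactSpace G] [T2Space G] [MeasurableSpace G] [BorelSpace G] [FiniteDimensional ℝ V]
  [SecondCountableTopology G] [IsTopologicalGroup G]
  (μ : Measure G) [μ.IsHaarMeasure] [IsProbabilityMeasure μ]

include μ

lemma contMDiff_column (ξ : UnitaryIrrep G) (j : Fin ξ.dim) :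
    ContMDiff 𝓘(ℝ, V) 𝓘(ℝ, EuclideanSpace ℂ (Fin ξ.dim)) ∞ (ξ.column j) := by
  have h : ContMDiff 𝓘(ℝ, V) 𝓘(ℝ, Fin ξ.dim → ℂ) ∞ (fun x i => ξ.coeff i j x) :=
    contMDiff_pi_space.2 fun i => contMDiff_coeff μ ξ i j
  exact ((PiLp.continuousLinearEquiv 2 ℝ fun _ : Fin ξ.dim => ℂ).symm :
    (Fin ξ.dim → ℂ) →L[ℝ] EuclideanSpace ℂ (Fin ξ.dim)).contMDiff.comp h

lemma norm_lieDeriv_column_sq (ξ : UnitaryIrrep G) (j : Fin ξ.dim)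
    (Z : GroupLieAlgebra 𝓘(ℝ, V) G) :
    ‖lieDeriv Z (ξ.column j) 1‖ ^ 2 = vecSq (matAct (ξ.derived Z) fun i => ξ.coeff i j 1) := by
  rw [EuclideanSpace.norm_sq_eq]
  refine Finset.sum_congr rfl fun i _ => ?_
  congr 2
  have h := congrFun (lieDeriv_clm (contMDiff_column (V := V) μ ξ j)
    ((EuclideanSpace.proj i : EuclideanSpace ℂ (Fin ξ.dim) →L[ℂ] ℂ).restrictScalars ℝ) Z) 1
  refine h.symm.trans ?_
  change lieDeriv Z (ξ.coeff i j) 1 = ∑ q, ξ.derived Z i q * ξ.coeff q j 1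
  simp only [ξ.coeff_one, mul_ite, mul_one, mul_zero, Finset.sum_ite_eq', Finset.mem_univ, if_true]
  rfl

/-- A bound for representations near the identity, which depends on the weight only. -/
theorem exists_norm_column_sub_le {B : LinearMap.BilinForm ℝ (GroupLieAlgebra 𝓘(ℝ, V) G)}
    (hB : IsBiInvariant B) {Y : Module.Basis (Fin n) ℝ (GroupLieAlgebra 𝓘(ℝ, V) G)}
    (hY : ∀ i j, B (Y i) (Y j) = if i = j then 1 else 0) :
    ∃ C r : ℝ, 0 < C ∧ 0 < r ∧ Metric.closedBall (chartOrigin V G) r ⊆ chartDomain V G ∧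
      ∀ (ξ : UnitaryIrrep G) (j : Fin ξ.dim), ∀ v ∈ Metric.closedBall (chartOrigin V G) r,
        ‖ξ.column j (invChart V G v) - ξ.column j 1‖ ≤
          C * ξ.weight Y * ‖v - chartOrigin V G‖ := by
  obtain ⟨C, r, hC, hr, hdom, hlip⟩ := exists_chart_lipschitz V G
  set o := chartOrigin V G with ho
  let L : V →ₗ[ℝ] (Fin n → ℝ) := Y.equivFun.toLinearMap
  let L' : V →L[ℝ] (Fin n → ℝ) := LinearMap.toContinuousLinearMap L
  -- `M` compares the Euclidean norm of the coordinates with respect to `Y` with the given norm of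
  -- `V`; the `1` keeps it positive.
  set M : ℝ := Real.sqrt n * ‖L'‖ + 1 with hM
  have hMpos : 0 < M := by positivity
  have hcoord : ∀ Z : V, ∑ i, (L Z i) ^ 2 ≤ (M * ‖Z‖) ^ 2 := fun Z => by
    have h1 : ∀ i, (L Z i) ^ 2 ≤ (‖L'‖ * ‖Z‖) ^ 2 := fun i => by
      rw [← sq_abs, ← Real.norm_eq_abs]
      exact pow_le_pow_left₀ (norm_nonneg _) ((norm_le_pi_norm (L' Z) i).trans (L'.le_opNorm Z)) 2
    calc ∑ i, (L Z i) ^ 2 ≤ ∑ i : Fin n, (‖L'‖ * ‖Z‖) ^ 2 := Finset.sum_le_sum fun i _ => h1 i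
      _ = (Real.sqrt n * ‖L'‖ * ‖Z‖) ^ 2 := by
          rw [Finset.sum_const, Finset.card_univ, Fintype.card_fin, nsmul_eq_mul, mul_assoc,
            mul_pow (Real.sqrt n), Real.sq_sqrt (Nat.cast_nonneg n)]
      _ ≤ _ := by
          gcongr
          exact le_add_of_nonneg_right zero_le_one
  -- At the identity the column is a unit vector, so its squared derivatives along the `Y i` add up
  -- to the Casimir number, at most `⟨ξ⟩²`.
  have hderiv : ∀ (ξ : UnitaryIrrep G) (j : Fin ξ.dim) (Z : V),
      ‖lieDeriv (Z : GroupLieAlgebra 𝓘(ℝ, V) G) (ξ.column j) 1‖ ≤ M * ξ.weight Y * ‖Z‖ := by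
    intro ξ j Z
    have hw : 0 < ξ.weight Y := ξ.weight_pos Y
    refine le_of_sq_le_sq ?_ (by positivity)
    have h1 : ξ.derived (Z : GroupLieAlgebra 𝓘(ℝ, V) G) = ∑ i, (L Z i : ℂ) • ξ.derived (Y i) := by
      rw [← derived_sum μ]
      exact congrArg ξ.derived (Y.sum_equivFun Z).symm
    have h2 : vecSq (fun i => ξ.coeff i j 1) = 1 := by
      simp [vecSq, ξ.coeff_one, apply_ite norm]
    refine (norm_lieDeriv_column_sq μ ξ j (Z : GroupLieAlgebra 𝓘(ℝ, V) G)).trans_le ?_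
    rw [h1]
    refine (vecSq_matAct_sum_le _ _ _).trans ?_
    rw [sum_vecSq_matAct_derived μ ξ hB hY, h2, mul_one]
    calc _ ≤ (M * ‖Z‖) ^ 2 * ξ.weight Y ^ 2 := by
          refine mul_le_mul (hcoord Z) ?_ (ξ.casimir_nonneg Y) (sq_nonneg _)
          rw [ξ.weight_sq]
          exact le_add_of_nonneg_left zero_le_one
      _ = _ := by ring
  refine ⟨M * C, r / 2, by positivity, by positivity,
    (Metric.closedBall_subset_closedBall (by linarith)).trans hdom, fun ξ j v hv => ?_⟩
  have hw : 0 < ξ.weight Y := ξ.weight_pos Y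
  set h : V → EuclideanSpace ℂ (Fin ξ.dim) := fun v => ξ.column j (invChart V G v) with hh
  have hdiff : ∀ v ∈ chartDomain V G, DifferentiableAt ℝ h v := fun v hv => by
    have := (jointlySmooth_translate (contMDiff_column (V := V) μ ξ j)).differentiableAt
      (isOpen_chartDomain V G) 1 hv
    simpa only [one_mul] using this
  have ho1 : ∀ Z : V, ‖fderiv ℝ h o Z‖ ≤ M * ξ.weight Y * ‖Z‖ := fun Z => by
    have h2 := lieDeriv_eq (contMDiff_column (V := V) μ ξ j) (Z : GroupLieAlgebra 𝓘(ℝ, V) G) 1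
    simp only [one_mul] at h2
    exact (congrArg norm h2).symm.trans_le (hderiv ξ j Z)
  -- Left translation identifies the increment from `v` to `w` with one from the origin to a point
  -- `z` with `‖z - o‖ ≤ C ‖w - v‖`, so the derivative bound at the origin spreads to the ball. The
  -- radius is halved so that `w` stays where the comparison holds; `ε` absorbs the first-order
  -- error.
  have hbound : ∀ v ∈ Metric.closedBall o (r / 2), ‖fderiv ℝ h v‖ ≤ M * C * ξ.weight Y := by
    intro v hv
    refine le_of_forall_pos_le_add fun ε hε => ?_
    set a : ℝ := M * ξ.weight Y + ε / C with ha
    have ha' : 0 ≤ a := by positivity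
    have h1 : ∀ᶠ z in 𝓝 o, ‖h z - h o‖ ≤ a * ‖z - o‖ := by
      have h2 := (hasFDerivAt_iff_isLittleO.1
        (hdiff o (chartOrigin_mem V G)).hasFDerivAt).def (div_pos hε hC)
      filter_upwards [h2] with z hz
      calc ‖h z - h o‖ ≤ ‖fderiv ℝ h o (z - o)‖ + ‖h z - h o - fderiv ℝ h o (z - o)‖ :=
            norm_le_insert' _ _
        _ ≤ M * ξ.weight Y * ‖z - o‖ + ε / C * ‖z - o‖ := add_le_add (ho1 _) hz
        _ = _ := (add_mul _ _ _).symm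
    obtain ⟨δ, hδ, hδ'⟩ := Metric.eventually_nhds_iff_ball.1 h1
    have h3 : ‖fderiv ℝ h v‖ ≤ a * C := by
      refine norm_fderiv_le_of_lip' ℝ (by positivity) ?_
      have h4 : min (δ / C) (r / 2) > 0 := by positivity
      filter_upwards [Metric.ball_mem_nhds v h4] with w hw'
      rw [Metric.mem_ball, dist_eq_norm] at hw'
      have h5 : w ∈ Metric.closedBall o r := by
        rw [Metric.mem_closedBall, dist_eq_norm] at hv ⊢
        calc ‖w - o‖ = ‖(w - v) + (v - o)‖ := by rw [sub_add_sub_cancel]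
          _ ≤ ‖w - v‖ + ‖v - o‖ := norm_add_le _ _
          _ ≤ r / 2 + r / 2 := add_le_add (hw'.trans_le (min_le_right _ _)).le hv
          _ = r := add_halves r
      obtain ⟨z, -, hz, hz'⟩ := hlip v (Metric.closedBall_subset_closedBall (by linarith) hv) w h5
      have h6 : z ∈ Metric.ball o δ := by
        rw [Metric.mem_ball, dist_eq_norm]
        refine hz.trans_lt ?_
        have := hw'.trans_le (min_le_left _ _)
        rwa [lt_div_iff₀ hC, mul_comm] at this
      calc ‖h w - h v‖ = ‖h z - h o‖ := by
            have h7 := ξ.norm_column_sub_column j (invChart V G v)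
              ((invChart V G v)⁻¹ * invChart V G w) 1
            rw [mul_inv_cancel_left, mul_one, hz'] at h7
            simp only [hh, ho, invChart_chartOrigin]
            exact h7
        _ ≤ a * ‖z - o‖ := hδ' z h6
        _ ≤ a * (C * ‖w - v‖) := mul_le_mul_of_nonneg_left hz ha'
        _ = _ := (mul_assoc _ _ _).symm
    refine h3.trans_eq ?_
    rw [ha, add_mul, div_mul_cancel₀ _ hC.ne']
    ring
  have := (convex_closedBall o (r / 2)).norm_image_sub_le_of_norm_fderiv_le
    (fun v hv => hdiff v (hdom (Metric.closedBall_subset_closedBall (by linarith) hv))) hbound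
    (Metric.mem_closedBall_self (by positivity)) hv
  simpa only [hh, ho, invChart_chartOrigin, mul_right_comm M C] using this

end Counting

/-! ### Volumes of small balls and the number of representations of bounded weight. -/

section Counting

open Filter Topology Set

variable {V : Type*} [NormedAddCommGroup V] [NormedSpace ℝ V]
  {G : Type*} [TopologicalSpace G] [ChartedSpace V G] [Group G] [LieGroup 𝓘(ℝ, V) ∞ G]
  {n : ℕ}

variable (V G) in
/-- The closed ball of radius `r` around the identity in the chart at the identity. -/
def chartBall (r : ℝ) : Set G := invChart V G '' Metric.closedBall (chartOrigin V G) r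

variable [CompactSpace G] [T2Space G] [MeasurableSpace G] [BorelSpace G] [FiniteDimensional ℝ V]
  [SecondCountableTopology G] [IsTopologicalGroup G]
  (μ : Measure G) [μ.IsHaarMeasure] [IsProbabilityMeasure μ]

lemma measurableSet_chartBall {r : ℝ}
    (hr : Metric.closedBall (chartOrigin V G) r ⊆ chartDomain V G) :
    MeasurableSet (chartBall V G r) := by
  have : ProperSpace V := FiniteDimensional.proper_real V
  exact ((isCompact_closedBall _ _).image_of_continuousOn
    ((contMDiffOn_invChart V G).continuousOn.mono hr)).measurableSet

include μ

lemma measureReal_chartBall_pos {r : ℝ} (h0 : 0 < r)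
    (hr : Metric.closedBall (chartOrigin V G) r ⊆ chartDomain V G) :
    0 < μ.real (chartBall V G r) := by
  have h1 : IsOpen (invChart V G '' Metric.ball (chartOrigin V G) r) :=
    (chartAt V (1 : G)).symm.isOpen_image_of_subset_source Metric.isOpen_ball
      (Metric.ball_subset_closedBall.trans hr)
  have h2 : 0 < μ (invChart V G '' Metric.ball (chartOrigin V G) r) :=
    h1.measure_pos μ ⟨_, mem_image_of_mem _ (Metric.mem_ball_self h0)⟩
  exact ENNReal.toReal_pos (h2.trans_le (measure_mono (image_mono Metric.ball_subset_closedBall))).ne'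
    (measure_ne_top μ _)

variable (V) in
/-- Haar measure is doubling on small chart balls around the identity. -/
lemma exists_measureReal_chartBall_le :
    ∃ (N : ℕ) (r : ℝ), 0 < r ∧ Metric.closedBall (chartOrigin V G) r ⊆ chartDomain V G ∧
      ∀ ρ, 0 < ρ → ρ ≤ r → μ.real (chartBall V G ρ) ≤ N * μ.real (chartBall V G (ρ / 2)) := by
  have : ProperSpace V := FiniteDimensional.proper_real V
  obtain ⟨C, r, hC, hr, hdom, hlip⟩ := exists_chart_lipschitz V G
  -- A cover of the unit ball of `V` by balls of radius `1/(2C)`, scaled by `ρ`, yields left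
  -- translates of the ball of radius `ρ/2`; their number does not depend on `ρ`.
  obtain ⟨t, ht, hfin, hcov⟩ := (isCompact_closedBall (0 : V) 1).finite_cover_balls
    (e := 1 / (2 * C)) (by positivity)
  lift t to Finset V using hfin
  refine ⟨t.card, r, hr, hdom, fun ρ hρ hρr => ?_⟩
  set o := chartOrigin V G with ho
  have hball : ∀ x ∈ Metric.closedBall (0 : V) 1, o + ρ • x ∈ Metric.closedBall o ρ := fun x hx => by
    rw [mem_closedBall_zero_iff] at hx
    rw [mem_closedBall_iff_norm, add_sub_cancel_left, norm_smul, Real.norm_of_nonneg hρ.le]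
    exact mul_le_of_le_one_right hρ.le hx
  have hsub : chartBall V G ρ ⊆
      ⋃ x ∈ t, (fun y => invChart V G (o + ρ • x) * y) '' chartBall V G (ρ / 2) := by
    rintro _ ⟨w, hw, rfl⟩
    have hw1 : ρ⁻¹ • (w - o) ∈ Metric.closedBall (0 : V) 1 := by
      rw [mem_closedBall_iff_norm] at hw
      rw [mem_closedBall_zero_iff, norm_smul, norm_inv, Real.norm_of_nonneg hρ.le]
      exact inv_mul_le_one_of_le₀ hw hρ.le
    obtain ⟨x, hx, hx'⟩ := mem_iUnion₂.1 (hcov hw1)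
    obtain ⟨z, -, hz, hz'⟩ := hlip (o + ρ • x)
      (Metric.closedBall_subset_closedBall hρr (hball x (ht hx))) w
      (Metric.closedBall_subset_closedBall hρr hw)
    refine mem_iUnion₂.2 ⟨x, hx, invChart V G z, ⟨z, ?_, rfl⟩, ?_⟩
    · rw [mem_closedBall_iff_norm]
      refine hz.trans ?_
      have h1 : w - (o + ρ • x) = ρ • (ρ⁻¹ • (w - o) - x) := by
        rw [smul_sub, smul_inv_smul₀ hρ.ne', sub_sub]
      rw [mem_ball_iff_norm] at hx'
      rw [h1, norm_smul, Real.norm_of_nonneg hρ.le]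
      calc C * (ρ * ‖ρ⁻¹ • (w - o) - x‖) ≤ C * (ρ * (1 / (2 * C))) := by gcongr
        _ = ρ / 2 := by field_simp
    · change invChart V G (o + ρ • x) * invChart V G z = _
      rw [← hz', mul_inv_cancel_left]
  have h2 : ∀ g : G, μ.real ((fun y => g * y) '' chartBall V G (ρ / 2)) =
      μ.real (chartBall V G (ρ / 2)) := fun g =>
    congrArg ENNReal.toReal (measure_smul μ g (chartBall V G (ρ / 2)))
  calc μ.real (chartBall V G ρ) ≤
        ∑ x ∈ t, μ.real ((fun y => invChart V G (o + ρ • x) * y) '' chartBall V G (ρ / 2)) :=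
        (measureReal_mono hsub (measure_ne_top μ _)).trans (measureReal_biUnion_finset_le _ _)
    _ = _ := by
        simp only [h2, Finset.sum_const, nsmul_eq_mul]

/-- With the identity matrix as coefficient, `trigTerm` is `d_ξ χ_ξ`, which has the value `d_ξ²` at
the identity. -/
lemma norm_sum_character_sub_le (S : Finset (UnitaryDual G)) (x : G) {a : ℝ}
    (ha : ∀ ξ ∈ S, ∀ j, ‖ξ.rep.column j x - ξ.rep.column j 1‖ ≤ a) :
    ‖∑ ξ ∈ S, trigTerm ξ.rep (fun i j => if i = j then (1 : ℂ) else 0) x -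
      ∑ ξ ∈ S, (ξ.rep.dim : ℂ) ^ 2‖ ≤ a * ∑ ξ ∈ S, (ξ.rep.dim : ℝ) ^ 2 := by
  rw [← Finset.sum_sub_distrib, Finset.mul_sum]
  refine (norm_sum_le _ _).trans (Finset.sum_le_sum fun ξ hξ => ?_)
  have h : trigTerm ξ.rep (fun i j => if i = j then (1 : ℂ) else 0) x - (ξ.rep.dim : ℂ) ^ 2 =
      ξ.rep.dim * ∑ j, (ξ.rep.coeff j j x - 1) := by
    simp [trigTerm, Finset.sum_sub_distrib, mul_sub, sq]
  rw [h, norm_mul, Complex.norm_natCast]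
  calc (ξ.rep.dim : ℝ) * ‖∑ j, (ξ.rep.coeff j j x - 1)‖ ≤
        ξ.rep.dim * ∑ j : Fin ξ.rep.dim, a :=
        mul_le_mul_of_nonneg_left ((norm_sum_le _ _).trans (Finset.sum_le_sum fun j _ =>
          (ξ.rep.norm_coeff_sub_le j x).trans (ha ξ hξ j))) (Nat.cast_nonneg _)
    _ = _ := by
        rw [Finset.sum_const, Finset.card_univ, Fintype.card_fin, nsmul_eq_mul]
        ring

/-- The function `∑ d_ξ χ_ξ` has squared `L²` norm `N = ∑ d_ξ²` but modulus at least `N/2` on `U`;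
hence `(N/2)² μ(U) ≤ N`. -/
lemma sum_dim_sq_mul_measureReal_le (S : Finset (UnitaryDual G)) {U : Set G}
    (hU : MeasurableSet U)
    (ha : ∀ ξ ∈ S, ∀ j, ∀ x ∈ U, ‖ξ.rep.column j x - ξ.rep.column j 1‖ ≤ 1 / 2) :
    (∑ ξ ∈ S, (ξ.rep.dim : ℝ) ^ 2) * μ.real U ≤ 4 := by
  set N := ∑ ξ ∈ S, (ξ.rep.dim : ℝ) ^ 2 with hN
  have hN0 : 0 ≤ N := Finset.sum_nonneg fun _ _ => sq_nonneg _
  set c : Coeffs G ℂ := fun ξ i j => if i = j then 1 else 0 with hc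
  have h1 := integral_norm_sum_trigTerm_sq μ c S
  have h2 : ∑ ξ ∈ S, ξ.rep.dim * hsSq (c ξ) = N := by
    refine Finset.sum_congr rfl fun ξ _ => ?_
    simp [hsSq, hc, sq, apply_ite norm]
  have hcont : Continuous fun x => ∑ ξ ∈ S, trigTerm ξ.rep (c ξ) x :=
    continuous_finsetSum _ fun ξ _ => continuous_trigTerm _ _
  have h3 : ∀ x ∈ U, N / 2 ≤ ‖∑ ξ ∈ S, trigTerm ξ.rep (c ξ) x‖ := fun x hx => by
    have h4 := norm_sum_character_sub_le μ S x fun ξ hξ j => ha ξ hξ j x hx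
    have h5 : ‖∑ ξ ∈ S, (ξ.rep.dim : ℂ) ^ 2‖ = N := by
      have : ∑ ξ ∈ S, (ξ.rep.dim : ℂ) ^ 2 = ((N : ℝ) : ℂ) := by simp [hN]
      rw [this, Complex.norm_real, Real.norm_of_nonneg hN0]
    have h6 := norm_le_norm_add_norm_sub (∑ ξ ∈ S, trigTerm ξ.rep (c ξ) x)
      (∑ ξ ∈ S, (ξ.rep.dim : ℂ) ^ 2)
    rw [h5] at h6
    have h7 : N ≤ ‖∑ ξ ∈ S, trigTerm ξ.rep (c ξ) x‖ + 1 / 2 * N := h6.trans (add_le_add_right h4 _)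
    linarith
  have h8 : (N / 2) ^ 2 * μ.real U ≤ N := by
    have hint := integrable_of_continuous μ (hcont.norm.pow 2)
    calc (N / 2) ^ 2 * μ.real U ≤ ∫ x in U, ‖∑ ξ ∈ S, trigTerm ξ.rep (c ξ) x‖ ^ 2 ∂μ :=
          setIntegral_ge_of_const_le_real hU (measure_ne_top μ _)
            (fun x hx => pow_le_pow_left₀ (by positivity) (h3 x hx) 2) hint.integrableOn
      _ ≤ ∫ x, ‖∑ ξ ∈ S, trigTerm ξ.rep (c ξ) x‖ ^ 2 ∂μ :=
          setIntegral_le_integral hint (Eventually.of_forall fun x => sq_nonneg _)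
      _ = N := by rw [h1, h2]
  rcases hN0.eq_or_lt with h0 | h0
  · rw [← h0, zero_mul]
    exact zero_le_four
  · refine le_of_mul_le_mul_left ?_ h0
    calc N * (N * μ.real U) = 4 * ((N / 2) ^ 2 * μ.real U) := by ring
      _ ≤ 4 * N := by gcongr
      _ = N * 4 := mul_comm _ _

/-- The number of representations of bounded weight, counted with the square of their dimensions,
grows at most polynomially. -/
theorem exists_sum_dim_sq_le {B : LinearMap.BilinForm ℝ (GroupLieAlgebra 𝓘(ℝ, V) G)}
    (hB : IsBiInvariant B) {Y : Module.Basis (Fin n) ℝ (GroupLieAlgebra 𝓘(ℝ, V) G)}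
    (hY : ∀ i j, B (Y i) (Y j) = if i = j then 1 else 0) :
    ∃ C M : ℝ, 0 < C ∧ 1 ≤ M ∧ ∀ (k : ℕ) (S : Finset (UnitaryDual G)),
      (∀ ξ ∈ S, ξ.rep.weight Y ≤ 2 ^ k) → ∑ ξ ∈ S, (ξ.rep.dim : ℝ) ^ 2 ≤ C * M ^ k := by
  obtain ⟨C, r₁, hC, hr₁, hdom, hcol⟩ := exists_norm_column_sub_le μ hB hY
  obtain ⟨N, r₂, hr₂, -, hdoub⟩ := exists_measureReal_chartBall_le V μ
  -- On the ball of radius `r / 2^k` a representation of weight at most `2^k` then differs from its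
  -- value at the identity by at most `1/2`, columnwise.
  set r := min (min r₁ r₂) (1 / (2 * C)) with hr
  have hr0 : 0 < r := by positivity
  have hrr₁ : r ≤ r₁ := (min_le_left _ _).trans (min_le_left _ _)
  have hrr₂ : r ≤ r₂ := (min_le_left _ _).trans (min_le_right _ _)
  set M : ℝ := max 1 N with hM
  have hM0 : 0 < M := by positivity
  have hdom' : ∀ k : ℕ, Metric.closedBall (chartOrigin V G) (r / 2 ^ k) ⊆ chartDomain V G := fun k =>
    (Metric.closedBall_subset_closedBall
      ((div_le_self hr0.le (one_le_pow₀ one_le_two)).trans hrr₁)).trans hdom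
  -- The doubling inequality applied `k` times.
  have hvol : ∀ k : ℕ, μ.real (chartBall V G r) ≤ M ^ k * μ.real (chartBall V G (r / 2 ^ k)) := by
    intro k
    induction k with
    | zero => simp
    | succ k ih =>
      have h1 := hdoub (r / 2 ^ k) (by positivity)
        ((div_le_self hr0.le (one_le_pow₀ one_le_two)).trans hrr₂)
      rw [div_div, ← pow_succ] at h1
      calc _ ≤ M ^ k * μ.real (chartBall V G (r / 2 ^ k)) := ih
        _ ≤ M ^ k * (M * μ.real (chartBall V G (r / 2 ^ (k + 1)))) := by
            gcongr
            exact h1.trans (mul_le_mul_of_nonneg_right (le_max_right _ _) measureReal_nonneg)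
        _ = _ := by ring
  have hpos : 0 < μ.real (chartBall V G r) := by
    have := measureReal_chartBall_pos (V := V) (G := G) μ (r := r) hr0 (by simpa using hdom' 0)
    exact this
  refine ⟨4 / μ.real (chartBall V G r), M, by positivity, le_max_left _ _, fun k S hS => ?_⟩
  have h1 := sum_dim_sq_mul_measureReal_le μ S (measurableSet_chartBall (hdom' k))
    (fun ξ hξ j x hx => by
      obtain ⟨v, hv, rfl⟩ := hx
      have hk : r / 2 ^ k ≤ r₁ := (div_le_self hr0.le (one_le_pow₀ one_le_two)).trans hrr₁
      refine (hcol ξ.rep j v (Metric.closedBall_subset_closedBall hk hv)).trans ?_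
      rw [mem_closedBall_iff_norm] at hv
      have hw := ξ.rep.weight_pos Y
      calc C * ξ.rep.weight Y * ‖v - chartOrigin V G‖ ≤ C * 2 ^ k * (1 / (2 * C) / 2 ^ k) := by
            gcongr
            · exact hS ξ hξ
            · refine hv.trans ?_
              gcongr
              exact min_le_right _ _
        _ = 1 / 2 := by field_simp)
  rw [div_mul_eq_mul_div, le_div_iff₀ hpos]
  calc _ ≤ (∑ ξ ∈ S, (ξ.rep.dim : ℝ) ^ 2) * (M ^ k * μ.real (chartBall V G (r / 2 ^ k))) :=
        mul_le_mul_of_nonneg_left (hvol k) (Finset.sum_nonneg fun _ _ => sq_nonneg _)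
    _ = M ^ k * ((∑ ξ ∈ S, (ξ.rep.dim : ℝ) ^ 2) * μ.real (chartBall V G (r / 2 ^ k))) := by ring
    _ ≤ M ^ k * 4 := by gcongr
    _ = 4 * M ^ k := mul_comm _ _

/-- The sum of `d² ⟨ξ⟩^{-p}` over the unitary dual converges for large `p`. -/
theorem exists_summable_dim_sq_div {B : LinearMap.BilinForm ℝ (GroupLieAlgebra 𝓘(ℝ, V) G)}
    (hB : IsBiInvariant B) {Y : Module.Basis (Fin n) ℝ (GroupLieAlgebra 𝓘(ℝ, V) G)}
    (hY : ∀ i j, B (Y i) (Y j) = if i = j then 1 else 0) :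
    ∃ p : ℕ, Summable fun ξ : UnitaryDual G => (ξ.rep.dim : ℝ) ^ 2 / ξ.rep.weight Y ^ p := by
  obtain ⟨C, M, hC, hM, h⟩ := exists_sum_dim_sq_le μ hB hY
  -- With `2^p > 2M`, the shell `2^j ≤ ⟨ξ⟩ < 2^(j+1)` contributes at most `C M^(j+1) / (2M)^j = C M
  -- 2^{-j}`.
  obtain ⟨p, hp⟩ := pow_unbounded_of_one_lt (2 * M) one_lt_two
  refine ⟨p, summable_of_sum_le (c := C * M * 2) (fun ξ => ?_) fun S => ?_⟩
  · have := ξ.rep.weight_pos Y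
    positivity
  -- the shell of a representation
  have hk : ∀ ξ : UnitaryDual G, ∃ k : ℕ, 2 ^ k ≤ ξ.rep.weight Y ∧ ξ.rep.weight Y < 2 ^ (k + 1) :=
    fun ξ => exists_nat_pow_near (ξ.rep.one_le_weight Y) one_lt_two
  choose k hk1 hk2 using hk
  have hS : ∀ ξ ∈ S, k ξ ∈ Finset.range (S.sup k + 1) := fun ξ hξ =>
    Finset.mem_range.2 (Nat.lt_succ_of_le (Finset.le_sup hξ))
  rw [← Finset.sum_fiberwise_of_maps_to hS]
  have hshell : ∀ j, ∑ ξ ∈ S with k ξ = j, (ξ.rep.dim : ℝ) ^ 2 / ξ.rep.weight Y ^ p ≤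
      C * M * (1 / 2) ^ j := fun j => by
    have h1 := h (j + 1) (S.filter fun ξ => k ξ = j) fun ξ hξ => by
      rw [← (Finset.mem_filter.1 hξ).2]
      exact (hk2 ξ).le
    calc _ ≤ ∑ ξ ∈ S with k ξ = j, (ξ.rep.dim : ℝ) ^ 2 / (2 ^ j) ^ p := by
          refine Finset.sum_le_sum fun ξ hξ => ?_
          gcongr
          rw [← (Finset.mem_filter.1 hξ).2]
          exact hk1 ξ
      _ = (∑ ξ ∈ S with k ξ = j, (ξ.rep.dim : ℝ) ^ 2) / (2 ^ p) ^ j := by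
          rw [Finset.sum_div, ← pow_mul, ← pow_mul, mul_comm]
      _ ≤ C * M ^ (j + 1) / (2 * M) ^ j := by gcongr
      _ = _ := by
          rw [mul_pow, pow_succ, div_pow, one_pow]
          field_simp
  calc _ ≤ ∑ j ∈ Finset.range (S.sup k + 1), C * M * (1 / 2) ^ j :=
        Finset.sum_le_sum fun j _ => hshell j
    _ = C * M * ∑ j ∈ Finset.range (S.sup k + 1), (1 / 2) ^ j := (Finset.mul_sum _ _ _).symm
    _ ≤ C * M * 2 := by
        gcongr
        exact (summable_geometric_two.sum_le_tsum _ fun _ _ => by positivity).trans_eq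
          tsum_geometric_two

end Counting

/-! ### Products of matrix coefficients -/

section Products

variable {V : Type*} [NormedAddCommGroup V] [NormedSpace ℝ V]
  {G : Type*} [TopologicalSpace G] [ChartedSpace V G] [Group G] [LieGroup 𝓘(ℝ, V) ∞ G]
  [CompactSpace G] [T2Space G] [MeasurableSpace G] [BorelSpace G] [FiniteDimensional ℝ V]
  [SecondCountableTopology G] [IsTopologicalGroup G] {n : ℕ}
  (μ : Measure G) [μ.IsHaarMeasure] [IsProbabilityMeasure μ]

include μ

lemma sum_norm_sum_star_derived_mul_sq
    {B : LinearMap.BilinForm ℝ (GroupLieAlgebra 𝓘(ℝ, V) G)}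
    (hB : IsBiInvariant B) {Y : Module.Basis (Fin n) ℝ (GroupLieAlgebra 𝓘(ℝ, V) G)}
    (hY : ∀ i j, B (Y i) (Y j) = if i = j then 1 else 0) (ξ : UnitaryIrrep G)
    (w : Fin ξ.dim → ℂ) :
    ∑ i, ∑ r, ‖∑ s, star (ξ.derived (Y i) s r) * w s‖ ^ 2 = ξ.casimir Y * ∑ r, ‖w r‖ ^ 2 := by
  refine Eq.trans ?_ (sum_vecSq_matAct_derived μ ξ hB hY w)
  refine Finset.sum_congr rfl fun i _ => Finset.sum_congr rfl fun r _ => ?_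
  simp only [star_derived μ, neg_mul, Finset.sum_neg_distrib, norm_neg]
  rfl

lemma sum_norm_sum_derived_mul_sq
    {B : LinearMap.BilinForm ℝ (GroupLieAlgebra 𝓘(ℝ, V) G)}
    (hB : IsBiInvariant B) {Y : Module.Basis (Fin n) ℝ (GroupLieAlgebra 𝓘(ℝ, V) G)}
    (hY : ∀ i j, B (Y i) (Y j) = if i = j then 1 else 0) (ξ : UnitaryIrrep G)
    (w : Fin ξ.dim → ℂ) :
    ∑ i, ∑ r, ‖∑ s, ξ.derived (Y i) s r * w s‖ ^ 2 = ξ.casimir Y * ∑ r, ‖w r‖ ^ 2 := by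
  have h := sum_norm_sum_star_derived_mul_sq μ hB hY ξ fun s => star (w s)
  simp only [norm_star] at h
  rw [← h]
  refine Finset.sum_congr rfl fun i _ => Finset.sum_congr rfl fun r _ => ?_
  rw [← norm_star]
  simp only [star_sum, star_mul']

/-- The invariance of a triple product integral. -/
lemma sum_derived_mul_integral (ζ η ξ : UnitaryIrrep G) (X : GroupLieAlgebra 𝓘(ℝ, V) G)
    (a p : Fin ζ.dim) (b q : Fin η.dim) (c r : Fin ξ.dim) :
    (∑ s, star (ζ.derived X s p) *
        ∫ x, star (ζ.coeff a s x) * (η.coeff b q x * ξ.coeff c r x) ∂μ) +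
      (∑ s, η.derived X s q * ∫ x, star (ζ.coeff a p x) * (η.coeff b s x * ξ.coeff c r x) ∂μ) +
      (∑ s, ξ.derived X s r *
        ∫ x, star (ζ.coeff a p x) * (η.coeff b q x * ξ.coeff c s x) ∂μ) = 0 := by
  have hζ := contMDiff_star_coeff (V := V) μ ζ
  have hη := contMDiff_coeff (V := V) μ η
  have hξ := contMDiff_coeff (V := V) μ ξ
  have hI : ∀ p q r, Integrable
      (fun x => star (ζ.coeff a p x) * (η.coeff b q x * ξ.coeff c r x)) μ := fun p q r =>
    integrable_of_continuous μ ((hζ a p).continuous.mul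
      ((hη b q).continuous.mul (hξ c r).continuous))
  -- The integral of the derivative of the triple product vanishes; the product rule gives the three
  -- sums.
  have h := integral_lieDeriv μ (contMDiff_smul_complex (hζ a p)
    (contMDiff_smul_complex (hη b q) (hξ c r))) X
  simp only [lieDeriv_smul (hζ a p) (contMDiff_smul_complex (hη b q) (hξ c r)),
    lieDeriv_smul (hη b q) (hξ c r), lieDeriv_star_coeff μ, lieDeriv_coeff μ] at h
  rw [← h]
  simp only [← integral_const_mul]
  rw [← integral_finsetSum _ fun s _ => (hI s q r).const_mul _,
    ← integral_finsetSum _ fun s _ => (hI p s r).const_mul _,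
    ← integral_finsetSum _ fun s _ => (hI p q s).const_mul _]
  have h1 : Integrable (fun x => ∑ s, star (ζ.derived X s p) *
      (star (ζ.coeff a s x) * (η.coeff b q x * ξ.coeff c r x))) μ :=
    integrable_finsetSum _ fun s _ => (hI s q r).const_mul _
  have h2 : Integrable (fun x => ∑ s, η.derived X s q *
      (star (ζ.coeff a p x) * (η.coeff b s x * ξ.coeff c r x))) μ :=
    integrable_finsetSum _ fun s _ => (hI p s r).const_mul _
  have h3 : Integrable (fun x => ∑ s, ξ.derived X s r *
      (star (ζ.coeff a p x) * (η.coeff b q x * ξ.coeff c s x))) μ :=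
    integrable_finsetSum _ fun s _ => (hI p q s).const_mul _
  have h12 : Integrable (fun x => (∑ s, star (ζ.derived X s p) *
      (star (ζ.coeff a s x) * (η.coeff b q x * ξ.coeff c r x))) + ∑ s, η.derived X s q *
      (star (ζ.coeff a p x) * (η.coeff b s x * ξ.coeff c r x))) μ := h1.add h2
  rw [← integral_add h1 h2, ← integral_add h12 h3]
  refine integral_congr_ae (Filter.Eventually.of_forall fun x => ?_)
  simp only [star_sum, star_mul', smul_eq_mul, mul_add, Finset.sum_mul, Finset.mul_sum,
    ← add_assoc]
  congr 1
  · congr 1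
    · exact Finset.sum_congr rfl fun s _ => by ring
    · exact Finset.sum_congr rfl fun s _ => by ring
  · exact Finset.sum_congr rfl fun s _ => by ring

/-- As functions of `p, q, r`, the triple integrals form an invariant vector of `ζ̄ ⊗ η ⊗ ξ`: the
actions `P`, `Q`, `R` of each `Y i` on the three factors add up to zero. Summed over `i`, their
squared norms are the three Casimir numbers times the squared norm `N` of the vector, and `‖P‖² ≤
2(‖Q‖² + ‖R‖²)`, likewise with `R` singled out. The assumed nonzero integral ensures `N > 0`. -/
lemma casimir_triple_le {B : LinearMap.BilinForm ℝ (GroupLieAlgebra 𝓘(ℝ, V) G)}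
    (hB : IsBiInvariant B) {Y : Module.Basis (Fin n) ℝ (GroupLieAlgebra 𝓘(ℝ, V) G)}
    (hY : ∀ i j, B (Y i) (Y j) = if i = j then 1 else 0) {ζ η ξ : UnitaryIrrep G}
    {a p : Fin ζ.dim} {b q : Fin η.dim} {c r : Fin ξ.dim}
    (h : ∫ x, star (ζ.coeff a p x) * (η.coeff b q x * ξ.coeff c r x) ∂μ ≠ 0) :
    ζ.casimir Y ≤ 2 * (η.casimir Y + ξ.casimir Y) ∧
      ξ.casimir Y ≤ 2 * (ζ.casimir Y + η.casimir Y) := by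
  set v : Fin ζ.dim → Fin η.dim → Fin ξ.dim → ℂ := fun p q r =>
    ∫ x, star (ζ.coeff a p x) * (η.coeff b q x * ξ.coeff c r x) ∂μ with hv
  set N : ℝ := ∑ p, ∑ q, ∑ r, ‖v p q r‖ ^ 2 with hN
  have hNpos : 0 < N := by
    refine Finset.sum_pos' (fun _ _ => by positivity) ⟨p, Finset.mem_univ _, ?_⟩
    refine Finset.sum_pos' (fun _ _ => by positivity) ⟨q, Finset.mem_univ _, ?_⟩
    refine Finset.sum_pos' (fun _ _ => by positivity) ⟨r, Finset.mem_univ _, ?_⟩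
    exact pow_pos (norm_pos_iff.2 h) 2
  set P : Fin n → Fin ζ.dim → Fin η.dim → Fin ξ.dim → ℂ := fun i p q r =>
    ∑ s, star (ζ.derived (Y i) s p) * v s q r with hP
  set Q : Fin n → Fin ζ.dim → Fin η.dim → Fin ξ.dim → ℂ := fun i p q r =>
    ∑ s, η.derived (Y i) s q * v p s r with hQ
  set R : Fin n → Fin ζ.dim → Fin η.dim → Fin ξ.dim → ℂ := fun i p q r =>
    ∑ s, ξ.derived (Y i) s r * v p q s with hR
  have h0 : ∀ i p q r, P i p q r + Q i p q r + R i p q r = 0 := fun i p q r =>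
    sum_derived_mul_integral μ ζ η ξ (Y i) a p b q c r
  have hPN : ∑ i, ∑ p, ∑ q, ∑ r, ‖P i p q r‖ ^ 2 = ζ.casimir Y * N := by
    have h1 := fun q r => sum_norm_sum_star_derived_mul_sq μ hB hY ζ fun p => v p q r
    calc _ = ∑ q, ∑ r, ∑ i, ∑ p, ‖P i p q r‖ ^ 2 := by
          rw [Finset.sum_congr rfl fun i _ => Finset.sum_comm, Finset.sum_comm]
          refine Finset.sum_congr rfl fun q _ => ?_
          rw [Finset.sum_congr rfl fun i _ => Finset.sum_comm, Finset.sum_comm]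
      _ = ∑ q, ∑ r, ζ.casimir Y * ∑ p, ‖v p q r‖ ^ 2 :=
          Finset.sum_congr rfl fun q _ => Finset.sum_congr rfl fun r _ => h1 q r
      _ = _ := by
          simp only [← Finset.mul_sum]
          rw [hN, Finset.sum_comm (f := fun p q => ∑ r, ‖v p q r‖ ^ 2)]
          congr 1
          exact Finset.sum_congr rfl fun q _ => Finset.sum_comm
  have hQN : ∑ i, ∑ p, ∑ q, ∑ r, ‖Q i p q r‖ ^ 2 = η.casimir Y * N := by
    have h1 := fun p r => sum_norm_sum_derived_mul_sq μ hB hY η fun q => v p q r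
    calc _ = ∑ p, ∑ r, ∑ i, ∑ q, ‖Q i p q r‖ ^ 2 := by
          rw [Finset.sum_comm]
          refine Finset.sum_congr rfl fun p _ => ?_
          rw [Finset.sum_congr rfl fun i _ => Finset.sum_comm, Finset.sum_comm]
      _ = ∑ p, ∑ r, η.casimir Y * ∑ q, ‖v p q r‖ ^ 2 :=
          Finset.sum_congr rfl fun p _ => Finset.sum_congr rfl fun r _ => h1 p r
      _ = _ := by
          simp only [← Finset.mul_sum]
          congr 1
          exact Finset.sum_congr rfl fun p _ => Finset.sum_comm
  have hRN : ∑ i, ∑ p, ∑ q, ∑ r, ‖R i p q r‖ ^ 2 = ξ.casimir Y * N := by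
    have h1 := fun p q => sum_norm_sum_derived_mul_sq μ hB hY ξ fun r => v p q r
    calc _ = ∑ p, ∑ q, ∑ i, ∑ r, ‖R i p q r‖ ^ 2 := by
          rw [Finset.sum_comm]
          refine Finset.sum_congr rfl fun p _ => ?_
          rw [Finset.sum_comm]
      _ = ∑ p, ∑ q, ξ.casimir Y * ∑ r, ‖v p q r‖ ^ 2 :=
          Finset.sum_congr rfl fun p _ => Finset.sum_congr rfl fun q _ => h1 p q
      _ = _ := by simp only [← Finset.mul_sum]; rfl
  have key : ∀ {x y z : ℂ}, x + y + z = 0 → ‖x‖ ^ 2 ≤ 2 * (‖y‖ ^ 2 + ‖z‖ ^ 2) := by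
    intro x y z hxyz
    have h1 : x = -(y + z) := by linear_combination hxyz
    rw [h1, norm_neg]
    calc ‖y + z‖ ^ 2 ≤ (‖y‖ + ‖z‖) ^ 2 := pow_le_pow_left₀ (norm_nonneg _) (norm_add_le _ _) 2
      _ ≤ _ := add_sq_le
  have hsum : ∀ {P Q R : Fin n → Fin ζ.dim → Fin η.dim → Fin ξ.dim → ℂ},
      (∀ i p q r, P i p q r + Q i p q r + R i p q r = 0) →
      ∑ i, ∑ p, ∑ q, ∑ r, ‖P i p q r‖ ^ 2 ≤ 2 * (∑ i, ∑ p, ∑ q, ∑ r, ‖Q i p q r‖ ^ 2 +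
        ∑ i, ∑ p, ∑ q, ∑ r, ‖R i p q r‖ ^ 2) := by
    intro P Q R h
    simp only [← Finset.sum_add_distrib, Finset.mul_sum]
    exact Finset.sum_le_sum fun i _ => Finset.sum_le_sum fun p _ => Finset.sum_le_sum fun q _ =>
      Finset.sum_le_sum fun r _ => key (h i p q r)
  constructor
  · have h1 := hsum h0
    rw [hPN, hQN, hRN, ← add_mul, ← mul_assoc] at h1
    exact le_of_mul_le_mul_right h1 hNpos
  · have h1 := hsum (P := R) (Q := P) (R := Q) fun i p q r => by
      rw [← h0 i p q r]
      ring
    rw [hPN, hQN, hRN, ← add_mul, ← mul_assoc] at h1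
    exact le_of_mul_le_mul_right h1 hNpos

/-- If the product of coefficients of `η` and `ξ` contains `ζ`, then the weights of `ζ` and `ξ`
differ at most by a factor `2⟨η⟩`. -/
theorem weight_triple_le {B : LinearMap.BilinForm ℝ (GroupLieAlgebra 𝓘(ℝ, V) G)}
    (hB : IsBiInvariant B) {Y : Module.Basis (Fin n) ℝ (GroupLieAlgebra 𝓘(ℝ, V) G)}
    (hY : ∀ i j, B (Y i) (Y j) = if i = j then 1 else 0) {ζ η ξ : UnitaryIrrep G}
    {a p : Fin ζ.dim} {b q : Fin η.dim} {c r : Fin ξ.dim}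
    (h : ∫ x, star (ζ.coeff a p x) * (η.coeff b q x * ξ.coeff c r x) ∂μ ≠ 0) :
    ζ.weight Y ≤ 2 * η.weight Y * ξ.weight Y ∧ ξ.weight Y ≤ 2 * η.weight Y * ζ.weight Y := by
  obtain ⟨h1, h2⟩ := casimir_triple_le μ hB hY h
  have hζ := ζ.weight_pos Y
  have hη := η.weight_pos Y
  have hξ := ξ.weight_pos Y
  have cζ := ζ.casimir_nonneg Y
  have cη := η.casimir_nonneg Y
  have cξ := ξ.casimir_nonneg Y
  constructor
  -- After squaring, the claim follows from `1 + 2(c_η + c_ξ) ≤ 4(1 + c_η)(1 + c_ξ)`.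
  · refine le_of_sq_le_sq ?_ (by positivity)
    rw [mul_pow, mul_pow, ζ.weight_sq, η.weight_sq, ξ.weight_sq]
    nlinarith [mul_nonneg cη cξ]
  · refine le_of_sq_le_sq ?_ (by positivity)
    rw [mul_pow, mul_pow, ζ.weight_sq, η.weight_sq, ξ.weight_sq]
    nlinarith [mul_nonneg cη cζ]

end Products

/-! ### Multiplication by a matrix coefficient on Sobolev spaces -/

/-- Comparability is assumed in both directions because the sign of `t` decides which one is used.
-/
lemma rpow_le_rpow_abs_mul {x y M : ℝ} (hx : 0 < x) (hy : 0 < y) (hM : 1 ≤ M) (hxy : x ≤ M * y)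
    (hyx : y ≤ M * x) (t : ℝ) : x ^ t ≤ M ^ |t| * y ^ t := by
  have hM0 : 0 < M := zero_lt_one.trans_le hM
  rcases le_total 0 t with ht | ht
  · rw [abs_of_nonneg ht, ← Real.mul_rpow hM0.le hy.le]
    exact Real.rpow_le_rpow hx.le hxy ht
  · rw [abs_of_nonpos ht]
    have h1 : (M * x) ^ t ≤ y ^ t := Real.rpow_le_rpow_of_nonpos hy hyx ht
    rw [Real.mul_rpow hM0.le hx.le] at h1
    calc x ^ t = M ^ (-t) * (M ^ t * x ^ t) := by
          rw [← mul_assoc, ← Real.rpow_add hM0, neg_add_cancel, Real.rpow_zero, one_mul]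
      _ ≤ _ := by gcongr

section SobolevWeight

variable {V : Type*} [NormedAddCommGroup V] [NormedSpace ℝ V]
  {G : Type*} [TopologicalSpace G] [ChartedSpace V G] [Group G] {n : ℕ}

/-- The Sobolev weight of a representation. -/
def sobolevWeight (Y : Fin n → GroupLieAlgebra 𝓘(ℝ, V) G) (t : ℝ) (ξ : UnitaryDual G) : ℝ :=
  ξ.rep.dim * (ξ.rep.weight Y ^ t) ^ 2

lemma sobolevWeight_nonneg (Y : Fin n → GroupLieAlgebra 𝓘(ℝ, V) G) (t : ℝ) (ξ : UnitaryDual G) :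
    0 ≤ sobolevWeight Y t ξ := mul_nonneg (Nat.cast_nonneg _) (sq_nonneg _)

lemma sobolevWeight_le {Y : Fin n → GroupLieAlgebra 𝓘(ℝ, V) G} {t : ℝ} {ξ : UnitaryDual G}
    {x M : ℝ} (hx : 0 < x) (hM : 1 ≤ M) (h1 : ξ.rep.weight Y ≤ M * x)
    (h2 : x ≤ M * ξ.rep.weight Y) :
    sobolevWeight Y t ξ ≤ (M ^ |t|) ^ 2 * (x ^ t) ^ 2 * ξ.rep.dim ∧
      ξ.rep.dim * (x ^ t) ^ 2 ≤ (M ^ |t|) ^ 2 * sobolevWeight Y t ξ := by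
  have hw := ξ.rep.weight_pos Y
  constructor
  · rw [sobolevWeight, mul_comm, ← mul_pow]
    gcongr
    exact rpow_le_rpow_abs_mul hw hx hM h1 h2 t
  · rw [sobolevWeight, mul_left_comm, ← mul_pow]
    gcongr
    exact rpow_le_rpow_abs_mul hx hw hM h2 h1 t

end SobolevWeight

section Multiplication

variable {V : Type*} [NormedAddCommGroup V] [NormedSpace ℝ V]
  {G : Type*} [TopologicalSpace G] [ChartedSpace V G] [Group G] [LieGroup 𝓘(ℝ, V) ∞ G]
  [CompactSpace G] [T2Space G] [MeasurableSpace G] [BorelSpace G] [FiniteDimensional ℝ V]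
  [SecondCountableTopology G] [IsTopologicalGroup G] {n : ℕ}
  (μ : Measure G) [μ.IsHaarMeasure] [IsProbabilityMeasure μ]
  {W : Type*} [NormedAddCommGroup W] [InnerProductSpace ℂ W]

lemma fourierCoeff_coeff_smul_trigTerm [CompleteSpace W] (ζ η ξ : UnitaryIrrep G)
    (a b : Fin η.dim) (c : Fin ξ.dim → Fin ξ.dim → W)
    (h : ∀ p q i j, ∫ x, star (ζ.coeff p q x) * (η.coeff a b x * ξ.coeff i j x) ∂μ = 0) :
    fourierCoeff μ ζ (fun x => η.coeff a b x • trigTerm ξ c x) = 0 := by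
  ext p q
  have h1 : (fun x => η.coeff a b x • trigTerm ξ c x) = fun x => (ξ.dim : ℂ) • ∑ i, ∑ j,
      (η.coeff a b x * ξ.coeff i j x) • c j i := funext fun x => by
    rw [trigTerm, smul_comm]
    simp only [Finset.smul_sum, smul_smul]
  have hc : ∀ i j, Continuous fun x => (η.coeff a b x * ξ.coeff i j x) • c j i := fun i j =>
    ((η.continuous_coeff a b).mul (ξ.continuous_coeff i j)).smul continuous_const
  rw [h1, fourierCoeff_smul, fourierCoeff_sum μ ζ _
    fun i => continuous_finsetSum _ fun j _ => hc i j]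
  simp only [fourierCoeff_sum μ ζ _ (hc _), Pi.smul_apply, Finset.sum_apply]
  have h2 : ∀ i j, fourierCoeff μ ζ (fun x => (η.coeff a b x * ξ.coeff i j x) • c j i) p q = 0 := by
    intro i j
    rw [fourierCoeff]
    simp only [smul_smul]
    rw [integral_smul_const, h, zero_smul]
  simp [h2]

/-- Multiplication by a matrix coefficient of `η` is bounded on Sobolev spaces, with a bound which
is a power of `⟨η⟩`. -/
theorem sum_sobolevWeight_mul_hsSq_le [CompleteSpace W]
    {B : LinearMap.BilinForm ℝ (GroupLieAlgebra 𝓘(ℝ, V) G)}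
    (hB : IsBiInvariant B) {Y : Module.Basis (Fin n) ℝ (GroupLieAlgebra 𝓘(ℝ, V) G)}
    (hY : ∀ i j, B (Y i) (Y j) = if i = j then 1 else 0) (t : ℝ) (η : UnitaryIrrep G)
    (a b : Fin η.dim) (c : Coeffs G W) (S Z : Finset (UnitaryDual G)) :
    ∑ ζ ∈ Z, sobolevWeight Y t ζ * hsSq (fourierCoeff μ ζ.rep fun x =>
        η.coeff a b x • ∑ ξ ∈ S, trigTerm ξ.rep (c ξ) x) ≤
      3 * ((((2 * η.weight Y) ^ 2) ^ |t|) ^ 2) ^ 2 *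
        ∑ ξ ∈ S, sobolevWeight Y t ξ * hsSq (c ξ) := by
  -- The ratio of the shells is the factor in `weight_triple_le`, so a product with `η_{ab}` moves a
  -- class by at most one shell. The index `k` below numbers the shells.
  set R : ℝ := 2 * η.weight Y with hR
  have hR1 : 1 < R := by
    have := η.one_le_weight Y
    linarith
  have hR0 : 0 < R := zero_lt_one.trans hR1
  -- A weight in the shell `l` or a neighbouring one agrees with `R ^ l` up to the factor `R ^ 2`.
  set M : ℝ := R ^ 2 with hM
  have hM1 : 1 ≤ M := one_le_pow₀ hR1.le
  set K : ℝ := (M ^ |t|) ^ 2 with hK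
  have hK0 : 0 ≤ K := sq_nonneg _
  have hk : ∀ ξ : UnitaryDual G, ∃ k : ℕ, R ^ k ≤ ξ.rep.weight Y ∧ ξ.rep.weight Y < R ^ (k + 1) :=
    fun ξ => exists_nat_pow_near (ξ.rep.one_le_weight Y) hR1
  choose k hk1 hk2 using hk
  have hcont : ∀ S' : Finset (UnitaryDual G),
      Continuous fun x => η.coeff a b x • ∑ ξ ∈ S', trigTerm ξ.rep (c ξ) x := fun S' =>
    (η.continuous_coeff a b).smul (continuous_finsetSum _ fun ξ _ => continuous_trigTerm _ _)
  have hterm : ∀ (S' : Finset (UnitaryDual G)) (ζ : UnitaryDual G),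
      fourierCoeff μ ζ.rep (fun x => η.coeff a b x • ∑ ξ ∈ S', trigTerm ξ.rep (c ξ) x) =
        ∑ ξ ∈ S', fourierCoeff μ ζ.rep fun x => η.coeff a b x • trigTerm ξ.rep (c ξ) x := by
    intro S' ζ
    simp only [Finset.smul_sum]
    exact fourierCoeff_sum μ _ _ fun ξ => (η.continuous_coeff a b).smul (continuous_trigTerm _ _)
  -- the part of `S` which contributes to a shell
  let N : ℕ → Finset (UnitaryDual G) := fun l => S.filter fun ξ => k ξ ≤ l + 1 ∧ l ≤ k ξ + 1
  have hloc : ∀ ζ, fourierCoeff μ ζ.rep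
        (fun x => η.coeff a b x • ∑ ξ ∈ S, trigTerm ξ.rep (c ξ) x) =
      fourierCoeff μ ζ.rep
        (fun x => η.coeff a b x • ∑ ξ ∈ N (k ζ), trigTerm ξ.rep (c ξ) x) := fun ζ => by
    rw [hterm, hterm]
    refine (Finset.sum_subset (Finset.filter_subset _ _) fun ξ hξ hξ' => ?_).symm
    refine fourierCoeff_coeff_smul_trigTerm μ _ _ _ _ _ _ fun p q i j => ?_
    by_contra h
    obtain ⟨h1, h2⟩ := weight_triple_le μ hB hY h
    refine hξ' (Finset.mem_filter.2 ⟨hξ, ?_, ?_⟩)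
    · have : R ^ k ξ < R ^ (k ζ + 2) := by
        calc R ^ k ξ ≤ ξ.rep.weight Y := hk1 ξ
          _ ≤ R * ζ.rep.weight Y := h2
          _ < R * R ^ (k ζ + 1) := by gcongr; exact hk2 ζ
          _ = _ := by ring
      have := (pow_lt_pow_iff_right₀ hR1).1 this
      omega
    · have : R ^ k ζ < R ^ (k ξ + 2) := by
        calc R ^ k ζ ≤ ζ.rep.weight Y := hk1 ζ
          _ ≤ R * ξ.rep.weight Y := h1
          _ < R * R ^ (k ξ + 1) := by gcongr; exact hk2 ξ
          _ = _ := by ring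
      have := (pow_lt_pow_iff_right₀ hR1).1 this
      omega
  -- Within a shell the Sobolev weight is almost constant, so plain `L²` boundedness of the
  -- multiplication, followed by Bessel's inequality, suffices.
  have hL2 : ∀ l, ∫ x, ‖η.coeff a b x • ∑ ξ ∈ N l, trigTerm ξ.rep (c ξ) x‖ ^ 2 ∂μ ≤
      ∑ ξ ∈ N l, ξ.rep.dim * hsSq (c ξ) := fun l => by
    rw [← integral_norm_sum_trigTerm_sq μ c]
    refine integral_mono (integrable_of_continuous μ ((hcont _).norm.pow 2))
      (integrable_of_continuous μ ((continuous_finsetSum _ fun ξ _ =>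
        continuous_trigTerm _ _).norm.pow 2)) fun x => ?_
    refine pow_le_pow_left₀ (norm_nonneg _) ?_ 2
    rw [norm_smul]
    exact mul_le_of_le_one_left (norm_nonneg _) (η.norm_coeff_le_one a b x)
  have hζ : ∀ ζ : UnitaryDual G, ζ.rep.weight Y ≤ M * R ^ k ζ ∧ R ^ k ζ ≤ M * ζ.rep.weight Y := by
    intro ζ
    refine ⟨(hk2 ζ).le.trans ?_, (hk1 ζ).trans (le_mul_of_one_le_left (ζ.rep.weight_pos Y).le hM1)⟩
    rw [hM, ← pow_add]
    exact pow_le_pow_right₀ hR1.le (by omega)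
  have hξ : ∀ l, ∀ ξ ∈ N l, ξ.rep.weight Y ≤ M * R ^ l ∧ R ^ l ≤ M * ξ.rep.weight Y := by
    intro l ξ hξ
    obtain ⟨-, h1, h2⟩ := Finset.mem_filter.1 hξ
    constructor
    · refine (hk2 ξ).le.trans ?_
      rw [hM, ← pow_add]
      exact pow_le_pow_right₀ hR1.le (by omega)
    · calc R ^ l ≤ R ^ (k ξ + 2) := pow_le_pow_right₀ hR1.le (by omega)
        _ = M * R ^ k ξ := by ring
        _ ≤ _ := by gcongr; exact hk1 ξ
  have hZ : ∀ ζ ∈ Z, k ζ ∈ Finset.range (Z.sup k + 1) := fun ζ hζ =>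
    Finset.mem_range.2 (Nat.lt_succ_of_le (Finset.le_sup hζ))
  rw [← Finset.sum_fiberwise_of_maps_to hZ]
  have hshell : ∀ l, ∑ ζ ∈ Z with k ζ = l, sobolevWeight Y t ζ * hsSq (fourierCoeff μ ζ.rep fun x =>
        η.coeff a b x • ∑ ξ ∈ S, trigTerm ξ.rep (c ξ) x) ≤
      K ^ 2 * ∑ ξ ∈ N l, sobolevWeight Y t ξ * hsSq (c ξ) := fun l => by
    calc _ ≤ ∑ ζ ∈ Z with k ζ = l, K * ((R ^ l) ^ t) ^ 2 * (ζ.rep.dim *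
            hsSq (fourierCoeff μ ζ.rep fun x =>
              η.coeff a b x • ∑ ξ ∈ N l, trigTerm ξ.rep (c ξ) x)) := by
          refine Finset.sum_le_sum fun ζ hζ' => ?_
          obtain rfl := (Finset.mem_filter.1 hζ').2
          rw [hloc, ← mul_assoc]
          exact mul_le_mul_of_nonneg_right
            (sobolevWeight_le (pow_pos hR0 _) hM1 (hζ ζ).1 (hζ ζ).2).1 (hsSq_nonneg _)
      _ ≤ K * ((R ^ l) ^ t) ^ 2 * ∑ ξ ∈ N l, ξ.rep.dim * hsSq (c ξ) := by
          rw [← Finset.mul_sum]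
          exact mul_le_mul_of_nonneg_left
            ((sum_hsSq_fourierCoeff_le μ (hcont _) _).trans (hL2 l)) (by positivity)
      _ = K * ∑ ξ ∈ N l, ξ.rep.dim * ((R ^ l) ^ t) ^ 2 * hsSq (c ξ) := by
          rw [mul_assoc, Finset.mul_sum]
          congr 1
          exact Finset.sum_congr rfl fun ξ _ => by ring
      _ ≤ K * ∑ ξ ∈ N l, K * sobolevWeight Y t ξ * hsSq (c ξ) := by
          refine mul_le_mul_of_nonneg_left (Finset.sum_le_sum fun ξ hξ' => ?_) hK0
          exact mul_le_mul_of_nonneg_right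
            (sobolevWeight_le (pow_pos hR0 _) hM1 (hξ l ξ hξ').1 (hξ l ξ hξ').2).2 (hsSq_nonneg _)
      _ = _ := by
          simp only [mul_assoc K, ← Finset.mul_sum]
          ring
  calc _ ≤ ∑ l ∈ Finset.range (Z.sup k + 1),
          K ^ 2 * ∑ ξ ∈ N l, sobolevWeight Y t ξ * hsSq (c ξ) :=
        Finset.sum_le_sum fun l _ => hshell l
    _ = K ^ 2 * ∑ ξ ∈ S, ∑ l ∈ Finset.range (Z.sup k + 1) with k ξ ≤ l + 1 ∧ l ≤ k ξ + 1,
          sobolevWeight Y t ξ * hsSq (c ξ) := by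
        rw [← Finset.mul_sum]
        simp only [N, Finset.sum_filter]
        rw [Finset.sum_comm]
    _ ≤ K ^ 2 * ∑ ξ ∈ S, 3 * (sobolevWeight Y t ξ * hsSq (c ξ)) := by
        refine mul_le_mul_of_nonneg_left (Finset.sum_le_sum fun ξ _ => ?_) (sq_nonneg K)
        rw [Finset.sum_const, nsmul_eq_mul]
        refine mul_le_mul_of_nonneg_right ?_
          (mul_nonneg (sobolevWeight_nonneg _ _ _) (hsSq_nonneg _))
        -- Each `ξ` contributes to at most three shells, whence the factor `3`; the truncated
        -- subtraction at `k ξ = 0` only makes the interval shorter.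
        have h1 : (Finset.range (Z.sup k + 1)).filter (fun l => k ξ ≤ l + 1 ∧ l ≤ k ξ + 1) ⊆
            Finset.Icc (k ξ - 1) (k ξ + 1) := fun l hl => by
          have := (Finset.mem_filter.1 hl).2
          exact Finset.mem_Icc.2 (by omega)
        have h2 := Finset.card_le_card h1
        rw [Nat.card_Icc] at h2
        exact_mod_cast h2.trans (by omega)
    _ = _ := by
        rw [← Finset.mul_sum]
        ring

end Multiplication

/-! ### Fourier series of smooth functions -/

section SmoothSeries

open Filter Topology

variable {V : Type*} [NormedAddCommGroup V] [NormedSpace ℝ V]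
  {G : Type*} [TopologicalSpace G] [ChartedSpace V G] [Group G] [LieGroup 𝓘(ℝ, V) ∞ G]
  [CompactSpace G] [T2Space G] [MeasurableSpace G] [BorelSpace G] [FiniteDimensional ℝ V]
  [SecondCountableTopology G] [IsTopologicalGroup G] {n : ℕ}
  (μ : Measure G) [μ.IsHaarMeasure] [IsProbabilityMeasure μ]

include μ

/-- The decay of the Fourier coefficients of a smooth function in terms of bounds for its
derivatives. -/
lemma exists_weight_pow_mul_dim_mul_hsSq_le
    {B : LinearMap.BilinForm ℝ (GroupLieAlgebra 𝓘(ℝ, V) G)}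
    (hB : IsBiInvariant B) {Y : Module.Basis (Fin n) ℝ (GroupLieAlgebra 𝓘(ℝ, V) G)}
    (hY : ∀ i j, B (Y i) (Y j) = if i = j then 1 else 0)
    (X : Module.Basis (Fin n) ℝ (GroupLieAlgebra 𝓘(ℝ, V) G)) (k : ℕ) :
    ∃ C : ℝ, 0 ≤ C ∧ ∀ {W : Type*} [NormedAddCommGroup W] [InnerProductSpace ℂ W]
      [CompleteSpace W] (f : G → W) (D : ℝ), ContMDiff 𝓘(ℝ, V) 𝓘(ℝ, W) ∞ f →
      (∀ x, ‖f x‖ ≤ D) → (∀ j x, ‖lieDerivs (List.replicate k (X j)) f x‖ ≤ D) →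
      ∀ ξ : UnitaryDual G, ξ.rep.weight Y ^ (2 * k) *
        (ξ.rep.dim * hsSq (fourierCoeff μ ξ.rep f)) ≤ C * D ^ 2 := by
  obtain ⟨C, hC, h⟩ := exists_weight_pow_mul_hsSq_le μ hB hY X k
  refine ⟨C * (1 + n), by positivity, fun {W} _ _ _ f D hf hD hD' ξ => ?_⟩
  calc _ = ξ.rep.dim * (ξ.rep.weight Y ^ (2 * k) * hsSq (fourierCoeff μ ξ.rep f)) := by ring
    _ ≤ ξ.rep.dim * (C * (hsSq (fourierCoeff μ ξ.rep f) +
          ∑ j, hsSq (fourierCoeff μ ξ.rep (lieDerivs (List.replicate k (X j)) f)))) :=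
        mul_le_mul_of_nonneg_left (h ξ.rep f hf) (Nat.cast_nonneg _)
    _ = C * (ξ.rep.dim * hsSq (fourierCoeff μ ξ.rep f) + ∑ j, ξ.rep.dim *
          hsSq (fourierCoeff μ ξ.rep (lieDerivs (List.replicate k (X j)) f))) := by
        rw [← Finset.mul_sum]
        ring
    _ ≤ C * (D ^ 2 + ∑ j : Fin n, D ^ 2) := by
        refine mul_le_mul_of_nonneg_left (add_le_add ?_ (Finset.sum_le_sum fun j _ => ?_)) hC
        · exact dim_mul_hsSq_fourierCoeff_le μ hf.continuous ξ hD
        · exact dim_mul_hsSq_fourierCoeff_le μ (contMDiff_lieDerivs hf _).continuous ξ (hD' j)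
    _ = _ := by
        rw [Finset.sum_const, Finset.card_univ, Fintype.card_fin, nsmul_eq_mul]
        ring

omit μ in
lemma exists_bound_of_continuous {ι : Type*} [Finite ι] {W : Type*} [NormedAddCommGroup W]
    {f : ι → G → W} (hf : ∀ i, Continuous (f i)) : ∃ D : ℝ, ∀ i x, ‖f i x‖ ≤ D := by
  have h : ∀ i, ∃ D : ℝ, ∀ x, ‖f i x‖ ≤ D := fun i => by
    obtain ⟨D, hD⟩ := (isCompact_range (hf i)).isBounded.exists_norm_le
    exact ⟨D, fun x => hD _ ⟨x, rfl⟩⟩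
  choose D hD using h
  obtain ⟨M, hM⟩ := (Set.finite_range D).bddAbove
  exact ⟨M, fun i x => (hD i x).trans (hM ⟨i, rfl⟩)⟩

variable {W : Type*} [NormedAddCommGroup W] [InnerProductSpace ℂ W] [CompleteSpace W]

/-- The Fourier series of a smooth function converges rapidly. -/
theorem exists_summable_norm_trigTerm_le
    {B : LinearMap.BilinForm ℝ (GroupLieAlgebra 𝓘(ℝ, V) G)}
    (hB : IsBiInvariant B) {Y : Module.Basis (Fin n) ℝ (GroupLieAlgebra 𝓘(ℝ, V) G)}
    (hY : ∀ i j, B (Y i) (Y j) = if i = j then 1 else 0) (s : ℝ) {f : G → W}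
    (hf : ContMDiff 𝓘(ℝ, V) 𝓘(ℝ, W) ∞ f) :
    ∃ b : UnitaryDual G → ℝ, Summable b ∧ ∀ ξ x, ‖trigTerm ξ.rep
      (((ξ.rep.weight Y ^ s : ℝ) : ℂ) • fourierCoeff μ ξ.rep f) x‖ ≤ b ξ := by
  obtain ⟨p, hp⟩ := exists_summable_dim_sq_div μ hB hY
  -- Decay of order `k` absorbs `⟨ξ⟩^s` and leaves the summable weight `⟨ξ⟩^{-p}`.
  obtain ⟨k, hk⟩ := exists_nat_ge (s + p)
  obtain ⟨C, hC, h⟩ := exists_weight_pow_mul_dim_mul_hsSq_le μ hB hY Y k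
  obtain ⟨D₁, hD₁⟩ := exists_bound_of_continuous (G := G) (fun _ : Unit => hf.continuous)
  obtain ⟨D₂, hD₂⟩ := exists_bound_of_continuous (G := G)
    (fun j => (contMDiff_lieDerivs hf (List.replicate k (Y j))).continuous)
  set D := max D₁ D₂ with hD
  have hD0 : 0 ≤ D := (norm_nonneg _).trans ((hD₁ () 1).trans (le_max_left _ _))
  refine ⟨fun ξ => Real.sqrt C * D * ((ξ.rep.dim : ℝ) ^ 2 / ξ.rep.weight Y ^ p),
    hp.mul_left _, fun ξ x => ?_⟩
  have hw := ξ.rep.weight_pos Y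
  have hw1 := ξ.rep.one_le_weight Y
  have h1 : Real.sqrt ξ.rep.dim * Real.sqrt (hsSq (fourierCoeff μ ξ.rep f)) ≤
      Real.sqrt C * D / ξ.rep.weight Y ^ k := by
    rw [le_div_iff₀ (pow_pos hw k), ← Real.sqrt_mul (Nat.cast_nonneg _)]
    refine Real.sqrt_le_sqrt (h f D hf (fun x => (hD₁ () x).trans (le_max_left _ _))
      (fun j x => (hD₂ j x).trans (le_max_right _ _)) ξ) |>.trans_eq' ?_ |>.trans_eq ?_
    · rw [pow_mul', Real.sqrt_mul (sq_nonneg _), Real.sqrt_sq (pow_nonneg hw.le _), mul_comm]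
    · rw [Real.sqrt_mul hC, Real.sqrt_sq hD0]
  have h2 : ξ.rep.weight Y ^ s / ξ.rep.weight Y ^ k ≤ 1 / ξ.rep.weight Y ^ p := by
    rw [div_le_div_iff₀ (pow_pos hw _) (pow_pos hw _), one_mul, ← Real.rpow_natCast,
      ← Real.rpow_natCast, ← Real.rpow_add hw]
    exact Real.rpow_le_rpow_of_exponent_le hw1 hk
  -- One power of `d` remains in front and is enlarged to the `d²` of the summability statement.
  have hd : (ξ.rep.dim : ℝ) ≤ (ξ.rep.dim : ℝ) ^ 2 := by
    have : (1 : ℝ) ≤ ξ.rep.dim := by exact_mod_cast ξ.rep.dim_pos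
    nlinarith
  calc _ ≤ ξ.rep.dim * (Real.sqrt ξ.rep.dim * Real.sqrt (hsSq
          (((ξ.rep.weight Y ^ s : ℝ) : ℂ) • fourierCoeff μ ξ.rep f))) := norm_trigTerm_le _ _ _
    _ = ξ.rep.dim * (ξ.rep.weight Y ^ s *
          (Real.sqrt ξ.rep.dim * Real.sqrt (hsSq (fourierCoeff μ ξ.rep f)))) := by
        rw [hsSq_smul, Real.sqrt_mul (sq_nonneg _), Real.sqrt_sq (norm_nonneg _),
          Complex.norm_real, Real.norm_of_nonneg (Real.rpow_nonneg hw.le _)]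
        ring
    _ ≤ (ξ.rep.dim : ℝ) ^ 2 * (ξ.rep.weight Y ^ s * (Real.sqrt C * D / ξ.rep.weight Y ^ k)) := by
        gcongr
    _ = Real.sqrt C * D * (ξ.rep.dim : ℝ) ^ 2 *
          (ξ.rep.weight Y ^ s / ξ.rep.weight Y ^ k) := by ring
    _ ≤ Real.sqrt C * D * (ξ.rep.dim : ℝ) ^ 2 * (1 / ξ.rep.weight Y ^ p) := by gcongr
    _ = _ := by ring

lemma exists_summable_norm_trigTerm_fourierCoeff_le
    {B : LinearMap.BilinForm ℝ (GroupLieAlgebra 𝓘(ℝ, V) G)}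
    (hB : IsBiInvariant B) {Y : Module.Basis (Fin n) ℝ (GroupLieAlgebra 𝓘(ℝ, V) G)}
    (hY : ∀ i j, B (Y i) (Y j) = if i = j then 1 else 0) {f : G → W}
    (hf : ContMDiff 𝓘(ℝ, V) 𝓘(ℝ, W) ∞ f) :
    ∃ b : UnitaryDual G → ℝ, Summable b ∧ ∀ ξ x, ‖trigTerm ξ.rep (fourierCoeff μ ξ.rep f) x‖ ≤
      b ξ := by
  obtain ⟨b, hb, h⟩ := exists_summable_norm_trigTerm_le μ hB hY 0 hf
  refine ⟨b, hb, fun ξ x => ?_⟩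
  simpa only [Real.rpow_zero, Complex.ofReal_one, one_smul] using h ξ x

end SmoothSeries

/-! ### Truncated Sobolev norms -/

section SobolevVec

open Filter Topology

variable {V : Type*} [NormedAddCommGroup V] [NormedSpace ℝ V]
  {G : Type*} [TopologicalSpace G] [ChartedSpace V G] [Group G] [MeasurableSpace G] {n : ℕ}
  {W : Type*} [NormedAddCommGroup W] [InnerProductSpace ℂ W]

/-- The Fourier coefficients of `f` at the finite set `Z`, multiplied with Sobolev weights. -/
def sobolevVec (μ : Measure G) (Y : Fin n → GroupLieAlgebra 𝓘(ℝ, V) G) (t : ℝ)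
    (Z : Finset (UnitaryDual G)) (f : G → W) :
    PiLp 2 fun _ : (ζ : Z) × (Fin ζ.1.rep.dim × Fin ζ.1.rep.dim) => W :=
  WithLp.toLp 2 fun p =>
    ((Real.sqrt (sobolevWeight Y t p.1.1) : ℝ) : ℂ) • fourierCoeff μ p.1.1.rep f p.2.1 p.2.2

lemma norm_sobolevVec_sq (μ : Measure G) (Y : Fin n → GroupLieAlgebra 𝓘(ℝ, V) G) (t : ℝ)
    (Z : Finset (UnitaryDual G)) (f : G → W) : ‖sobolevVec μ Y t Z f‖ ^ 2 =
      ∑ ζ ∈ Z, sobolevWeight Y t ζ * hsSq (fourierCoeff μ ζ.rep f) := by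
  rw [PiLp.norm_sq_eq_of_L2, Fintype.sum_sigma, ← Finset.sum_coe_sort Z]
  refine Finset.sum_congr rfl fun ζ _ => ?_
  rw [Fintype.sum_prod_type, hsSq, Finset.mul_sum]
  refine Finset.sum_congr rfl fun i _ => ?_
  rw [Finset.mul_sum]
  refine Finset.sum_congr rfl fun j _ => ?_
  change ‖((Real.sqrt (sobolevWeight Y t ζ.1) : ℝ) : ℂ) • fourierCoeff μ ζ.1.rep f i j‖ ^ 2 = _
  rw [norm_smul, mul_pow, Complex.norm_real, Real.norm_of_nonneg (Real.sqrt_nonneg _),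
    Real.sq_sqrt (sobolevWeight_nonneg _ _ _)]

variable [CompactSpace G] [BorelSpace G] [IsTopologicalGroup G] (μ : Measure G) [μ.IsHaarMeasure]
  [IsProbabilityMeasure μ]

lemma sobolevVec_sum (Y : Fin n → GroupLieAlgebra 𝓘(ℝ, V) G) (t : ℝ)
    (Z : Finset (UnitaryDual G)) {ι : Type*} (s : Finset ι) {f : ι → G → W}
    (hf : ∀ i, Continuous (f i)) :
    sobolevVec μ Y t Z (fun x => ∑ i ∈ s, f i x) = ∑ i ∈ s, sobolevVec μ Y t Z (f i) := by
  ext p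
  rw [WithLp.ofLp_sum, Finset.sum_apply]
  change _ • fourierCoeff μ p.1.1.rep (fun x => ∑ i ∈ s, f i x) p.2.1 p.2.2 = _
  rw [fourierCoeff_sum μ _ s hf]
  simp only [Finset.sum_apply, Finset.smul_sum]
  rfl

omit [CompactSpace G] [BorelSpace G] [IsTopologicalGroup G] [μ.IsHaarMeasure]
  [IsProbabilityMeasure μ] in
lemma sobolevVec_smul (Y : Fin n → GroupLieAlgebra 𝓘(ℝ, V) G) (t : ℝ)
    (Z : Finset (UnitaryDual G)) (a : ℂ) (f : G → W) :
    sobolevVec μ Y t Z (fun x => a • f x) = a • sobolevVec μ Y t Z f := by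
  ext p
  change ((Real.sqrt (sobolevWeight Y t p.1.1) : ℝ) : ℂ) •
    fourierCoeff μ p.1.1.rep (fun x => a • f x) p.2.1 p.2.2 =
      a • ((Real.sqrt (sobolevWeight Y t p.1.1) : ℝ) : ℂ) • fourierCoeff μ p.1.1.rep f p.2.1 p.2.2
  have h : fourierCoeff μ p.1.1.rep (fun x => a • f x) p.2.1 p.2.2 =
      a • fourierCoeff μ p.1.1.rep f p.2.1 p.2.2 := by
    simp only [fourierCoeff, smul_comm _ a]
    exact integral_smul a _
  rw [h, smul_comm]

/-- Because `Z` is finite, uniform convergence alone gives convergence of the truncated norm,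
whatever the order `t`. The full norm is recovered by a supremum over `Z`. -/
lemma tendsto_sobolevVec (Y : Fin n → GroupLieAlgebra 𝓘(ℝ, V) G) (t : ℝ)
    (Z : Finset (UnitaryDual G)) {ι : Type*} {l : Filter ι} {F : ι → G → W} {f : G → W}
    (h : TendstoUniformly F f l) (hF : ∀ i, Continuous (F i)) (hf : Continuous f) :
    Tendsto (fun i => sobolevVec μ Y t Z (F i)) l (𝓝 (sobolevVec μ Y t Z f)) := by
  refine ((PiLp.continuous_toLp 2 _).tendsto _).comp (tendsto_pi_nhds.2 fun p => ?_)
  exact (tendsto_fourierCoeff μ h hF hf _ _ _).const_smul _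

end SobolevVec

/-! ### Fourier series of sections -/

section FourierSections

open Filter Topology

variable {V : Type*} [NormedAddCommGroup V] [NormedSpace ℝ V]
  {G : Type*} [TopologicalSpace G] [ChartedSpace V G] [Group G] [LieGroup 𝓘(ℝ, V) ∞ G]
  [CompactSpace G] [T2Space G] [MeasurableSpace G] [BorelSpace G] [FiniteDimensional ℝ V]
  [SecondCountableTopology G] [IsTopologicalGroup G] {n : ℕ}
  (μ : Measure G) [μ.IsHaarMeasure] [IsProbabilityMeasure μ]

section Derivatives

variable {W : Type*} [NormedAddCommGroup W] [InnerProductSpace ℂ W]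

include μ in
lemma contMDiff_trigTerm (ξ : UnitaryIrrep G) (c : Fin ξ.dim → Fin ξ.dim → W) :
    ContMDiff 𝓘(ℝ, V) 𝓘(ℝ, W) ∞ (trigTerm ξ c) :=
  contMDiff_smul_complex contMDiff_const (contMDiff_finsetSum fun i _ => contMDiff_finsetSum
    fun j _ => contMDiff_smul_complex (contMDiff_coeff μ ξ i j) contMDiff_const)

lemma trigTerm_eq_sum (ξ : UnitaryIrrep G) (c : Fin ξ.dim → Fin ξ.dim → W) :
    trigTerm ξ c = fun x => ∑ i, ∑ j, ξ.coeff i j x • ((ξ.dim : ℂ) • c j i) := by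
  funext x
  simp only [trigTerm, Finset.smul_sum, smul_comm (ξ.dim : ℂ)]

/-- Left-invariant derivatives commute with the projection to an isotypic component, so convergence
of all derivatives reduces to uniform convergence for smooth functions. -/
lemma lieDeriv_trigTerm [CompleteSpace W] (ξ : UnitaryIrrep G) {u : G → W}
    (hu : ContMDiff 𝓘(ℝ, V) 𝓘(ℝ, W) ∞ u) (X : GroupLieAlgebra 𝓘(ℝ, V) G) :
    lieDeriv X (trigTerm ξ (fourierCoeff μ ξ u)) =
      trigTerm ξ (fourierCoeff μ ξ (lieDeriv X u)) := by
  have h := contMDiff_coeff (V := V) μ ξ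
  have h1 : ∀ i j (w : W), ContMDiff 𝓘(ℝ, V) 𝓘(ℝ, W) ∞ fun x => ξ.coeff i j x • w := fun i j w =>
    contMDiff_smul_complex (h i j) contMDiff_const
  have h2 : ∀ i j (w : W) x, lieDeriv X (fun x => ξ.coeff i j x • w) x =
      ∑ k, ξ.coeff i k x • (ξ.derived X k j • w) := fun i j w x => by
    refine (congrFun (lieDeriv_clm (h i j)
      ((ContinuousLinearMap.toSpanSingleton ℂ w).restrictScalars ℝ) X) x).trans ?_
    change lieDeriv X (ξ.coeff i j) x • w = _
    rw [lieDeriv_coeff μ, Finset.sum_smul]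
    simp only [smul_smul]
  rw [trigTerm_eq_sum, trigTerm_eq_sum]
  refine (lieDeriv_sum Finset.univ (f := fun i x => ∑ j, ξ.coeff i j x • ((ξ.dim : ℂ) •
    fourierCoeff μ ξ u j i)) (fun i => contMDiff_finsetSum fun j _ => h1 i j _) X).trans ?_
  funext x
  refine Finset.sum_congr rfl fun i _ => ?_
  refine (congrFun (lieDeriv_sum Finset.univ (f := fun j x => ξ.coeff i j x • ((ξ.dim : ℂ) •
    fourierCoeff μ ξ u j i)) (fun j => h1 i j _) X) x).trans ?_
  simp only [h2]
  rw [Finset.sum_comm]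
  refine Finset.sum_congr rfl fun k _ => ?_
  rw [fourierCoeff_lieDeriv μ ξ hu]
  simp only [Finset.smul_sum, smul_comm (ξ.dim : ℂ)]

lemma lieDerivs_trigTerm [CompleteSpace W] (ξ : UnitaryIrrep G) {u : G → W}
    (hu : ContMDiff 𝓘(ℝ, V) 𝓘(ℝ, W) ∞ u) (l : List (GroupLieAlgebra 𝓘(ℝ, V) G)) :
    lieDerivs l (trigTerm ξ (fourierCoeff μ ξ u)) =
      trigTerm ξ (fourierCoeff μ ξ (lieDerivs l u)) := by
  induction l with
  | nil => rfl
  | cons X l ih => rw [lieDerivs, ih, lieDeriv_trigTerm μ ξ (contMDiff_lieDerivs hu l)]; rfl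

omit [CompactSpace G] [T2Space G] [MeasurableSpace G] [BorelSpace G] [FiniteDimensional ℝ V]
  [SecondCountableTopology G] [IsTopologicalGroup G] in
lemma lieDerivs_sum {ι : Type*} (s : Finset ι) {f : ι → G → W}
    (hf : ∀ i, ContMDiff 𝓘(ℝ, V) 𝓘(ℝ, W) ∞ (f i)) (l : List (GroupLieAlgebra 𝓘(ℝ, V) G)) :
    lieDerivs l (fun x => ∑ i ∈ s, f i x) = fun x => ∑ i ∈ s, lieDerivs l (f i) x := by
  induction l with
  | nil => rfl
  | cons X l ih =>
    rw [lieDerivs, ih]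
    exact lieDeriv_sum s (fun i => contMDiff_lieDerivs (hf i) l) X

end Derivatives

section Equivariance

variable {W : Type*} [NormedAddCommGroup W] [InnerProductSpace ℂ W]

lemma fourierCoeff_translate (ξ : UnitaryIrrep G) {u : G → W} (hu : Continuous u) (g : G)
    (i j : Fin ξ.dim) : fourierCoeff μ ξ (fun y => u (y * g)) i j =
      ∑ l, ξ.coeff i l g • fourierCoeff μ ξ u l j := by
  have : μ.IsMulRightInvariant := isMulRightInvariant μ
  have h := integral_mul_right_eq_self (μ := μ) (fun y => star (ξ.coeff j i (y * g⁻¹)) • u y) g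
  simp only [mul_inv_cancel_right] at h
  rw [fourierCoeff, h]
  simp only [ξ.coeff_mul, ξ.coeff_inv, star_sum, star_mul', star_star, Finset.sum_smul]
  rw [integral_finsetSum]
  · refine Finset.sum_congr rfl fun l _ => ?_
    rw [fourierCoeff, ← integral_smul]
    refine integral_congr_ae (Eventually.of_forall fun y => ?_)
    simp only [smul_smul, mul_comm]
  · intro l _
    exact integrable_of_continuous μ
      (((ξ.continuous_coeff j l).star.mul continuous_const).smul hu)

lemma trigTerm_translate (ξ : UnitaryIrrep G) {u : G → W} (hu : Continuous u) (g x : G) :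
    trigTerm ξ (fourierCoeff μ ξ fun y => u (y * g)) x =
      trigTerm ξ (fourierCoeff μ ξ u) (x * g) := by
  simp only [trigTerm, fourierCoeff_translate μ ξ hu, ξ.coeff_mul, Finset.smul_sum,
    Finset.sum_smul, smul_smul]
  refine Finset.sum_congr rfl fun i _ => ?_
  rw [Finset.sum_comm]

lemma fourierCoeff_clm {W' : Type*} [NormedAddCommGroup W'] [InnerProductSpace ℂ W']
    [CompleteSpace W] [CompleteSpace W'] (ξ : UnitaryIrrep G) {u : G → W} (hu : Continuous u)
    (L : W →L[ℂ] W') (i j : Fin ξ.dim) :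
    fourierCoeff μ ξ (fun y => L (u y)) i j = L (fourierCoeff μ ξ u i j) := by
  have h1 : Integrable (fun y => star (ξ.coeff j i y) • u y) μ := integrable_coeff_smul μ ξ j i hu
  rw [fourierCoeff, fourierCoeff, ← L.integral_comp_comm h1]
  simp only [map_smul]

lemma trigTerm_clm {W' : Type*} [NormedAddCommGroup W'] [InnerProductSpace ℂ W']
    [CompleteSpace W] [CompleteSpace W'] (ξ : UnitaryIrrep G) {u : G → W} (hu : Continuous u)
    (L : W →L[ℂ] W') (x : G) :
    trigTerm ξ (fourierCoeff μ ξ fun y => L (u y)) x = L (trigTerm ξ (fourierCoeff μ ξ u) x) := by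
  simp only [trigTerm, fourierCoeff_clm μ ξ hu, map_smul, map_sum]

end Equivariance

variable {K : Subgroup G} {E₀ : Type*} [NormedAddCommGroup E₀] [InnerProductSpace ℂ E₀]
  [FiniteDimensional ℂ E₀] {τ : K →* (E₀ ≃ₗᵢ[ℂ] E₀)}

omit [T2Space G] [MeasurableSpace G] [BorelSpace G] [CompactSpace G] [FiniteDimensional ℝ V]
  [SecondCountableTopology G] [IsTopologicalGroup G] [LieGroup 𝓘(ℝ, V) ∞ G]
  [FiniteDimensional ℂ E₀] in
lemma SmoothSection.coe_sum {ι : Type*} (s : Finset ι) (u : ι → SmoothSection V τ) (x : G) :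
    (∑ i ∈ s, u i).1 x = ∑ i ∈ s, (u i).1 x := by
  have h := map_sum (sectionSubmodule V τ).subtype u s
  exact (congrFun h x).trans (Finset.sum_apply _ _ _)

omit [T2Space G] [MeasurableSpace G] [BorelSpace G] [CompactSpace G] [FiniteDimensional ℝ V]
  [SecondCountableTopology G] [IsTopologicalGroup G] [LieGroup 𝓘(ℝ, V) ∞ G]
  [FiniteDimensional ℂ E₀] in
lemma SmoothSection.coe_smul (a : ℂ) (u : SmoothSection V τ) (x : G) :
    (a • u).1 x = a • u.1 x := rfl

omit [T2Space G] [MeasurableSpace G] [BorelSpace G] [CompactSpace G] [FiniteDimensional ℝ V]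
  [SecondCountableTopology G] [IsTopologicalGroup G] [LieGroup 𝓘(ℝ, V) ∞ G]
  [FiniteDimensional ℂ E₀] in
lemma SmoothSection.ext {u v : SmoothSection V τ} (h : ∀ x, u.1 x = v.1 x) : u = v :=
  Subtype.ext (funext h)

/-- The projection to an isotypic component commutes with right translations and with linear maps of
the fibre, so it preserves equivariance. -/
lemma trigTerm_mul_of_section (ξ : UnitaryIrrep G) (u : SmoothSection V τ) (x : G) (k : K) :
    trigTerm ξ (fourierCoeff μ ξ u.1) (x * k) = (τ k)⁻¹ (trigTerm ξ (fourierCoeff μ ξ u.1) x) := by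
  have : CompleteSpace E₀ := FiniteDimensional.complete ℂ E₀
  have hu : Continuous u.1 := u.2.1.continuous
  rw [← trigTerm_translate μ ξ hu]
  have h : (fun y => u.1 (y * k)) = fun y => ((τ k)⁻¹ : E₀ ≃ₗᵢ[ℂ] E₀) (u.1 y) :=
    funext fun y => u.2.2 y k
  rw [h]
  exact trigTerm_clm μ ξ hu (((τ k)⁻¹ : E₀ ≃ₗᵢ[ℂ] E₀) : E₀ →L[ℂ] E₀) x

section Projection

variable (hK : IsClosed (K : Set G)) (κ : Measure K) [κ.IsHaarMeasure] [IsProbabilityMeasure κ]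
  (hτ : ∀ v, Continuous fun k => τ k v)

include hK hτ

omit [FiniteDimensional ℝ V] in
lemma integrable_proj_coeff (ξ : UnitaryIrrep G) (i j : Fin ξ.dim) (e : E₀) (x : G) :
    Integrable (fun k : K => τ k (ξ.coeff i j (x * k) • e)) κ := by
  have : CompactSpace K := isCompact_iff_compactSpace.1 hK.isCompact
  refine integrable_of_continuous κ ?_
  simp only [map_smul]
  exact ((ξ.continuous_coeff i j).comp (continuous_const.mul continuous_subtype_val)).smul (hτ e)

include μ

/-- Expanding `ξ(xk) = ξ(x) ξ(k)` leaves a finite combination of the smooth `ξ_{il}`; equivariance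
is left invariance of `κ`. -/
lemma proj_coeff_mem (ξ : UnitaryIrrep G) (i j : Fin ξ.dim) (e : E₀) :
    (fun x => ∫ k, τ k (ξ.coeff i j (x * k) • e) ∂κ) ∈ sectionSubmodule V τ := by
  have : CompactSpace K := isCompact_iff_compactSpace.1 hK.isCompact
  have hint : ∀ l, Integrable (fun k : K => ξ.coeff l j k • τ k e) κ := fun l =>
    integrable_of_continuous κ (((ξ.continuous_coeff l j).comp continuous_subtype_val).smul (hτ e))
  constructor
  · have h : (fun x => ∫ k, τ k (ξ.coeff i j (x * k) • e) ∂κ) =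
        fun x => ∑ l, ξ.coeff i l x • ∫ k : K, ξ.coeff l j k • τ k e ∂κ := by
      funext x
      simp only [← integral_smul]
      have hint' : ∀ l, Integrable (fun k : K => ξ.coeff i l x • ξ.coeff l j k • τ k e) κ :=
        fun l => (hint l).smul _
      rw [← integral_finsetSum _ fun l _ => hint' l]
      refine integral_congr_ae (Eventually.of_forall fun k => ?_)
      simp only [ξ.coeff_mul, Finset.sum_smul, map_sum, map_smul, smul_smul]
    rw [h]
    exact contMDiff_finsetSum fun l _ =>
      contMDiff_smul_complex (contMDiff_coeff μ ξ i l) contMDiff_const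
  · intro g k₀
    have h := integral_mul_left_eq_self (μ := κ)
      (fun k => τ (k₀⁻¹ * k) (ξ.coeff i j (g * k) • e)) k₀
    simp only [inv_mul_cancel_left, Subgroup.coe_mul] at h
    simp only [← mul_assoc] at h
    refine h.trans ?_
    have hc := (((τ k₀)⁻¹ : E₀ ≃ₗᵢ[ℂ] E₀) : E₀ →L[ℂ] E₀).integral_comp_comm
      (integrable_proj_coeff hK κ hτ ξ i j e g)
    refine Eq.trans ?_ hc
    refine integral_congr_ae (Eventually.of_forall fun k => ?_)
    change τ (k₀⁻¹ * k) _ = (τ k₀)⁻¹ (τ k _)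
    rw [map_mul, map_inv]
    rfl

lemma proj_coeff_apply (ξ : UnitaryIrrep G) (i j : Fin ξ.dim) (e : E₀) (x : G) :
    (proj τ κ fun y => ξ.coeff i j y • e : SmoothSection V τ).1 x =
      ∫ k, τ k (ξ.coeff i j (x * k) • e) ∂κ :=
  congrArg (fun v : SmoothSection V τ => v.1 x) (dif_pos (proj_coeff_mem μ hK κ hτ ξ i j e))

lemma proj_coeff_add (ξ : UnitaryIrrep G) (i j : Fin ξ.dim) (e e' : E₀) :
    (proj τ κ fun y => ξ.coeff i j y • (e + e') : SmoothSection V τ) =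
      proj τ κ (fun y => ξ.coeff i j y • e) + proj τ κ fun y => ξ.coeff i j y • e' := by
  refine SmoothSection.ext fun x => ?_
  refine Eq.trans ?_ (congrArg₂ (· + ·) (proj_coeff_apply μ hK κ hτ ξ i j e x).symm
    (proj_coeff_apply μ hK κ hτ ξ i j e' x).symm)
  rw [proj_coeff_apply μ hK κ hτ]
  simp only [smul_add, map_add]
  exact integral_add (integrable_proj_coeff hK κ hτ ξ i j e x)
    (integrable_proj_coeff hK κ hτ ξ i j e' x)

lemma proj_coeff_smul (ξ : UnitaryIrrep G) (i j : Fin ξ.dim) (a : ℂ) (e : E₀) :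
    (proj τ κ fun y => ξ.coeff i j y • (a • e) : SmoothSection V τ) =
      a • proj τ κ (fun y => ξ.coeff i j y • e) := by
  refine SmoothSection.ext fun x => ?_
  rw [SmoothSection.coe_smul, proj_coeff_apply μ hK κ hτ, proj_coeff_apply μ hK κ hτ,
    ← integral_smul]
  simp only [smul_comm _ a, map_smul]

/-- The component of a section `u` at `ξ`, which is again a section. -/
def fourierSection (κ : Measure K) (μ : Measure G) (ξ : UnitaryIrrep G) (u : SmoothSection V τ) :
    SmoothSection V τ :=
  (ξ.dim : ℂ) • ∑ i, ∑ j, proj τ κ fun y => ξ.coeff i j y • fourierCoeff μ ξ u.1 j i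

/-- An equivariant function is unchanged by the average over `K`. The section is assembled from
projected coefficients because these are the inputs through which the symbol sees `A`. -/
lemma fourierSection_apply (ξ : UnitaryIrrep G) (u : SmoothSection V τ) (x : G) :
    (fourierSection κ μ ξ u).1 x = trigTerm ξ (fourierCoeff μ ξ u.1) x := by
  rw [fourierSection, SmoothSection.coe_smul]
  simp only [SmoothSection.coe_sum, proj_coeff_apply μ hK κ hτ]
  have h1 : ∀ k : K, τ k (trigTerm ξ (fourierCoeff μ ξ u.1) (x * k)) =
      trigTerm ξ (fourierCoeff μ ξ u.1) x := fun k => by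
    rw [trigTerm_mul_of_section μ]
    exact (τ k).apply_symm_apply _
  have hint := fun i j => integrable_proj_coeff hK κ hτ ξ i j (fourierCoeff μ ξ u.1 j i) x
  have h2 : ∫ k : K, τ k (trigTerm ξ (fourierCoeff μ ξ u.1) (x * k)) ∂κ =
      trigTerm ξ (fourierCoeff μ ξ u.1) x := by
    simp only [h1]
    simp
  rw [← h2]
  simp only [trigTerm, map_smul, map_sum]
  rw [integral_smul]
  simp only [← map_smul]
  congr 1
  have hint2 : ∀ i, Integrable (fun k : K =>
      ∑ j, τ k (ξ.coeff i j (x * k) • fourierCoeff μ ξ u.1 j i)) κ := fun i =>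
    integrable_finsetSum _ fun j _ => hint i j
  rw [integral_finsetSum _ fun i _ => hint2 i]
  exact Finset.sum_congr rfl fun i _ => (integral_finsetSum _ fun j _ => hint i j).symm

/-- The Fourier series of a smooth section converges in the `C^∞` topology. -/
theorem tendsto_sum_fourierSection
    {B : LinearMap.BilinForm ℝ (GroupLieAlgebra 𝓘(ℝ, V) G)}
    (hB : IsBiInvariant B) {Y : Module.Basis (Fin n) ℝ (GroupLieAlgebra 𝓘(ℝ, V) G)}
    (hY : ∀ i j, B (Y i) (Y j) = if i = j then 1 else 0) (u : SmoothSection V τ) :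
    Tendsto (fun S : Finset (UnitaryDual G) => ∑ ξ ∈ S, fourierSection κ μ ξ.rep u) atTop (𝓝 u) := by
  have : CompleteSpace E₀ := FiniteDimensional.complete ℂ E₀
  -- The topology is an infimum over lists of vector fields, so each iterated derivative is treated
  -- separately.
  simp only [nhds_iInf, tendsto_iInf, nhds_induced, tendsto_comap_iff]
  intro l
  rw [UniformFun.tendsto_iff_tendstoUniformly]
  have hu := contMDiff_lieDerivs u.2.1 l
  obtain ⟨b, hb, hb'⟩ := exists_summable_norm_trigTerm_fourierCoeff_le μ hB hY hu
  have h1 := tendstoUniformly_trigSeries hb hb'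
  rw [trigSeries_fourierCoeff μ hu.continuous hb hb'] at h1
  refine (tendstoUniformly_congr (Eventually.of_forall fun S => funext fun x => ?_)).1 h1
  have h2 : (∑ ξ ∈ S, fourierSection κ μ ξ.rep u).1 =
      fun x => ∑ ξ ∈ S, trigTerm ξ.rep (fourierCoeff μ ξ.rep u.1) x := funext fun x => by
    rw [SmoothSection.coe_sum]
    exact Finset.sum_congr rfl fun ξ _ => fourierSection_apply μ hK κ hτ ξ.rep u x
  change _ = lieDerivs l (∑ ξ ∈ S, fourierSection κ μ ξ.rep u).1 x
  rw [h2, lieDerivs_sum S (fun ξ => contMDiff_trigTerm μ ξ.rep _) l]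
  exact Finset.sum_congr rfl fun ξ _ =>
    (congrFun (lieDerivs_trigTerm μ ξ.rep u.2.1 l) x).symm

end Projection

end FourierSections

/-! ### The symbol -/

section SymbolCalculus

open Filter Topology

/-- Only the pure derivatives `X_j^k`, that is the multi-indices `k e_j`, enter the proof. -/
lemma flatMap_replicate_single {α : Type*} {n : ℕ} (X : Fin n → α) (j : Fin n) (k : ℕ) :
    ((List.finRange n).flatMap fun i => List.replicate ((Pi.single j k : Fin n → ℕ) i) (X i)) =
      List.replicate k (X j) := by
  have h : ∀ l : List (Fin n), l.Nodup → l.flatMap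
      (fun i => List.replicate ((Pi.single j k : Fin n → ℕ) i) (X i)) =
        if j ∈ l then List.replicate k (X j) else [] := by
    intro l
    induction l with
    | nil => simp
    | cons a l ih =>
      intro hl
      rw [List.nodup_cons] at hl
      rw [List.flatMap_cons, ih hl.2]
      by_cases ha : j = a
      · subst ha
        simp [hl.1]
      · simp [ha]
  rw [h _ (List.nodup_finRange n), if_pos (List.mem_finRange j)]

variable {V : Type*} [NormedAddCommGroup V] [NormedSpace ℝ V]
  {G : Type*} [TopologicalSpace G] [ChartedSpace V G] [Group G]

lemma multiDeriv_single {W : Type*} [NormedAddCommGroup W] [NormedSpace ℝ W] {n : ℕ}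
    (X : Fin n → GroupLieAlgebra 𝓘(ℝ, V) G) (j : Fin n) (k : ℕ) (f : G → W) :
    multiDeriv X (Pi.single j k) f = lieDerivs (List.replicate k (X j)) f := by
  rw [multiDeriv, flatMap_replicate_single]

lemma multiDeriv_zero {W : Type*} [NormedAddCommGroup W] [NormedSpace ℝ W] {n : ℕ}
    (X : Fin n → GroupLieAlgebra 𝓘(ℝ, V) G) (f : G → W) : multiDeriv X 0 f = f := by
  have h : ((List.finRange n).flatMap fun i => List.replicate ((0 : Fin n → ℕ) i) (X i)) = [] := by
    simp
  rw [multiDeriv, h]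
  rfl

variable [LieGroup 𝓘(ℝ, V) ∞ G]
  [CompactSpace G] [T2Space G] [MeasurableSpace G] [BorelSpace G] [FiniteDimensional ℝ V]
  [SecondCountableTopology G] [IsTopologicalGroup G] {n : ℕ}
  (μ : Measure G) [μ.IsHaarMeasure] [IsProbabilityMeasure μ]
  {K : Subgroup G} (hK : IsClosed (K : Set G)) (κ : Measure K) [κ.IsHaarMeasure]
  [IsProbabilityMeasure κ]
  {E₀ : Type*} [NormedAddCommGroup E₀] [InnerProductSpace ℂ E₀] [FiniteDimensional ℂ E₀]
  {F₀ : Type*} [NormedAddCommGroup F₀] [InnerProductSpace ℂ F₀] [FiniteDimensional ℂ F₀]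
  {τ : K →* (E₀ ≃ₗᵢ[ℂ] E₀)} (hτ : ∀ v, Continuous fun k => τ k v)
  {ρ : K →* (F₀ ≃ₗᵢ[ℂ] F₀)}
  (A : SmoothSection V τ →ₗ[ℂ] SmoothSection V ρ)

include μ hK hτ

/-- The block is prescribed on an orthonormal basis only; the right side is linear in `e`, so the
formula extends to all vectors. -/
lemma symbolBlock_apply (ξ : UnitaryIrrep G) (x : G) (p j : Fin ξ.dim) (e : E₀) :
    symbolBlock κ A ξ x p j e =
      ∑ l, star (ξ.coeff l p x) • (A (proj τ κ fun y => ξ.coeff l j y • e)).1 x := by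
  let L : E₀ →ₗ[ℂ] F₀ :=
    { toFun := fun e =>
        ∑ l, star (ξ.coeff l p x) • (A (proj τ κ fun y => ξ.coeff l j y • e)).1 x
      map_add' := fun e e' => by
        rw [← Finset.sum_add_distrib]
        refine Finset.sum_congr rfl fun l _ => ?_
        rw [proj_coeff_add μ hK κ hτ, map_add, ← smul_add]
        rfl
      map_smul' := fun a e => by
        rw [RingHom.id_apply, Finset.smul_sum]
        refine Finset.sum_congr rfl fun l _ => ?_
        rw [proj_coeff_smul μ hK κ hτ, map_smul, smul_comm a]
        rfl }
  have h : symbolBlock κ A ξ x p j = L :=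
    (stdOrthonormalBasis ℂ E₀).toBasis.ext fun a => by
      rw [symbolBlock, Module.Basis.constr_basis, OrthonormalBasis.coe_toBasis]
      rfl
  exact congrArg (fun T : E₀ →ₗ[ℂ] F₀ => T e) h

/-- Multiplying by `ξ(x)` undoes the factor `ξ(x)*` in the symbol, by unitarity. -/
lemma sum_coeff_smul_symbolBlock (ξ : UnitaryIrrep G) (x : G) (i j : Fin ξ.dim) (e : E₀) :
    ∑ p, ξ.coeff i p x • symbolBlock κ A ξ x p j e =
      (A (proj τ κ fun y => ξ.coeff i j y • e)).1 x := by
  simp only [symbolBlock_apply μ hK κ hτ A, Finset.smul_sum, smul_smul]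
  rw [Finset.sum_comm]
  simp only [← Finset.sum_smul, ξ.sum_coeff_mul_star_coeff]
  simp

/-- The operator in terms of its symbol. -/
theorem apply_fourierSection (ξ : UnitaryIrrep G) (u : SmoothSection V τ) (x : G) :
    (A (fourierSection κ μ ξ u)).1 x = (ξ.dim : ℂ) • ∑ i, ∑ p, ξ.coeff i p x •
      symbol κ A ξ x (WithLp.toLp 2 fun j => fourierCoeff μ ξ u.1 j i) p := by
  rw [fourierSection, map_smul, SmoothSection.coe_smul]
  simp only [map_sum, SmoothSection.coe_sum]
  congr 1
  refine Finset.sum_congr rfl fun i _ => ?_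
  simp only [← sum_coeff_smul_symbolBlock μ hK κ hτ A]
  rw [Finset.sum_comm]
  refine Finset.sum_congr rfl fun p _ => ?_
  rw [← Finset.smul_sum]
  rfl

lemma contMDiff_symbolBlock (ξ : UnitaryIrrep G) (p j : Fin ξ.dim) (e : E₀) :
    ContMDiff 𝓘(ℝ, V) 𝓘(ℝ, F₀) ∞ fun x => symbolBlock κ A ξ x p j e := by
  simp only [symbolBlock_apply μ hK κ hτ A]
  exact contMDiff_finsetSum fun l _ => contMDiff_smul_complex (contMDiff_star_coeff μ ξ l p)
    (A (proj τ κ fun y => ξ.coeff l j y • e)).2.1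

lemma contMDiff_symbol_apply (ξ : UnitaryIrrep G) (v : PiLp 2 fun _ : Fin ξ.dim => E₀) :
    ContMDiff 𝓘(ℝ, V) 𝓘(ℝ, PiLp 2 fun _ : Fin ξ.dim => F₀) ∞ fun x => symbol κ A ξ x v := by
  have h : ContMDiff 𝓘(ℝ, V) 𝓘(ℝ, Fin ξ.dim → F₀) ∞
      (fun x p => ∑ j, symbolBlock κ A ξ x p j (v j)) :=
    contMDiff_pi_space.2 fun p => contMDiff_finsetSum fun j _ =>
      contMDiff_symbolBlock μ hK κ hτ A ξ p j (v j)
  exact ((PiLp.continuousLinearEquiv 2 ℝ fun _ : Fin ξ.dim => F₀).symm :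
    (Fin ξ.dim → F₀) →L[ℝ] PiLp 2 fun _ : Fin ξ.dim => F₀).contMDiff.comp h

omit hK hτ in
omit [CompactSpace G] [T2Space G] [MeasurableSpace G] [BorelSpace G] [FiniteDimensional ℝ V]
  [SecondCountableTopology G] [IsTopologicalGroup G] [Group G] [LieGroup 𝓘(ℝ, V) ∞ G] μ in
-- In finite dimension an operator depends linearly and continuously on its values on a basis.
lemma contMDiff_of_apply {P Q : Type*} [NormedAddCommGroup P] [NormedSpace ℂ P]
    [FiniteDimensional ℂ P] [NormedAddCommGroup Q] [NormedSpace ℂ Q] [FiniteDimensional ℂ Q]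
    {f : G → P →L[ℂ] Q} (hf : ∀ v, ContMDiff 𝓘(ℝ, V) 𝓘(ℝ, Q) ∞ fun x => f x v) :
    ContMDiff 𝓘(ℝ, V) 𝓘(ℝ, P →L[ℂ] Q) ∞ f := by
  let b := Module.finBasis ℂ P
  let Ψ : (Fin (Module.finrank ℂ P) → Q) →ₗ[ℂ] (P →L[ℂ] Q) :=
    (LinearMap.toContinuousLinearMap : (P →ₗ[ℂ] Q) ≃ₗ[ℂ] (P →L[ℂ] Q)).toLinearMap ∘ₗ
      (b.constr ℂ : (Fin (Module.finrank ℂ P) → Q) ≃ₗ[ℂ] (P →ₗ[ℂ] Q)).toLinearMap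
  let L : (Fin (Module.finrank ℂ P) → Q) →L[ℂ] (P →L[ℂ] Q) := LinearMap.toContinuousLinearMap Ψ
  have h1 : f = fun x => L.restrictScalars ℝ (fun i => f x (b i)) := by
    funext x
    refine ContinuousLinearMap.coe_injective (b.ext fun i => ?_)
    exact (b.constr_basis ℂ (fun i => f x (b i)) i).symm
  have h2 : ContMDiff 𝓘(ℝ, V) 𝓘(ℝ, Fin (Module.finrank ℂ P) → Q) ∞ fun x i => f x (b i) :=
    contMDiff_pi_space.2 fun i => hf _
  rw [h1]
  exact (L.restrictScalars ℝ).contMDiff.comp h2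

lemma contMDiff_symbol (ξ : UnitaryIrrep G) :
    ContMDiff 𝓘(ℝ, V) 𝓘(ℝ, (PiLp 2 fun _ : Fin ξ.dim => E₀) →L[ℂ] PiLp 2 fun _ : Fin ξ.dim => F₀) ∞
      (symbol κ A ξ) :=
  contMDiff_of_apply (contMDiff_symbol_apply μ hK κ hτ A ξ)

lemma lieDerivs_symbol_apply (ξ : UnitaryIrrep G) (v : PiLp 2 fun _ : Fin ξ.dim => E₀)
    (l : List (GroupLieAlgebra 𝓘(ℝ, V) G)) (x : G) :
    lieDerivs l (fun x => symbol κ A ξ x v) x = lieDerivs l (symbol κ A ξ) x v :=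
  congrFun (lieDerivs_clm (contMDiff_symbol μ hK κ hτ A ξ)
    ((ContinuousLinearMap.apply ℂ (PiLp 2 fun _ : Fin ξ.dim => F₀) v).restrictScalars ℝ) l) x

end SymbolCalculus

/-! ### The Sobolev estimate -/

lemma norm_sq_le_hsSq {W : Type*} [NormedAddCommGroup W] {d : ℕ} (c : Fin d → Fin d → W)
    (i j : Fin d) : ‖c i j‖ ^ 2 ≤ hsSq c :=
  (Finset.single_le_sum (f := fun j => ‖c i j‖ ^ 2) (fun _ _ => sq_nonneg _)
    (Finset.mem_univ j)).trans (Finset.single_le_sum (f := fun i => ∑ j, ‖c i j‖ ^ 2)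
      (fun _ _ => Finset.sum_nonneg fun _ _ => sq_nonneg _) (Finset.mem_univ i))

section Estimate

open Filter Topology

variable {V : Type*} [NormedAddCommGroup V] [NormedSpace ℝ V]
  {G : Type*} [TopologicalSpace G] [ChartedSpace V G] [Group G] [MeasurableSpace G]
  (μ : Measure G) {K : Subgroup G} (κ : Measure K)
  {E₀ : Type*} [NormedAddCommGroup E₀] [InnerProductSpace ℂ E₀] [FiniteDimensional ℂ E₀]
  {F₀ : Type*} [NormedAddCommGroup F₀] [InnerProductSpace ℂ F₀] [FiniteDimensional ℂ F₀]
  {τ : K →* (E₀ ≃ₗᵢ[ℂ] E₀)} {ρ : K →* (F₀ ≃ₗᵢ[ℂ] F₀)}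
  (A : SmoothSection V τ →ₗ[ℂ] SmoothSection V ρ)

/-- The symbol at `ξ`, applied to the `i`-th column of the Fourier coefficient of `u`. -/
def symbolColumn (u : SmoothSection V τ) (ξ : UnitaryIrrep G) (i : Fin ξ.dim) (x : G) :
    PiLp 2 fun _ : Fin ξ.dim => F₀ :=
  symbol κ A ξ x (WithLp.toLp 2 fun j => fourierCoeff μ ξ u.1 j i)

/-- The Fourier coefficients at `η` of the functions `symbolColumn`. -/
def symbolCoeff (u : SmoothSection V τ) (η : UnitaryIrrep G) (a b : Fin η.dim) : Coeffs G F₀ :=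
  fun ξ p i => fourierCoeff μ η (symbolColumn μ κ A u ξ.rep i) b a p

variable {n : ℕ} {Y X : Module.Basis (Fin n) ℝ (GroupLieAlgebra 𝓘(ℝ, V) G)} {m : ℝ}

omit [FiniteDimensional ℂ F₀] in
-- One constant for the symbol and its finitely many derivatives `X_j^k`; absolute values are taken
-- because the given constants carry no sign.
lemma exists_norm_symbol_le (hsymbol : ∀ α : Fin n → ℕ, ∃ C : ℝ, ∀ (ξ : UnitaryDual G) (x : G),
      ‖multiDeriv X α (symbol κ A ξ.rep) x‖ ≤ C * (ξ.rep.weight Y) ^ m) (k : ℕ) :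
    ∃ M : ℝ, 0 ≤ M ∧ ∀ (ξ : UnitaryDual G) (x : G),
      ‖symbol κ A ξ.rep x‖ ≤ M * (ξ.rep.weight Y) ^ m ∧
      ∀ j, ‖lieDerivs (List.replicate k (X j)) (symbol κ A ξ.rep) x‖ ≤
        M * (ξ.rep.weight Y) ^ m := by
  obtain ⟨C₀, h₀⟩ := hsymbol 0
  choose C h using fun j : Fin n => hsymbol (Pi.single j k)
  have hs : 0 ≤ ∑ j, |C j| := Finset.sum_nonneg fun _ _ => abs_nonneg _
  refine ⟨|C₀| + ∑ j, |C j|, by positivity, fun ξ x => ⟨?_, fun j => ?_⟩⟩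
  · have h1 := h₀ ξ x
    rw [multiDeriv_zero] at h1
    refine h1.trans (mul_le_mul_of_nonneg_right ?_ (Real.rpow_nonneg (ξ.rep.weight_pos Y).le _))
    exact (le_abs_self _).trans (le_add_of_nonneg_right hs)
  · have h1 := h j ξ x
    rw [multiDeriv_single] at h1
    refine h1.trans (mul_le_mul_of_nonneg_right ?_ (Real.rpow_nonneg (ξ.rep.weight_pos Y).le _))
    exact (le_abs_self _).trans ((Finset.single_le_sum (f := fun j => |C j|)
      (fun _ _ => abs_nonneg _) (Finset.mem_univ j)).trans (le_add_of_nonneg_left (abs_nonneg _)))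

variable [LieGroup 𝓘(ℝ, V) ∞ G]
  [CompactSpace G] [T2Space G] [BorelSpace G] [FiniteDimensional ℝ V]
  [SecondCountableTopology G] [IsTopologicalGroup G]
  [μ.IsHaarMeasure] [IsProbabilityMeasure μ] [κ.IsHaarMeasure] [IsProbabilityMeasure κ]
  (hK : IsClosed (K : Set G)) (hτ : ∀ v, Continuous fun k => τ k v)

include hK hτ

lemma contMDiff_symbolColumn (u : SmoothSection V τ) (ξ : UnitaryIrrep G) (i : Fin ξ.dim) :
    ContMDiff 𝓘(ℝ, V) 𝓘(ℝ, PiLp 2 fun _ : Fin ξ.dim => F₀) ∞ (symbolColumn μ κ A u ξ i) :=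
  contMDiff_symbol_apply μ hK κ hτ A ξ _

/-- Decay in `η` comes from smoothness in `x`: the function `x ↦ σ(ξ,x) v_i`, with `v_i` a column of
`û(ξ)`, has its `X_j^k`-derivatives bounded by `M ⟨ξ⟩^m ‖v_i‖`. Summing the squares over the columns
produces the Hilbert-Schmidt norm of `û(ξ)`. -/
lemma exists_hsSq_symbolCoeff_le
    {B : LinearMap.BilinForm ℝ (GroupLieAlgebra 𝓘(ℝ, V) G)}
    (hB : IsBiInvariant B) (hY : ∀ i j, B (Y i) (Y j) = if i = j then 1 else 0)
    (hsymbol : ∀ α : Fin n → ℕ, ∃ C : ℝ, ∀ (ξ : UnitaryDual G) (x : G),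
      ‖multiDeriv X α (symbol κ A ξ.rep) x‖ ≤ C * (ξ.rep.weight Y) ^ m) (k : ℕ) :
    ∃ C : ℝ, 0 ≤ C ∧ ∀ (u : SmoothSection V τ) (η ξ : UnitaryDual G) (a b : Fin η.rep.dim),
      η.rep.weight Y ^ (2 * k) * hsSq (symbolCoeff μ κ A u η.rep a b ξ) ≤
        C * ((ξ.rep.weight Y ^ m) ^ 2 * hsSq (fourierCoeff μ ξ.rep u.1)) := by
  have : CompleteSpace F₀ := FiniteDimensional.complete ℂ F₀
  obtain ⟨M, hM, hMbound⟩ := exists_norm_symbol_le κ A hsymbol k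
  obtain ⟨C, hC, hdecay⟩ := exists_weight_pow_mul_dim_mul_hsSq_le μ hB hY X k
  refine ⟨C * M ^ 2, by positivity, fun u η ξ a b => ?_⟩
  have hw := ξ.rep.weight_pos Y
  have hwη := η.rep.weight_pos Y
  let v : Fin ξ.rep.dim → PiLp 2 fun _ : Fin ξ.rep.dim => E₀ := fun i =>
    WithLp.toLp 2 fun j => fourierCoeff μ ξ.rep u.1 j i
  have h1 : ∀ i, η.rep.weight Y ^ (2 * k) *
      hsSq (fourierCoeff μ η.rep (symbolColumn μ κ A u ξ.rep i)) ≤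
        C * (M * ξ.rep.weight Y ^ m * ‖v i‖) ^ 2 := fun i => by
    refine le_trans ?_ (hdecay (symbolColumn μ κ A u ξ.rep i) (M * ξ.rep.weight Y ^ m * ‖v i‖)
      (contMDiff_symbolColumn μ κ A hK hτ u ξ.rep i) (fun x => ?_) (fun j x => ?_) η)
    · refine mul_le_mul_of_nonneg_left ?_ (pow_nonneg hwη.le _)
      refine le_mul_of_one_le_left (hsSq_nonneg _) ?_
      exact_mod_cast η.rep.dim_pos
    · exact (symbol κ A ξ.rep x).le_of_opNorm_le (hMbound ξ x).1 (v i)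
    · have h2 := lieDerivs_symbol_apply μ hK κ hτ A ξ.rep (v i) (List.replicate k (X j)) x
      exact (congrArg norm h2).trans_le
        (ContinuousLinearMap.le_of_opNorm_le _ ((hMbound ξ x).2 j) (v i))
  have h4 : ∀ w : PiLp 2 fun _ : Fin ξ.rep.dim => F₀, ‖w‖ ^ 2 = ∑ p, ‖w p‖ ^ 2 :=
    PiLp.norm_sq_eq_of_L2 _
  have h3 : hsSq (symbolCoeff μ κ A u η.rep a b ξ) ≤
      ∑ i, hsSq (fourierCoeff μ η.rep (symbolColumn μ κ A u ξ.rep i)) := by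
    rw [hsSq, Finset.sum_comm]
    refine Finset.sum_le_sum fun i _ => ?_
    exact (h4 (fourierCoeff μ η.rep (symbolColumn μ κ A u ξ.rep i) b a)).symm.trans_le
      (norm_sq_le_hsSq _ b a)
  have h5 : ∑ i, ‖v i‖ ^ 2 = hsSq (fourierCoeff μ ξ.rep u.1) := by
    rw [hsSq, Finset.sum_comm]
    exact Finset.sum_congr rfl fun i _ => PiLp.norm_sq_eq_of_L2 _ (v i)
  calc _ ≤ η.rep.weight Y ^ (2 * k) *
          ∑ i, hsSq (fourierCoeff μ η.rep (symbolColumn μ κ A u ξ.rep i)) := by gcongr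
    _ ≤ ∑ i, C * (M * ξ.rep.weight Y ^ m * ‖v i‖) ^ 2 := by
        rw [Finset.mul_sum]
        exact Finset.sum_le_sum fun i _ => h1 i
    _ = C * M ^ 2 * ((ξ.rep.weight Y ^ m) ^ 2 * ∑ i, ‖v i‖ ^ 2) := by
        simp only [Finset.mul_sum]
        exact Finset.sum_congr rfl fun i _ => by ring
    _ = _ := by rw [h5]

/-- The expansion of the symbol in a Fourier series. -/
lemma hasSum_apply_fourierSection
    {B : LinearMap.BilinForm ℝ (GroupLieAlgebra 𝓘(ℝ, V) G)}
    (hB : IsBiInvariant B) (hY : ∀ i j, B (Y i) (Y j) = if i = j then 1 else 0)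
    (u : SmoothSection V τ) (ξ : UnitaryDual G) (x : G) :
    HasSum (fun η : UnitaryDual G => (η.rep.dim : ℂ) • ∑ a, ∑ b, η.rep.coeff a b x •
      trigTerm ξ.rep (symbolCoeff μ κ A u η.rep a b ξ) x)
      ((A (fourierSection κ μ ξ.rep u)).1 x) := by
  have : CompleteSpace F₀ := FiniteDimensional.complete ℂ F₀
  have h1 : ∀ i p, HasSum (fun η : UnitaryDual G => (η.rep.dim : ℂ) • ∑ a, ∑ b,
      η.rep.coeff a b x • symbolCoeff μ κ A u η.rep a b ξ p i)
      (symbolColumn μ κ A u ξ.rep i x p) := fun i p => by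
    have hf := contMDiff_symbolColumn μ κ A hK hτ u ξ.rep i
    obtain ⟨b, hb, hb'⟩ := exists_summable_norm_trigTerm_fourierCoeff_le μ hB hY hf
    have h2 := hasSum_trigSeries hb hb' x
    rw [trigSeries_fourierCoeff μ hf.continuous hb hb'] at h2
    refine (h2.mapL (PiLp.proj (𝕜 := ℂ) 2 (fun _ : Fin ξ.rep.dim => F₀) p)).congr_fun ?_
    intro η
    simp only [trigTerm, map_smul, map_sum]
    rfl
  rw [apply_fourierSection μ hK κ hτ A]
  have h3 := (hasSum_sum (s := Finset.univ) fun i _ => hasSum_sum (s := Finset.univ) fun p _ =>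
    (h1 i p).const_smul (ξ.rep.coeff i p x)).const_smul (ξ.rep.dim : ℂ)
  refine h3.congr_fun fun η => ?_
  simp only [trigTerm, Finset.smul_sum, smul_smul]
  rw [Finset.sum_congr rfl fun a _ => Finset.sum_comm, Finset.sum_comm]
  refine Finset.sum_congr rfl fun i _ => ?_
  rw [Finset.sum_congr rfl fun a _ => Finset.sum_comm, Finset.sum_comm]
  refine Finset.sum_congr rfl fun p _ => Finset.sum_congr rfl fun a _ =>
    Finset.sum_congr rfl fun b _ => ?_
  congr 1
  ring

end Estimate

/-! ### Summing the expansion of the symbol: the Sobolev bound for finite sums. -/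

section Estimate

open Filter Topology

variable {V : Type*} [NormedAddCommGroup V] [NormedSpace ℝ V]
  {G : Type*} [TopologicalSpace G] [ChartedSpace V G] [Group G] [MeasurableSpace G]
  [LieGroup 𝓘(ℝ, V) ∞ G] [CompactSpace G] [T2Space G] [BorelSpace G] [FiniteDimensional ℝ V]
  [SecondCountableTopology G] [IsTopologicalGroup G]
  (μ : Measure G) [μ.IsHaarMeasure] [IsProbabilityMeasure μ]
  {n : ℕ} {Y : Module.Basis (Fin n) ℝ (GroupLieAlgebra 𝓘(ℝ, V) G)}
  {B : LinearMap.BilinForm ℝ (GroupLieAlgebra 𝓘(ℝ, V) G)}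

lemma exists_norm_sobolevVec_coeff_smul_le {W : Type*} [NormedAddCommGroup W]
    [InnerProductSpace ℂ W] [CompleteSpace W]
    (hB : IsBiInvariant B) (hY : ∀ i j, B (Y i) (Y j) = if i = j then 1 else 0) (t : ℝ) :
    ∃ (C : ℝ) (q : ℕ), 0 ≤ C ∧ ∀ (η : UnitaryIrrep G) (a b : Fin η.dim) (c : Coeffs G W)
      (S Z : Finset (UnitaryDual G)),
      ‖sobolevVec μ Y t Z fun x => η.coeff a b x • ∑ ξ ∈ S, trigTerm ξ.rep (c ξ) x‖ ≤
        C * η.weight Y ^ q * Real.sqrt (∑ ξ ∈ S, sobolevWeight Y t ξ * hsSq (c ξ)) := by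
  obtain ⟨q, hq⟩ := exists_nat_ge |t|
  -- With `z = 2⟨η⟩` and `|t| ≤ q`, the squared bound is at most `3 z^(8q)`, which is less than `(2
  -- z^(4q))²`.
  refine ⟨2 * 2 ^ (4 * q), 4 * q, by positivity, fun η a b c S Z => ?_⟩
  have hw := η.weight_pos Y
  have hw1 := η.one_le_weight Y
  set N := ∑ ξ ∈ S, sobolevWeight Y t ξ * hsSq (c ξ) with hN
  have hN0 : 0 ≤ N := Finset.sum_nonneg fun ξ _ =>
    mul_nonneg (sobolevWeight_nonneg _ _ _) (hsSq_nonneg _)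
  refine le_of_sq_le_sq ?_ (by positivity)
  rw [norm_sobolevVec_sq]
  refine (sum_sobolevWeight_mul_hsSq_le μ hB hY t η a b c S Z).trans ?_
  have h1 : ((2 * η.weight Y) ^ 2) ^ |t| ≤ ((2 * η.weight Y) ^ 2) ^ q := by
    rw [← Real.rpow_natCast _ q]
    exact Real.rpow_le_rpow_of_exponent_le (one_le_pow₀ (by linarith)) hq
  rw [mul_assoc 2, ← mul_pow, mul_pow _ (Real.sqrt N), Real.sq_sqrt hN0]
  generalize 2 * η.weight Y = z at h1 ⊢
  calc 3 * (((z ^ 2) ^ |t|) ^ 2) ^ 2 * N ≤ 4 * (((z ^ 2) ^ q) ^ 2) ^ 2 * N := by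
        gcongr
        norm_num
    _ = (2 * z ^ (4 * q)) ^ 2 * N := by ring

variable {K : Subgroup G} (κ : Measure K) [κ.IsHaarMeasure] [IsProbabilityMeasure κ]
  {E₀ : Type*} [NormedAddCommGroup E₀] [InnerProductSpace ℂ E₀] [FiniteDimensional ℂ E₀]
  {F₀ : Type*} [NormedAddCommGroup F₀] [InnerProductSpace ℂ F₀] [FiniteDimensional ℂ F₀]
  {τ : K →* (E₀ ≃ₗᵢ[ℂ] E₀)} {ρ : K →* (F₀ ≃ₗᵢ[ℂ] F₀)}
  (A : SmoothSection V τ →ₗ[ℂ] SmoothSection V ρ)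
  {X : Module.Basis (Fin n) ℝ (GroupLieAlgebra 𝓘(ℝ, V) G)} {m : ℝ}
  (hK : IsClosed (K : Set G)) (hτ : ∀ v, Continuous fun k => τ k v)

include hK hτ

/-- The Sobolev estimate for finite sums of components of a section. -/
theorem exists_norm_sobolevVec_sum_le
    (hB : IsBiInvariant B) (hY : ∀ i j, B (Y i) (Y j) = if i = j then 1 else 0)
    (hsymbol : ∀ α : Fin n → ℕ, ∃ C : ℝ, ∀ (ξ : UnitaryDual G) (x : G),
      ‖multiDeriv X α (symbol κ A ξ.rep) x‖ ≤ C * (ξ.rep.weight Y) ^ m) (s : ℝ) :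
    ∃ C : ℝ, 0 ≤ C ∧ ∀ (u : SmoothSection V τ) (S Z : Finset (UnitaryDual G)),
      ‖sobolevVec μ Y (s - m) Z fun x => ∑ ξ ∈ S, (A (fourierSection κ μ ξ.rep u)).1 x‖ ≤
        C * Real.sqrt (∑ ξ ∈ S, sobolevWeight Y s ξ * hsSq (fourierCoeff μ ξ.rep u.1)) := by
  have : CompleteSpace F₀ := FiniteDimensional.complete ℂ F₀
  obtain ⟨p, hp⟩ := exists_summable_dim_sq_div μ hB hY
  set w : UnitaryDual G → ℝ := fun η => η.rep.weight Y with hw_def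
  set d : UnitaryDual G → ℝ := fun η => η.rep.dim with hd_def
  have hw : ∀ η, 0 < w η := fun η => η.rep.weight_pos Y
  have hw1 : ∀ η, 1 ≤ w η := fun η => η.rep.one_le_weight Y
  have hd0 : ∀ η, 0 ≤ d η := fun η => Nat.cast_nonneg _
  have hd1 : ∀ η, 1 ≤ d η := fun η => Nat.one_le_cast.2 η.rep.dim_pos
  have hterm : ∀ η, 0 ≤ d η ^ 2 / w η ^ p := fun η =>
    div_nonneg (sq_nonneg _) (pow_nonneg (hw η).le _)
  set C₁ : ℝ := ∑' η, d η ^ 2 / w η ^ p with hC₁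
  have hC₁0 : 0 ≤ C₁ := tsum_nonneg hterm
  -- A single term of a convergent series of nonnegative terms is at most its sum; this bounds
  -- dimensions polynomially.
  have hdw : ∀ η, d η ≤ C₁ * w η ^ p := fun η => by
    have h1 := hp.le_tsum η fun j _ => hterm j
    rw [div_le_iff₀ (pow_pos (hw η) p)] at h1
    exact (le_self_pow₀ (hd1 η) two_ne_zero).trans h1
  obtain ⟨C₂, q, hC₂, hmul⟩ := exists_norm_sobolevVec_coeff_smul_le (W := F₀) μ hB hY (s - m)
  -- The decay order `2p + q` pays `q` for multiplication by a coefficient, `p` for one of the three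
  -- powers of `d_η` (from the prefactor and the sums over `a`, `b`), and `p` for summability of the
  -- other two.
  obtain ⟨C₃, hC₃, hsym⟩ := exists_hsSq_symbolCoeff_le μ κ A hK hτ hB hY hsymbol (2 * p + q)
  have hcube : ∀ η, d η ^ 3 * w η ^ q / w η ^ (2 * p + q) ≤ C₁ * (d η ^ 2 / w η ^ p) := fun η => by
    have := hw η
    rw [div_le_iff₀ (pow_pos (hw η) _)]
    calc d η ^ 3 * w η ^ q = d η * (d η ^ 2 * w η ^ q) := by ring
      _ ≤ C₁ * w η ^ p * (d η ^ 2 * w η ^ q) :=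
          mul_le_mul_of_nonneg_right (hdw η) (by positivity)
      _ = _ := by
          field_simp
          ring
  refine ⟨C₁ * C₂ * Real.sqrt C₃ * C₁, by positivity, fun u S Z => ?_⟩
  set N := ∑ ξ ∈ S, sobolevWeight Y s ξ * hsSq (fourierCoeff μ ξ.rep u.1) with hN
  -- The order of summation is exchanged: for fixed `η`, `v` is a multiplication operator applied to
  -- a Fourier multiplier of `u`.
  let v : (η : UnitaryDual G) → Fin η.rep.dim → Fin η.rep.dim → G → F₀ := fun η a b x =>
    η.rep.coeff a b x • ∑ ξ ∈ S, trigTerm ξ.rep (symbolCoeff μ κ A u η.rep a b ξ) x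
  have hv : ∀ η a b, Continuous (v η a b) := fun η a b =>
    (η.rep.continuous_coeff a b).smul (continuous_finsetSum _ fun ξ _ => continuous_trigTerm _ _)
  let g : UnitaryDual G → G → F₀ := fun η x => ∑ a, ∑ b, (η.rep.dim : ℂ) • v η a b x
  have hg : ∀ η, Continuous (g η) := fun η => continuous_finsetSum _ fun a _ =>
    continuous_finsetSum _ fun b _ => (hv η a b).const_smul _
  have hsqrt : ∀ η ξ a b, Real.sqrt (hsSq (symbolCoeff μ κ A u η.rep a b ξ)) ≤
      Real.sqrt (C₃ * ((ξ.rep.weight Y ^ m) ^ 2 * hsSq (fourierCoeff μ ξ.rep u.1))) /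
        w η ^ (2 * p + q) := fun η ξ a b => by
    rw [le_div_iff₀ (pow_pos (hw η) _)]
    refine (Real.sqrt_le_sqrt (hsym u η ξ a b)).trans_eq' ?_
    rw [pow_mul', Real.sqrt_mul (sq_nonneg _), Real.sqrt_sq (pow_nonneg (hw η).le _), mul_comm]
  -- uniform convergence of the expansion
  have hsum : ∀ x, HasSum (fun η => g η x) (∑ ξ ∈ S, (A (fourierSection κ μ ξ.rep u)).1 x) := by
    intro x
    refine (hasSum_sum fun ξ (_ : ξ ∈ S) =>
      hasSum_apply_fourierSection μ κ A hK hτ hB hY u ξ x).congr_fun fun η => ?_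
    simp only [g, v, Finset.smul_sum]
    rw [Finset.sum_congr rfl fun a _ => Finset.sum_comm, Finset.sum_comm]
  -- This crude bound depends on `u` and `S`; it serves only for uniform convergence in `η`, not for
  -- the final constant.
  have hgbound : ∃ D : ℝ, ∀ η x, ‖g η x‖ ≤ D * (d η ^ 2 / w η ^ p) := by
    set T : ℝ := ∑ ξ ∈ S, d ξ * (Real.sqrt (d ξ) * Real.sqrt (C₃ *
      ((ξ.rep.weight Y ^ m) ^ 2 * hsSq (fourierCoeff μ ξ.rep u.1)))) with hT
    have hT0 : 0 ≤ T := Finset.sum_nonneg fun ξ _ => by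
      have := hd0 ξ
      positivity
    refine ⟨C₁ * T, fun η x => ?_⟩
    have h1 : ∀ a b, ‖v η a b x‖ ≤ T / w η ^ (2 * p + q) := fun a b => by
      rw [norm_smul]
      refine (mul_le_of_le_one_left (norm_nonneg _) (η.rep.norm_coeff_le_one a b x)).trans ?_
      rw [hT, Finset.sum_div]
      refine (norm_sum_le _ _).trans (Finset.sum_le_sum fun ξ _ => ?_)
      refine (norm_trigTerm_le ξ.rep _ x).trans ?_
      rw [mul_div_assoc, mul_div_assoc]
      exact mul_le_mul_of_nonneg_left (mul_le_mul_of_nonneg_left (hsqrt η ξ a b)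
        (Real.sqrt_nonneg _)) (hd0 ξ)
    calc ‖g η x‖ ≤ ∑ a : Fin η.rep.dim, ∑ b : Fin η.rep.dim, d η * (T / w η ^ (2 * p + q)) := by
          refine (norm_sum_le _ _).trans (Finset.sum_le_sum fun a _ => (norm_sum_le _ _).trans
            (Finset.sum_le_sum fun b _ => ?_))
          rw [norm_smul, Complex.norm_natCast]
          exact mul_le_mul_of_nonneg_left (h1 a b) (hd0 η)
      _ = T * (d η ^ 3 * 1 / w η ^ (2 * p + q)) := by
          simp only [Finset.sum_const, Finset.card_univ, Fintype.card_fin, nsmul_eq_mul]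
          ring
      _ ≤ T * (d η ^ 3 * w η ^ q / w η ^ (2 * p + q)) := by
          have := hw η
          have := hd0 η
          gcongr
          exact one_le_pow₀ (hw1 η)
      _ ≤ T * (C₁ * (d η ^ 2 / w η ^ p)) := mul_le_mul_of_nonneg_left (hcube η) hT0
      _ = _ := by ring
  obtain ⟨D, hD⟩ := hgbound
  have hunif : TendstoUniformly (fun (H : Finset (UnitaryDual G)) x => ∑ η ∈ H, g η x)
      (fun x => ∑ ξ ∈ S, (A (fourierSection κ μ ξ.rep u)).1 x) atTop := by
    have h1 := tendstoUniformly_tsum (hp.mul_left D) hD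
    have h2 : (fun x => ∑' η, g η x) = fun x => ∑ ξ ∈ S, (A (fourierSection κ μ ξ.rep u)).1 x :=
      funext fun x => (hsum x).tsum_eq
    rwa [h2] at h1
  have hcont : Continuous fun x => ∑ ξ ∈ S, (A (fourierSection κ μ ξ.rep u)).1 x :=
    continuous_finsetSum _ fun ξ _ => (A (fourierSection κ μ ξ.rep u)).2.1.continuous
  refine le_of_tendsto (tendsto_sobolevVec μ Y (s - m) Z hunif
    (fun H => continuous_finsetSum _ fun η _ => hg η) hcont).norm (Eventually.of_forall fun H => ?_)
  -- the estimate for one term of the expansion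
  have hone : ∀ η, ‖sobolevVec μ Y (s - m) Z (g η)‖ ≤
      C₁ * C₂ * Real.sqrt C₃ * Real.sqrt N * (d η ^ 2 / w η ^ p) := by
    intro η
    have hwη := hw η
    have hdη := hd0 η
    have h1 : ∀ a b, Real.sqrt (∑ ξ ∈ S, sobolevWeight Y (s - m) ξ *
        hsSq (symbolCoeff μ κ A u η.rep a b ξ)) ≤
          Real.sqrt C₃ * Real.sqrt N / w η ^ (2 * p + q) := fun a b => by
      rw [le_div_iff₀ (pow_pos hwη _), ← Real.sqrt_mul hC₃]
      have h5 : ∀ z : ℝ, Real.sqrt z * w η ^ (2 * p + q) =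
          Real.sqrt ((w η ^ (2 * p + q)) ^ 2 * z) := fun z => by
        rw [Real.sqrt_mul (sq_nonneg _), Real.sqrt_sq (pow_nonneg hwη.le _), mul_comm]
      rw [h5]
      refine Real.sqrt_le_sqrt ?_
      rw [hN, Finset.mul_sum, Finset.mul_sum]
      refine Finset.sum_le_sum fun ξ _ => ?_
      -- The order `m` of the multiplier accounts exactly for the shift from `s` to `s - m`.
      have h2 : sobolevWeight Y s ξ =
          sobolevWeight Y (s - m) ξ * (ξ.rep.weight Y ^ m) ^ 2 := by
        rw [sobolevWeight, sobolevWeight, mul_assoc, ← mul_pow,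
          ← Real.rpow_add (ξ.rep.weight_pos Y), sub_add_cancel]
      have h3 := mul_le_mul_of_nonneg_left (hsym u η ξ a b)
        (sobolevWeight_nonneg Y (s - m) ξ)
      rw [pow_mul'] at h3
      rw [h2]
      calc _ = sobolevWeight Y (s - m) ξ * ((w η ^ (2 * p + q)) ^ 2 *
            hsSq (symbolCoeff μ κ A u η.rep a b ξ)) := by ring
        _ ≤ _ := h3
        _ = _ := by ring
    have h4 : sobolevVec μ Y (s - m) Z (g η) =
        ∑ a, ∑ b, (η.rep.dim : ℂ) • sobolevVec μ Y (s - m) Z (v η a b) := by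
      refine (sobolevVec_sum μ Y (s - m) Z Finset.univ fun a => continuous_finsetSum _ fun b _ =>
        (hv η a b).const_smul _).trans (Finset.sum_congr rfl fun a _ => ?_)
      refine (sobolevVec_sum μ Y (s - m) Z Finset.univ fun b =>
        (hv η a b).const_smul _).trans (Finset.sum_congr rfl fun b _ => ?_)
      exact sobolevVec_smul μ Y (s - m) Z _ _
    rw [h4]
    calc _ ≤ ∑ a : Fin η.rep.dim, ∑ b : Fin η.rep.dim, d η * (C₂ * w η ^ q *
            (Real.sqrt C₃ * Real.sqrt N / w η ^ (2 * p + q))) := by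
          refine (norm_sum_le _ _).trans (Finset.sum_le_sum fun a _ => (norm_sum_le _ _).trans
            (Finset.sum_le_sum fun b _ => ?_))
          rw [norm_smul, Complex.norm_natCast]
          refine mul_le_mul_of_nonneg_left ((hmul η.rep a b _ S Z).trans ?_) hdη
          exact mul_le_mul_of_nonneg_left (h1 a b) (by positivity)
      _ = C₂ * Real.sqrt C₃ * Real.sqrt N * (d η ^ 3 * w η ^ q / w η ^ (2 * p + q)) := by
          simp only [Finset.sum_const, Finset.card_univ, Fintype.card_fin, nsmul_eq_mul]
          ring
      _ ≤ C₂ * Real.sqrt C₃ * Real.sqrt N * (C₁ * (d η ^ 2 / w η ^ p)) :=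
          mul_le_mul_of_nonneg_left (hcube η) (by positivity)
      _ = _ := by ring
  rw [sobolevVec_sum μ Y (s - m) Z H hg]
  calc _ ≤ ∑ η ∈ H, C₁ * C₂ * Real.sqrt C₃ * Real.sqrt N * (d η ^ 2 / w η ^ p) :=
        (norm_sum_le _ _).trans (Finset.sum_le_sum fun η _ => hone η)
    _ = C₁ * C₂ * Real.sqrt C₃ * Real.sqrt N * ∑ η ∈ H, d η ^ 2 / w η ^ p :=
        (Finset.mul_sum _ _ _).symm
    _ ≤ C₁ * C₂ * Real.sqrt C₃ * Real.sqrt N * C₁ := by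
        gcongr
        exact hp.sum_le_tsum H fun η _ => hterm η
    _ = _ := by ring

end Estimate

/-! ### Sobolev spaces of sections -/

section SobolevNorm

open Filter Topology

variable {V : Type*} [NormedAddCommGroup V] [NormedSpace ℝ V]
  {G : Type*} [TopologicalSpace G] [ChartedSpace V G] [Group G] [LieGroup 𝓘(ℝ, V) ∞ G]
  [CompactSpace G] [T2Space G] [MeasurableSpace G] [BorelSpace G] [FiniteDimensional ℝ V]
  [SecondCountableTopology G] [IsTopologicalGroup G] {n : ℕ}
  (μ : Measure G) [μ.IsHaarMeasure] [IsProbabilityMeasure μ]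
  {Y : Module.Basis (Fin n) ℝ (GroupLieAlgebra 𝓘(ℝ, V) G)}
  {B : LinearMap.BilinForm ℝ (GroupLieAlgebra 𝓘(ℝ, V) G)}
  {K : Subgroup G}
  {E₀ : Type*} [NormedAddCommGroup E₀] [InnerProductSpace ℂ E₀] [FiniteDimensional ℂ E₀]
  {τ : K →* (E₀ ≃ₗᵢ[ℂ] E₀)}

lemma xiTerm_eq_trigTerm (Y : Fin n → GroupLieAlgebra 𝓘(ℝ, V) G) (s : ℝ) (u : G → E₀) (x : G)
    (ξ : UnitaryDual G) :
    xiTerm Y s μ u x ξ =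
      trigTerm ξ.rep (((ξ.rep.weight Y ^ s : ℝ) : ℂ) • fourierCoeff μ ξ.rep u) x := by
  rw [trigTerm_smul, xiTerm, fourierTerm_eq_trigTerm]

lemma xiPow_eq_trigSeries (Y : Fin n → GroupLieAlgebra 𝓘(ℝ, V) G) (s : ℝ) (u : G → E₀) :
    xiPow Y s μ u =
      trigSeries fun ξ => ((ξ.rep.weight Y ^ s : ℝ) : ℂ) • fourierCoeff μ ξ.rep u :=
  funext fun x => tsum_congr fun ξ => xiTerm_eq_trigTerm μ Y s u x ξ

/-- Every smooth section lies in the domain of `Ξ^s`. -/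
theorem mem_sobolevDomain (hB : IsBiInvariant B)
    (hY : ∀ i j, B (Y i) (Y j) = if i = j then 1 else 0) (s : ℝ) (u : SmoothSection V τ) :
    u ∈ sobolevDomain Y s μ τ := by
  have : CompleteSpace E₀ := FiniteDimensional.complete ℂ E₀
  obtain ⟨b, hb, hub⟩ := exists_summable_norm_trigTerm_le μ hB hY s u.2.1
  refine ⟨fun x => ?_, ?_⟩
  · have h1 := (hasSum_trigSeries hb hub x).summable
    exact h1.congr fun ξ => (xiTerm_eq_trigTerm μ Y s u.1 x ξ).symm
  · rw [xiPow_eq_trigSeries]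
    exact (continuous_trigSeries hb hub).memLp_of_hasCompactSupport
      (HasCompactSupport.of_compactSpace _)

/-- The Plancherel formula for the Sobolev norm. -/
theorem hasSum_norm_preSobolev_sq (hB : IsBiInvariant B)
    (hY : ∀ i j, B (Y i) (Y j) = if i = j then 1 else 0) (s : ℝ) (u : PreSobolev Y s μ τ) :
    HasSum (fun ξ => sobolevWeight Y s ξ * hsSq (fourierCoeff μ ξ.rep u.1.1)) (‖u‖ ^ 2) := by
  have : CompleteSpace E₀ := FiniteDimensional.complete ℂ E₀
  obtain ⟨b, hb, hub⟩ := exists_summable_norm_trigTerm_le μ hB hY s u.1.2.1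
  have h1 := hasSum_integral_norm_trigSeries_sq μ hb hub
  have h2 : ‖u‖ ^ 2 = ∫ x, ‖xiPow Y s μ u.1.1 x‖ ^ 2 ∂μ := by
    have h3 : ‖u‖ = ‖MemLp.toLp (xiPow Y s μ u.1.1) u.2.2‖ := rfl
    have h4 := inner_self_eq_norm_sq_to_K (𝕜 := ℂ) (MemLp.toLp (xiPow Y s μ u.1.1) u.2.2)
    rw [L2.inner_def] at h4
    have h5 : ∫ x, inner ℂ ((MemLp.toLp (xiPow Y s μ u.1.1) u.2.2 : Lp E₀ 2 μ) x)
        ((MemLp.toLp (xiPow Y s μ u.1.1) u.2.2 : Lp E₀ 2 μ) x) ∂μ =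
        ∫ x, ((‖xiPow Y s μ u.1.1 x‖ ^ 2 : ℝ) : ℂ) ∂μ := by
      refine integral_congr_ae ?_
      filter_upwards [MemLp.coeFn_toLp u.2.2] with x hx
      rw [hx, inner_self_eq_norm_sq_to_K]
      push_cast
      rfl
    rw [h5, integral_complex_ofReal] at h4
    rw [h3]
    refine Complex.ofReal_injective ?_
    rw [Complex.ofReal_pow]
    exact h4.symm
  rw [h2, xiPow_eq_trigSeries]
  refine h1.congr_fun fun ξ => ?_
  rw [hsSq_smul, Complex.norm_real, Real.norm_eq_abs, sq_abs, sobolevWeight, mul_assoc]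

variable (κ : Measure K) [κ.IsHaarMeasure] [IsProbabilityMeasure κ]
  {F₀ : Type*} [NormedAddCommGroup F₀] [InnerProductSpace ℂ F₀] [FiniteDimensional ℂ F₀]
  {ρ : K →* (F₀ ≃ₗᵢ[ℂ] F₀)}
  (A : SmoothSection V τ →ₗ[ℂ] SmoothSection V ρ)
  {X : Module.Basis (Fin n) ℝ (GroupLieAlgebra 𝓘(ℝ, V) G)} {m : ℝ}

/-- Convergence in `Γ(E)` implies uniform convergence. -/
lemma SmoothSection.tendstoUniformly {ι : Type*} {l : Filter ι} {F : ι → SmoothSection V τ}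
    {u : SmoothSection V τ} (h : Tendsto F l (𝓝 u)) :
    TendstoUniformly (fun i => (F i).1) u.1 l := by
  rw [nhds_iInf, tendsto_iInf] at h
  have h1 := h []
  rw [nhds_induced, tendsto_comap_iff] at h1
  exact UniformFun.tendsto_iff_tendstoUniformly.1 h1

/-- The Sobolev estimate for smooth sections. -/
theorem exists_norm_apply_le (hK : IsClosed (K : Set G)) (hτ : ∀ v, Continuous fun k => τ k v)
    (hA : Continuous A) (hB : IsBiInvariant B)
    (hY : ∀ i j, B (Y i) (Y j) = if i = j then 1 else 0)
    (hsymbol : ∀ α : Fin n → ℕ, ∃ C : ℝ, ∀ (ξ : UnitaryDual G) (x : G),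
      ‖multiDeriv X α (symbol κ A ξ.rep) x‖ ≤ C * (ξ.rep.weight Y) ^ m) (s : ℝ) :
    ∃ C : ℝ, 0 ≤ C ∧ ∀ (u : PreSobolev Y s μ τ) (v : PreSobolev Y (s - m) μ ρ),
      v.1 = A u.1 → ‖v‖ ≤ C * ‖u‖ := by
  obtain ⟨C, hC, h⟩ := exists_norm_sobolevVec_sum_le μ κ A hK hτ hB hY hsymbol s
  refine ⟨C, hC, fun u v huv => le_of_sq_le_sq ?_ (by positivity)⟩
  have hu := hasSum_norm_preSobolev_sq μ hB hY s u
  have hv := hasSum_norm_preSobolev_sq μ hB hY (s - m) v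
  -- It suffices to bound each finite truncation of the target norm, uniformly in `Z`.
  refine hasSum_le_of_sum_le hv fun Z => ?_
  rw [← norm_sobolevVec_sq, huv]
  refine pow_le_pow_left₀ (norm_nonneg _) ?_ 2
  -- Continuity of `A` on `Γ(E)` enters here: it may be applied termwise to the Fourier series,
  -- which converges in `C^∞`.
  have h1 : Tendsto (fun S : Finset (UnitaryDual G) => ∑ ξ ∈ S, A (fourierSection κ μ ξ.rep u.1)) atTop (𝓝 (A u.1)) := by
    have h2 := (hA.tendsto u.1).comp (tendsto_sum_fourierSection μ hK κ hτ hB hY u.1)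
    exact h2.congr fun S => map_sum A (fun ξ : UnitaryDual G => fourierSection κ μ ξ.rep u.1) S
  refine le_of_tendsto (tendsto_sobolevVec μ Y (s - m) Z (SmoothSection.tendstoUniformly h1)
    (fun S => (∑ ξ ∈ S, A (fourierSection κ μ ξ.rep u.1)).2.1.continuous)
    (A u.1).2.1.continuous).norm (Eventually.of_forall fun S => ?_)
  have h3 : (∑ ξ ∈ S, A (fourierSection κ μ ξ.rep u.1)).1 =
      fun x => ∑ ξ ∈ S, (A (fourierSection κ μ ξ.rep u.1)).1 x := by
    funext x
    rw [SmoothSection.coe_sum]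
  rw [h3]
  refine (h u.1 S Z).trans (mul_le_mul_of_nonneg_left ?_ hC)
  refine Real.sqrt_le_iff.2 ⟨norm_nonneg _, ?_⟩
  exact sum_le_hasSum S (fun ξ _ => mul_nonneg (sobolevWeight_nonneg _ _ _) (hsSq_nonneg _)) hu

/-- The extension of an operator with a bounded symbol to the Sobolev spaces. -/
theorem exists_sobolev_extension (hK : IsClosed (K : Set G)) (hτ : ∀ v, Continuous fun k => τ k v)
    (hA : Continuous A) (hB : IsBiInvariant B)
    (hY : ∀ i j, B (Y i) (Y j) = if i = j then 1 else 0)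
    (hsymbol : ∀ α : Fin n → ℕ, ∃ C : ℝ, ∀ (ξ : UnitaryDual G) (x : G),
      ‖multiDeriv X α (symbol κ A ξ.rep) x‖ ≤ C * (ξ.rep.weight Y) ^ m) (s : ℝ) :
    ∃ T : Sobolev Y s μ τ →L[ℂ] Sobolev Y (s - m) μ ρ,
      ∀ u : SmoothSection V τ,
        ∃ (hu : u ∈ sobolevDomain Y s μ τ) (hAu : A u ∈ sobolevDomain Y (s - m) μ ρ),
          T (u.toSobolev Y s μ hu) = (A u).toSobolev Y (s - m) μ hAu := by
  obtain ⟨C, -, h⟩ := exists_norm_apply_le μ κ A hK hτ hA hB hY hsymbol s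
  have hmem := fun u : SmoothSection V ρ => mem_sobolevDomain μ hB hY (s - m) u
  let T₀ : PreSobolev Y s μ τ →ₗ[ℂ] PreSobolev Y (s - m) μ ρ :=
    { toFun := fun u => ⟨A u.1, hmem _⟩
      map_add' := fun u v => Subtype.ext (A.map_add u.1 v.1)
      map_smul' := fun c u => Subtype.ext (A.map_smul c u.1) }
  let T₁ : PreSobolev Y s μ τ →L[ℂ] PreSobolev Y (s - m) μ ρ :=
    T₀.mkContinuous C fun u => h u (T₀ u) rfl
  refine ⟨T₁.completion, fun u => ⟨mem_sobolevDomain μ hB hY s u, hmem _, ?_⟩⟩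
  exact UniformSpace.Completion.map_coe T₁.uniformContinuous
    (⟨u, mem_sobolevDomain μ hB hY s u⟩ : PreSobolev Y s μ τ)

end SobolevNorm

end HomogeneousBundle

end

/-! ### The boundedness theorem. -/

open HomogeneousBundle in
theorem mainTheorem5
    {V : Type*} [NormedAddCommGroup V] [NormedSpace ℝ V]
    -- a compact Lie group `G` and a closed subgroup `K`, with their normalized Haar measures
    {G : Type*} [TopologicalSpace G] [ChartedSpace V G] [Group G] [LieGroup 𝓘(ℝ, V) ∞ G]
    [CompactSpace G] [T2Space G] [MeasurableSpace G] [BorelSpace G]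
    (μ : Measure G) [μ.IsHaarMeasure] [IsProbabilityMeasure μ]
    (K : Subgroup G) (hK : IsClosed (K : Set G))
    (κ : Measure K) [κ.IsHaarMeasure] [IsProbabilityMeasure κ]
    -- a bi-invariant inner product on the Lie algebra, with an orthonormal basis
    {n : ℕ} (B : LinearMap.BilinForm ℝ (GroupLieAlgebra 𝓘(ℝ, V) G)) (hB : IsBiInvariant B)
    (Y : Module.Basis (Fin n) ℝ (GroupLieAlgebra 𝓘(ℝ, V) G))
    (hY : ∀ i j, B (Y i) (Y j) = if i = j then 1 else 0)
    -- the homogeneous bundles `E`, `F` given by unitary representations of `K` on `E₀`, `F₀`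
    {E₀ : Type*} [NormedAddCommGroup E₀] [InnerProductSpace ℂ E₀] [FiniteDimensional ℂ E₀]
    {F₀ : Type*} [NormedAddCommGroup F₀] [InnerProductSpace ℂ F₀] [FiniteDimensional ℂ F₀]
    (τ : K →* (E₀ ≃ₗᵢ[ℂ] E₀)) (hτ : ∀ v, Continuous fun k => τ k v)
    (ρ : K →* (F₀ ≃ₗᵢ[ℂ] F₀)) (hρ : ∀ v, Continuous fun k => ρ k v)
    -- a continuous operator `A : Γ(E) → Γ(F)`
    (A : SmoothSection V τ →ₗ[ℂ] SmoothSection V ρ) (hA : Continuous A)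
    -- the estimates for its symbol
    (X : Module.Basis (Fin n) ℝ (GroupLieAlgebra 𝓘(ℝ, V) G)) (m : ℝ)
    (hsymbol : ∀ α : Fin n → ℕ, ∃ C : ℝ, ∀ (ξ : UnitaryDual G) (x : G),
      ‖multiDeriv X α (symbol κ A ξ.rep) x‖ ≤ C * (ξ.rep.weight Y) ^ m)
    (s : ℝ) :
    ∃ T : Sobolev Y s μ τ →L[ℂ] Sobolev Y (s - m) μ ρ,
      ∀ u : SmoothSection V τ,
        ∃ (hu : u ∈ sobolevDomain Y s μ τ) (hAu : A u ∈ sobolevDomain Y (s - m) μ ρ),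
          T (u.toSobolev Y s μ hu) = (A u).toSobolev Y (s - m) μ hAu := by
  -- As a real vector space the Lie algebra is the model space `V`, so the finite basis makes `V`
  -- finite-dimensional; with compactness of `G` this gives second countability.
  have : FiniteDimensional ℝ V := Module.Finite.of_basis Y
  have : IsTopologicalGroup G := topologicalGroup_of_lieGroup 𝓘(ℝ, V) ∞
  have : ProperSpace V := FiniteDimensional.proper ℝ V
  have : SecondCountableTopology G := ChartedSpace.secondCountable_of_sigmaCompact V G
  exact exists_sobolev_extension μ κ A hK hτ hA hB hY hsymbol s
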